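/- **Setting.** All manifolds, bundles, maps and fields are smooth and real, and finite-dimensional. Let $G$ be a semisimple Lie group with a $|k|$-grading $\mathfrak g=\mathfrak g_{-k}\oplus\cdots\oplus\mathfrak g_k$ of its Lie algebra, i.e. $[\mathfrak g_i,\mathfrak g_j]\subseteq\mathfrak g_{i+j}$ and $\mathfrak g_-=\bigoplus_{i<0}\mathfrak g_i$ is generated by $\mathfrak g_{-1}$. Put $\mathfrak g^i=\bigoplus_{j\ge i}\mathfrak g_j$. Let $P\subset G$ be a (parabolic) closed subgroup with Lie algebra $\mathfrak p=\mathfrak g^0$, let $G_0\subset P$ be the subgroup of elements whose adjoint action preserves every $\mathfrak g_i$, and let $P_+=\exp(\mathfrak g^1)$. Fix a scale representation: an element $E_\lambda$ of the centre of $\mathfrak g_0$ such that $\mathrm{ad}(E_\lambda)$ acts on each $\mathfrak g_i$ by a scalar, nonzero for $i\neq0$, and a representation $\lambda:G_0\to\mathbb R_+$ with $\lambda'(A)=B(E_\lambda,A)$, where $B$ is the Killing form of $\mathfrak g$. Let $\mathcal M=(M,\{T^iM\},\mathcal G_0)$ be a regular infinitesimal flag structure of type $(\mathfrak g,P)$.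 That is, $TM=T^{-k}M\supseteq\cdots\supseteq T^{-1}M\supseteq T^0M=0$ is a filtration by subbundles with $\mathrm{rk}(T^iM)=\dim(\mathfrak g^i/\mathfrak p)$, $\mathcal G_0\to M$ is a reduction of the structure group of $\mathrm{gr}(TM)$ to $G_0$, one has $[\Gamma(T^iM),\Gamma(T^jM)]\subseteq\Gamma(T^{i+j}M)$, and the frames in $\mathcal G_0$ identify the induced bracket on $\mathrm{gr}(T_xM)$ with the bracket of $\mathfrak g_-$. Let $(\mathcal G\to M,\omega)$ be a regular normal parabolic geometry of type $(G,P)$ inducing $\mathcal M$, with projection $\pi_+:\mathcal G\to\mathcal G/P_+=\mathcal G_0$. Let $X\in\mathrm{inf}(\mathcal M)$ be an infinitesimal automorphism: a vector field on $M$ with $[X,\Gamma(T^iM)]\subseteq\Gamma(T^iM)$ for all $i$, whose local flows, acting on frames of $\mathrm{gr}(TM)$, preserve $\mathcal G_0$. It induces $G_0$-invariant and $\mathbb R_+$-invariant vector fields $\mathbf X_0$ on $\mathcal G_0$ and $\mathbf X_\lambda$ on the $\mathbb R_+$-principal bundle of scales $\mathcal L^\lambda=\mathcal G_0\times_\lambda\mathbb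 R_+$. For $U\subseteq M$ open, a Weyl structure over $U$ is a $G_0$-equivariant section $\sigma:\mathcal G_0|_U\to\mathcal G|_U$ of $\pi_+$. It is exact if the principal connection on $\mathcal L^\lambda|_U$ induced by $\lambda'\circ\sigma^*\omega_0$, where $\omega_0$ is the $\mathfrak g_0$-component of $\omega$, is the trivial connection defined by a section $s_\sigma$ of $\mathcal L^\lambda$ over $U$ (a scale). The restriction of $X$ to $U$ is *inessential* if there is an exact Weyl structure $\sigma$ over $U$ with a corresponding scale $s_\sigma$ such that $\mathcal L_Xs_\sigma=\frac{d}{dt}\big|_{t=0}\,\Phi_{\mathbf X_\lambda,t}^{-1}\circ s_\sigma\circ\varphi_{X,t}=0$ on $U$, where $\Phi_{\mathbf X_\lambda,t}$ and $\varphi_{X,t}$ are the local flows of $\mathbf X_\lambda$ and $X$. **Proposition.** Let $x\in M$. If $X(x)\neq0$, then there exists an open neighbourhood $U$ of $x$ such that the restriction of $X$ to $U$ is inessential. -/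

import Mathlib

open scoped Manifold ContDiff

namespace Parabolic

noncomputable section

/-- Over `ℝ` a smooth Lie group meets the smoothness requirement under which Mathlib provides the
Lie algebra structure on `GroupLieAlgebra`. -/
instance instLieGroupMinSmoothness {n : ℕ} {G : Type*} [TopologicalSpace G]
    [ChartedSpace (EuclideanSpace ℝ (Fin n)) G] [Group G] [LieGroup (𝓡 n) ∞ G] :
    LieGroup (𝓡 n) (minSmoothness ℝ 3) G :=
  LieGroup.of_le (n := ∞) (by
    rw [minSmoothness_of_isRCLikeNormedField]
    exact ENat.LEInfty.out)

/-! ### Vector fields and Lie groups -/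

/-- `Y` is a smooth vector field on the set `V` (used for open `V`; the values of `Y` outside `V`
are irrelevant). -/
def SmoothFieldOn {m : ℕ} {M : Type*} [TopologicalSpace M]
    [ChartedSpace (EuclideanSpace ℝ (Fin m)) M] [IsManifold (𝓡 m) ∞ M]
    (V : Set M) (Y : (x : M) → TangentSpace (𝓡 m) x) : Prop :=
  ContMDiffOn (𝓡 m) (𝓡 m).tangent ∞ (fun x => (⟨x, Y x⟩ : TangentBundle (𝓡 m) M)) V

/-- The differential `df_x : T_x M → ℝ` of a real-valued function. -/
def differential {m : ℕ} {M : Type*} [TopologicalSpace M]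
    [ChartedSpace (EuclideanSpace ℝ (Fin m)) M] (f : M → ℝ) (x : M) :
    TangentSpace (𝓡 m) x →L[ℝ] ℝ :=
  mfderiv (𝓡 m) 𝓘(ℝ, ℝ) f x

section LieGroups

variable {nG : ℕ} {G : Type*} [TopologicalSpace G] [ChartedSpace (EuclideanSpace ℝ (Fin nG)) G]
  [Group G] [LieGroup (𝓡 nG) ∞ G]

/-- The adjoint representation: `Ad g` is the derivative at `1` of the conjugation by `g`. -/
def Ad (g : G) : GroupLieAlgebra (𝓡 nG) G →L[ℝ] GroupLieAlgebra (𝓡 nG) G :=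
  mfderiv (𝓡 nG) (𝓡 nG) (fun h : G => g * h * g⁻¹) (1 : G)

/-- `γ` is the smooth one-parameter subgroup of `G` with initial velocity `Z`,
i.e. `γ t = exp (t Z)`. -/
def IsOneParameterSubgroup (Z : GroupLieAlgebra (𝓡 nG) G) (γ : ℝ → G) : Prop :=
  ContMDiff 𝓘(ℝ, ℝ) (𝓡 nG) ∞ γ ∧ (∀ s t, γ (s + t) = γ s * γ t) ∧
    (mfderiv 𝓘(ℝ, ℝ) (𝓡 nG) γ 0 : ℝ →L[ℝ] GroupLieAlgebra (𝓡 nG) G) 1 = Z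

/-- An element of the Lie algebra of `G`, regarded as a vector of the model space. -/
def toModel (A : GroupLieAlgebra (𝓡 nG) G) : EuclideanSpace ℝ (Fin nG) := A

/-- The differential `dφ_x : T_x M → 𝔤` of a `𝔤`-valued function. -/
def lieDifferential {m : ℕ} {M : Type*} [TopologicalSpace M]
    [ChartedSpace (EuclideanSpace ℝ (Fin m)) M] (φ : M → GroupLieAlgebra (𝓡 nG) G) (x : M) :
    TangentSpace (𝓡 m) x →L[ℝ] GroupLieAlgebra (𝓡 nG) G :=
  mfderiv (𝓡 m) (𝓡 nG) (fun y => toModel (φ y)) x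

variable {nH : ℕ} {H : Type*} [TopologicalSpace H] [ChartedSpace (EuclideanSpace ℝ (Fin nH)) H]
  [Group H] [LieGroup (𝓡 nH) ∞ H]

variable (nH nG) in
/-- The differential at the identity of a homomorphism of Lie groups, as a map of Lie algebras. -/
def lieMap (f : H →* G) : GroupLieAlgebra (𝓡 nH) H →L[ℝ] GroupLieAlgebra (𝓡 nG) G :=
  mfderiv (𝓡 nH) (𝓡 nG) f (1 : H)

variable (nH nG) in
/-- `f` realizes the Lie group `H` as a closed (embedded) Lie subgroup of `G`. -/
structure IsClosedLieSubgroup (f : H →* G) : Prop where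
  contMDiff : ContMDiff (𝓡 nH) (𝓡 nG) ∞ f
  isClosedEmbedding : Topology.IsClosedEmbedding f
  injective_lieMap : Function.Injective (lieMap nG nH f)

end LieGroups

/-! ### Parabolic types -/

/-- A parabolic type `(G, P)`: a semisimple Lie group `G` with a `|k|`-grading
`𝔤 = 𝔤_{-k} ⊕ ⋯ ⊕ 𝔤_k` of its Lie algebra, and a closed subgroup `P` with Lie algebra
`𝔭 = 𝔤_0 ⊕ ⋯ ⊕ 𝔤_k`, together with the subgroup `G₀` of those elements of `P` whose adjoint
action preserves the grading. -/
structure ParabolicType (nG nP n0 : ℕ) (G P G₀ : Type*)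
    [TopologicalSpace G] [ChartedSpace (EuclideanSpace ℝ (Fin nG)) G] [Group G]
    [LieGroup (𝓡 nG) ∞ G]
    [TopologicalSpace P] [ChartedSpace (EuclideanSpace ℝ (Fin nP)) P] [Group P]
    [LieGroup (𝓡 nP) ∞ P]
    [TopologicalSpace G₀] [ChartedSpace (EuclideanSpace ℝ (Fin n0)) G₀] [Group G₀]
    [LieGroup (𝓡 n0) ∞ G₀] where
  semisimple : LieAlgebra.IsSemisimple ℝ (GroupLieAlgebra (𝓡 nG) G)
  k : ℕ
  /-- the grading component `𝔤_i` -/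
  gr : ℤ → Submodule ℝ (GroupLieAlgebra (𝓡 nG) G)
  isInternal : DirectSum.IsInternal gr
  gr_eq_bot : ∀ i : ℤ, (k : ℤ) < |i| → gr i = ⊥
  lie_mem : ∀ (i j : ℤ), ∀ A ∈ gr i, ∀ B ∈ gr j, ⁅A, B⁆ ∈ gr (i + j)
  /-- `𝔤_- = 𝔤_{-k} ⊕ ⋯ ⊕ 𝔤_{-1}` is generated by `𝔤_{-1}` -/
  generated : (LieSubalgebra.lieSpan ℝ (GroupLieAlgebra (𝓡 nG) G)
    (gr (-1) : Set (GroupLieAlgebra (𝓡 nG) G))).toSubmodule = ⨆ i : ℤ, ⨆ _ : i < 0, gr i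
  /-- the inclusion of `P` into `G` -/
  ι : P →* G
  closed_P : IsClosedLieSubgroup nG nP ι
  lie_P : LinearMap.range (lieMap nG nP ι).toLinearMap = ⨆ i : ℤ, ⨆ _ : 0 ≤ i, gr i
  /-- the inclusion of `G₀` into `P` -/
  j : G₀ →* P
  closed_G₀ : IsClosedLieSubgroup nP n0 j
  range_j : Set.range j = {p : P | ∀ i : ℤ, ∀ A ∈ gr i, Ad (ι p) A ∈ gr i}

/-! ### Principal bundles -/

/-- A smooth principal bundle `E → M` with structure group `H`, acting from the right.
Local triviality is expressed by a local smooth section `e` and the smooth `H`-component `τ` of the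
trivialization `(y, h) ↦ e(y)·h`. -/
structure PrincipalBundle (nH nE m : ℕ) (H E M : Type*)
    [TopologicalSpace H] [ChartedSpace (EuclideanSpace ℝ (Fin nH)) H] [Group H]
    [LieGroup (𝓡 nH) ∞ H]
    [TopologicalSpace E] [ChartedSpace (EuclideanSpace ℝ (Fin nE)) E] [IsManifold (𝓡 nE) ∞ E]
    [TopologicalSpace M] [ChartedSpace (EuclideanSpace ℝ (Fin m)) M] [IsManifold (𝓡 m) ∞ M] where
  proj : E → M
  act : E → H → E
  contMDiff_proj : ContMDiff (𝓡 nE) (𝓡 m) ∞ proj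
  contMDiff_act : ContMDiff ((𝓡 nE).prod (𝓡 nH)) (𝓡 nE) ∞ (fun q : E × H => act q.1 q.2)
  act_one : ∀ u, act u 1 = u
  act_mul : ∀ u g h, act (act u g) h = act u (g * h)
  proj_act : ∀ u h, proj (act u h) = proj u
  locallyTrivial : ∀ x : M, ∃ (V : Set M) (e : M → E) (τ : E → H), IsOpen V ∧ x ∈ V ∧
    ContMDiffOn (𝓡 m) (𝓡 nE) ∞ e V ∧ ContMDiffOn (𝓡 nE) (𝓡 nH) ∞ τ (proj ⁻¹' V) ∧
    (∀ y ∈ V, proj (e y) = y) ∧ (∀ u, proj u ∈ V → act (e (proj u)) (τ u) = u) ∧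
    (∀ y ∈ V, ∀ h, τ (act (e y) h) = h)

section Geometry

variable {nG nP n0 m b b0 : ℕ} {G P G₀ M B B₀ : Type*}
  [TopologicalSpace G] [ChartedSpace (EuclideanSpace ℝ (Fin nG)) G] [Group G]
  [LieGroup (𝓡 nG) ∞ G]
  [TopologicalSpace P] [ChartedSpace (EuclideanSpace ℝ (Fin nP)) P] [Group P]
  [LieGroup (𝓡 nP) ∞ P]
  [TopologicalSpace G₀] [ChartedSpace (EuclideanSpace ℝ (Fin n0)) G₀] [Group G₀]
  [LieGroup (𝓡 n0) ∞ G₀]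
  [TopologicalSpace M] [ChartedSpace (EuclideanSpace ℝ (Fin m)) M] [IsManifold (𝓡 m) ∞ M]
  [TopologicalSpace B] [ChartedSpace (EuclideanSpace ℝ (Fin b)) B] [IsManifold (𝓡 b) ∞ B]
  [TopologicalSpace B₀] [ChartedSpace (EuclideanSpace ℝ (Fin b0)) B₀] [IsManifold (𝓡 b0) ∞ B₀]

namespace ParabolicType

/-- The filtration component `𝔤^i = 𝔤_i ⊕ ⋯ ⊕ 𝔤_k`. -/
def filt (T : ParabolicType nG nP n0 G P G₀) (i : ℤ) : Submodule ℝ (GroupLieAlgebra (𝓡 nG) G) :=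
  ⨆ l : ℤ, ⨆ _ : i ≤ l, T.gr l

theorem coeLinearMap_bijective (T : ParabolicType nG nP n0 G P G₀) :
    Function.Bijective (DirectSum.coeLinearMap T.gr) :=
  T.isInternal

/-- The component of `A ∈ 𝔤` in `𝔤_i`. -/
def comp (T : ParabolicType nG nP n0 G P G₀) (i : ℤ) (A : GroupLieAlgebra (𝓡 nG) G) :
    GroupLieAlgebra (𝓡 nG) G :=
  ((LinearEquiv.ofBijective (DirectSum.coeLinearMap T.gr) T.coeLinearMap_bijective).symm A) i

/-- The subgroup `P₊ = exp (𝔭₊)` of `P`, where `𝔭₊ = 𝔤_1 ⊕ ⋯ ⊕ 𝔤_k`. -/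
def Pplus (T : ParabolicType nG nP n0 G P G₀) : Set P :=
  {p | ∃ Z ∈ T.filt 1, ∃ γ : ℝ → G, IsOneParameterSubgroup Z γ ∧ γ 1 = T.ι p}

end ParabolicType

/-- The datum defining a bundle of scales: an element `E_λ` of the centre of `𝔤_0` acting by a
scalar on each `𝔤_i` (nonzero for `i ≠ 0`), and a smooth representation `λ : G₀ → ℝ_+` whose
derivative is `A ↦ B(E_λ, A)`, with `B` the Killing form of `𝔤`. -/
structure ScaleRep (T : ParabolicType nG nP n0 G P G₀) where
  E : GroupLieAlgebra (𝓡 nG) G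
  E_mem : E ∈ T.gr 0
  E_central : ∀ A ∈ T.gr 0, ⁅E, A⁆ = 0
  E_scalar : ∀ i : ℤ, ∃ c : ℝ, (i ≠ 0 → c ≠ 0) ∧ ∀ A ∈ T.gr i, ⁅E, A⁆ = c • A
  lam : G₀ →* ℝ
  lam_pos : ∀ g, 0 < lam g
  contMDiff_lam : ContMDiff (𝓡 n0) 𝓘(ℝ, ℝ) ∞ lam
  deriv_lam : ∀ A : GroupLieAlgebra (𝓡 n0) G₀,
    differential (m := n0) lam (1 : G₀) A =
      killingForm ℝ (GroupLieAlgebra (𝓡 nG) G) E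
        (lieMap nG nP T.ι (lieMap nP n0 T.j A))

/-! ### Infinitesimal flag structures -/

/-- The preimage `T^i E` in `T E` of a filtration `T^i M` of the tangent bundle of the base of a
principal bundle `E → M`. -/
def liftFilt {nH nE : ℕ} {H E : Type*}
    [TopologicalSpace H] [ChartedSpace (EuclideanSpace ℝ (Fin nH)) H] [Group H]
    [LieGroup (𝓡 nH) ∞ H]
    [TopologicalSpace E] [ChartedSpace (EuclideanSpace ℝ (Fin nE)) E] [IsManifold (𝓡 nE) ∞ E]
    (π : PrincipalBundle nH nE m H E M) (F : ℤ → (x : M) → Submodule ℝ (TangentSpace (𝓡 m) x))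
    (i : ℤ) (u : E) : Submodule ℝ (TangentSpace (𝓡 nE) u) :=
  (F i (π.proj u)).comap (mfderiv (𝓡 nE) (𝓡 m) π.proj u).toLinearMap

/-- An infinitesimal flag structure `(M, {T^i M}, 𝒢₀)` of type `(𝔤, P)`: a filtration of `TM` by
smooth subbundles with `rk T^i M = dim (𝔤^i/𝔭)`, and a reduction `𝒢₀ → M` of the structure group of
`gr(TM)` to `G₀`.  The reduction is a principal `G₀`-bundle in which every point `u` over `x`
determines a graded linear isomorphism `gr(T_x M) ≅ 𝔤_-`, depending smoothly and
`G₀`-equivariantly on `u`; its component of degree `i < 0` is recorded by the form `θ i u`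
(soldering form), a map `T^i_u 𝒢₀ → 𝔤_i` with kernel `T^{i+1}_u 𝒢₀`.  Only the restriction of
`θ i u` to `T^i_u 𝒢₀`, for `i < 0`, is meaningful. -/
structure FlagStructure (T : ParabolicType nG nP n0 G P G₀) (m b0 : ℕ) (M B₀ : Type*)
    [TopologicalSpace M] [ChartedSpace (EuclideanSpace ℝ (Fin m)) M] [IsManifold (𝓡 m) ∞ M]
    [TopologicalSpace B₀] [ChartedSpace (EuclideanSpace ℝ (Fin b0)) B₀]
    [IsManifold (𝓡 b0) ∞ B₀] where
  /-- the subspace `T^i_x M` of `T_x M` -/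
  F : ℤ → (x : M) → Submodule ℝ (TangentSpace (𝓡 m) x)
  F_antitone : ∀ i l x, i ≤ l → F l x ≤ F i x
  F_neg_k : ∀ x, F (-(T.k : ℤ)) x = ⊤
  F_zero : ∀ x, F 0 x = ⊥
  F_rank : ∀ (i : ℤ) (x : M), i ≤ 0 →
    Module.finrank ℝ (F i x) + Module.finrank ℝ (T.filt 0) = Module.finrank ℝ (T.filt i)
  F_smooth : ∀ (i : ℤ) (x : M), ∀ v ∈ F i x,
    ∃ (V : Set M) (Y : (y : M) → TangentSpace (𝓡 m) y), IsOpen V ∧ x ∈ V ∧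
      SmoothFieldOn V Y ∧ (∀ y ∈ V, Y y ∈ F i y) ∧ Y x = v
  /-- the principal `G₀`-bundle `𝒢₀ → M` -/
  π₀ : PrincipalBundle n0 b0 m G₀ B₀ M
  θ : ℤ → (u : B₀) → TangentSpace (𝓡 b0) u →ₗ[ℝ] GroupLieAlgebra (𝓡 nG) G
  θ_range : ∀ i < 0, ∀ u, (liftFilt π₀ F i u).map (θ i u) = T.gr i
  θ_ker : ∀ i < 0, ∀ u, ∀ ξ ∈ liftFilt π₀ F i u, θ i u ξ = 0 ↔ ξ ∈ liftFilt π₀ F (i + 1) u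
  θ_equivariant : ∀ i < 0, ∀ (u : B₀) (g : G₀), ∀ ξ ∈ liftFilt π₀ F i u,
    θ i (π₀.act u g) (mfderiv (𝓡 b0) (𝓡 b0) (fun v => π₀.act v g) u ξ) =
      Ad (T.ι (T.j g))⁻¹ (θ i u ξ)
  θ_smooth : ∀ i < 0, ∀ (V : Set B₀) (ξ : (u : B₀) → TangentSpace (𝓡 b0) u), IsOpen V →
    SmoothFieldOn V ξ → (∀ u ∈ V, ξ u ∈ liftFilt π₀ F i u) →
    ContMDiffOn (𝓡 b0) (𝓡 nG) ∞
      (fun u => toModel (θ i u (ξ u))) V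

namespace FlagStructure

variable {T : ParabolicType nG nP n0 G P G₀}

/-- The flag structure is regular: the Lie bracket of vector fields satisfies
`[Γ(T^i M), Γ(T^j M)] ⊆ Γ(T^{i+j} M)`, and the bracket thus induced on `gr(T_x M)` is carried to the
Lie bracket of `𝔤_-` by the isomorphisms `gr(T_x M) ≅ 𝔤_-` belonging to `𝒢₀`. -/
structure IsRegular (S : FlagStructure T m b0 M B₀) : Prop where
  bracket_mem : ∀ i < 0, ∀ l < 0, ∀ (V : Set M) (Y Z : (x : M) → TangentSpace (𝓡 m) x),
    IsOpen V → SmoothFieldOn V Y → SmoothFieldOn V Z →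
    (∀ x ∈ V, Y x ∈ S.F i x) → (∀ x ∈ V, Z x ∈ S.F l x) →
    ∀ x ∈ V, VectorField.mlieBracket (𝓡 m) Y Z x ∈ S.F (i + l) x
  bracket_gr : ∀ i < 0, ∀ l < 0, ∀ (V : Set B₀) (ξ η : (u : B₀) → TangentSpace (𝓡 b0) u),
    IsOpen V → SmoothFieldOn V ξ → SmoothFieldOn V η →
    (∀ u ∈ V, ξ u ∈ liftFilt S.π₀ S.F i u) → (∀ u ∈ V, η u ∈ liftFilt S.π₀ S.F l u) →
    ∀ u ∈ V, S.θ (i + l) u (VectorField.mlieBracket (𝓡 b0) ξ η u) =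
      ⁅S.θ i u (ξ u), S.θ l u (η u)⁆

/-- An infinitesimal automorphism `X ∈ inf(𝓜)` of the flag structure: a smooth vector field `X` on
`M` with `[X, Γ(T^i M)] ⊆ Γ(T^i M)` whose local flows, acting on the frames of `gr(TM)`, preserve
`𝒢₀`.  The vector field `X₀` on `𝒢₀` generating the induced flow is included in the data: it is
the `G₀`-invariant lift of `X` preserving the soldering forms, `ℒ_{X₀} θ_i = 0`. -/
structure InfAut (S : FlagStructure T m b0 M B₀) where
  X : (x : M) → TangentSpace (𝓡 m) x
  smooth : SmoothFieldOn Set.univ X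
  bracket_mem : ∀ (i : ℤ) (V : Set M) (Y : (x : M) → TangentSpace (𝓡 m) x), IsOpen V →
    SmoothFieldOn V Y → (∀ x ∈ V, Y x ∈ S.F i x) →
    ∀ x ∈ V, VectorField.mlieBracket (𝓡 m) X Y x ∈ S.F i x
  X₀ : (u : B₀) → TangentSpace (𝓡 b0) u
  smooth₀ : SmoothFieldOn Set.univ X₀
  lifts : ∀ u, mfderiv (𝓡 b0) (𝓡 m) S.π₀.proj u (X₀ u) = X (S.π₀.proj u)
  invariant : ∀ u g,
    mfderiv (𝓡 b0) (𝓡 b0) (fun v => S.π₀.act v g) u (X₀ u) = X₀ (S.π₀.act u g)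
  preserves : ∀ i < 0, ∀ (V : Set B₀) (ξ : (u : B₀) → TangentSpace (𝓡 b0) u), IsOpen V →
    SmoothFieldOn V ξ → (∀ u ∈ V, ξ u ∈ liftFilt S.π₀ S.F i u) → ∀ u ∈ V,
    lieDifferential (fun v => S.θ i v (ξ v)) u (X₀ u) =
      S.θ i u (VectorField.mlieBracket (𝓡 b0) X₀ ξ u)

end FlagStructure

/-! ### Parabolic geometries -/

/-- A parabolic geometry `(𝒢 → M, ω)` of type `(G, P)`: a principal `P`-bundle with a Cartan
connection `ω`. -/
structure Geometry (T : ParabolicType nG nP n0 G P G₀) (m b : ℕ) (M B : Type*)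
    [TopologicalSpace M] [ChartedSpace (EuclideanSpace ℝ (Fin m)) M] [IsManifold (𝓡 m) ∞ M]
    [TopologicalSpace B] [ChartedSpace (EuclideanSpace ℝ (Fin b)) B]
    [IsManifold (𝓡 b) ∞ B] where
  /-- the principal `P`-bundle `𝒢 → M` -/
  π : PrincipalBundle nP b m P B M
  form : (u : B) → TangentSpace (𝓡 b) u →ₗ[ℝ] GroupLieAlgebra (𝓡 nG) G
  form_smooth : ContMDiff (𝓡 b).tangent (𝓡 nG) ∞
    (fun q : TangentBundle (𝓡 b) B => toModel (form q.1 q.2))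
  form_equivariant : ∀ (u : B) (p : P) (ξ : TangentSpace (𝓡 b) u),
    form (π.act u p) (mfderiv (𝓡 b) (𝓡 b) (fun v => π.act v p) u ξ) = Ad (T.ι p)⁻¹ (form u ξ)
  form_fundamental : ∀ (u : B) (A : GroupLieAlgebra (𝓡 nP) P),
    form (π.act u 1) (mfderiv (𝓡 nP) (𝓡 b) (fun p : P => π.act u p) 1 A) = lieMap nG nP T.ι A
  form_bijective : ∀ u, Function.Bijective (form u)

namespace Geometry

variable {T : ParabolicType nG nP n0 G P G₀}

/-- The constant vector field `ω⁻¹(A)` on `𝒢`. -/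
def constField (C : Geometry T m b M B) (A : GroupLieAlgebra (𝓡 nG) G) (u : B) :
    TangentSpace (𝓡 b) u :=
  (LinearEquiv.ofBijective (C.form u) (C.form_bijective u)).symm A

/-- The curvature function `κ(u)(A, A') = dω(ω⁻¹A, ω⁻¹A') + [A, A'] = [A, A'] - ω([ω⁻¹A, ω⁻¹A'])`
of the Cartan connection. -/
def curvature (C : Geometry T m b M B) (u : B) (A A' : GroupLieAlgebra (𝓡 nG) G) :
    GroupLieAlgebra (𝓡 nG) G :=
  ⁅A, A'⁆ - C.form u (VectorField.mlieBracket (𝓡 b) (C.constField A) (C.constField A') u)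

/-- Regularity: the curvature has strictly positive homogeneity. -/
def IsRegular (C : Geometry T m b M B) : Prop :=
  ∀ (u : B) (i l : ℤ), ∀ A ∈ T.filt i, ∀ A' ∈ T.filt l, C.curvature u A A' ∈ T.filt (i + l + 1)

/-- Normality: `∂^* κ = 0` for the Kostant codifferential
`(∂^* κ)(A) = 2 ∑ₐ [Zₐ, κ(A, Aₐ)] - ∑ₐ κ([Zₐ, A], Aₐ)`, where `Aₐ` is a basis of `𝔤_-` and `Zₐ` the
basis of `𝔭₊` dual to it under the Killing form. -/
def IsNormal (C : Geometry T m b M B) : Prop :=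
  ∀ (d : ℕ) (Xb Zb : Fin d → GroupLieAlgebra (𝓡 nG) G),
    LinearIndependent ℝ Xb → Submodule.span ℝ (Set.range Xb) = (⨆ i : ℤ, ⨆ _ : i < 0, T.gr i) →
    (∀ a, Zb a ∈ T.filt 1) →
    (∀ a c, killingForm ℝ (GroupLieAlgebra (𝓡 nG) G) (Zb a) (Xb c) = if a = c then 1 else 0) →
    ∀ (u : B) (A : GroupLieAlgebra (𝓡 nG) G),
      (2 : ℝ) • ∑ a, ⁅Zb a, C.curvature u A (Xb a)⁆ - ∑ a, C.curvature u ⁅Zb a, A⁆ (Xb a) = 0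

/-- The parabolic geometry `(𝒢 → M, ω)` induces the flag structure `(M, {T^i M}, 𝒢₀)`, with
projection `q = π_+ : 𝒢 → 𝒢₀`: the map `q` identifies `𝒢/P₊` with `𝒢₀` as principal `G₀`-bundle over
`M`, `T^i M` corresponds to `𝔤^i/𝔭` under `ω`, and the frames of `gr(TM)` given by `𝒢₀` are those
defined by `ω`. -/
structure Induces (C : Geometry T m b M B) (S : FlagStructure T m b0 M B₀) (q : B → B₀) : Prop where
  contMDiff : ContMDiff (𝓡 b) (𝓡 b0) ∞ q
  proj_q : ∀ u, S.π₀.proj (q u) = C.π.proj u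
  q_act : ∀ u g, q (C.π.act u (T.j g)) = S.π₀.act (q u) g
  q_eq_iff : ∀ u v, q u = q v ↔ ∃ p ∈ T.Pplus, v = C.π.act u p
  filt_iff : ∀ i ≤ 0, ∀ (u : B) (ξ : TangentSpace (𝓡 b) u),
    ξ ∈ liftFilt C.π S.F i u ↔ C.form u ξ ∈ T.filt i
  frames : ∀ i < 0, ∀ (u : B) (ξ : TangentSpace (𝓡 b) u), C.form u ξ ∈ T.filt i →
    S.θ i (q u) (mfderiv (𝓡 b) (𝓡 b0) q u ξ) = T.comp i (C.form u ξ)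

/-- A Weyl structure over `U ⊆ M`: a smooth `G₀`-equivariant section `σ` of `q : 𝒢 → 𝒢₀` over `U`
(the values of `σ` outside of the preimage of `U` are irrelevant). -/
structure IsWeylStructureOn (C : Geometry T m b M B) (S : FlagStructure T m b0 M B₀) (q : B → B₀)
    (U : Set M) (σ : B₀ → B) : Prop where
  contMDiffOn : ContMDiffOn (𝓡 b0) (𝓡 b) ∞ σ (S.π₀.proj ⁻¹' U)
  section_q : ∀ u, S.π₀.proj u ∈ U → q (σ u) = u
  equivariant : ∀ u g, S.π₀.proj u ∈ U → σ (S.π₀.act u g) = C.π.act (σ u) (T.j g)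

end Geometry

/-! ### Scales, exact Weyl structures and essentiality -/

variable {T : ParabolicType nG nP n0 G P G₀}

/-- A scale over `U`, that is, a smooth section `s` over `U` of the `ℝ_+`-principal bundle
`ℒ^λ = 𝒢₀ ×_λ ℝ_+ → M`, given in the standard manner by the equivariant function
`f : 𝒢₀|_U → ℝ_+` with `s(x) = [u, f(u)]` for all `u` over `x`, i.e. `f(u·g) = λ(g)⁻¹ f(u)`. -/
structure IsScaleOn (R : ScaleRep T) (S : FlagStructure T m b0 M B₀) (U : Set M) (f : B₀ → ℝ) :
    Prop where
  contMDiffOn : ContMDiffOn (𝓡 b0) 𝓘(ℝ, ℝ) ∞ f (S.π₀.proj ⁻¹' U)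
  pos : ∀ u, S.π₀.proj u ∈ U → 0 < f u
  equivariant : ∀ u g, S.π₀.proj u ∈ U → f (S.π₀.act u g) = (R.lam g)⁻¹ * f u

/-- The principal connection `σ^λ` which a Weyl structure `σ` induces on `ℒ^λ` is the trivial
connection for which the section given by `f` is parallel.  Pulled back to `𝒢₀`, the former is
`λ' ∘ σ^*ω_0`, with `λ' = B(E_λ, ·)`, and the latter is `-df/f`. -/
def InducesConnection (C : Geometry T m b M B) (R : ScaleRep T) (S : FlagStructure T m b0 M B₀) (U : Set M)
    (σ : B₀ → B) (f : B₀ → ℝ) : Prop :=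
  ∀ (u : B₀), S.π₀.proj u ∈ U → ∀ ξ : TangentSpace (𝓡 b0) u,
    killingForm ℝ (GroupLieAlgebra (𝓡 nG) G) R.E
        (T.comp 0 (C.form (σ u) (mfderiv (𝓡 b0) (𝓡 b) σ u ξ))) =
      -(differential f u ξ) / f u

/-- `σ` is an exact Weyl structure over `U` and `f` is (the function representing) a corresponding
scale `s_σ`. -/
structure IsExactWeylStructureOn (C : Geometry T m b M B) (R : ScaleRep T) (S : FlagStructure T m b0 M B₀)
    (q : B → B₀) (U : Set M) (σ : B₀ → B) (f : B₀ → ℝ) : Prop where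
  weyl : C.IsWeylStructureOn S q U σ
  scale : IsScaleOn R S U f
  trivial : InducesConnection C R S U σ f

/-- The Lie derivative at `u` of the scale given by `f`: if `Φ_{0,t}` is the flow of `X₀`, then the
scale `Φ_{λ,t}⁻¹ ∘ s ∘ φ_t` is given by `f ∘ Φ_{0,t}`, whose `t`-derivative at `0` is `df(X₀)`. -/
def lieDerivScale {S : FlagStructure T m b0 M B₀} (X : S.InfAut) (f : B₀ → ℝ) (u : B₀) : ℝ :=
  differential f u (X.X₀ u)

/-- The restriction of `X` to `U` is inessential: it is an exact infinitesimal automorphism of some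
exact Weyl structure `σ` over `U`, i.e. `ℒ_X s_σ = 0`. -/
def InessentialOn (C : Geometry T m b M B) (R : ScaleRep T) {S : FlagStructure T m b0 M B₀} (q : B → B₀)
    (X : S.InfAut) (U : Set M) : Prop :=
  ∃ (σ : B₀ → B) (f : B₀ → ℝ), IsExactWeylStructureOn C R S q U σ f ∧
    ∀ u, S.π₀.proj u ∈ U → lieDerivScale X f u = 0

end Geometry

end

end Parabolic

/-!
Near a point where `X` does not vanish the required exact Weyl structure is built by hand, starting
from the scale.

*The scale.* Let `e₀` be a local section of `𝒢₀ → M` and write points of `𝒢₀` as `e₀(y) · τ`.  Any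
function `h` on the base gives a scale, represented by `f = exp (h - log λ(τ))`.  Since `X₀` is
`G₀`-invariant, `d(log λ(τ))(X₀)` is the pull-back of a function `c` on the base, so that
`ℒ_X s = 0` becomes the equation `dh(X) = c`.  It is solvable near a point where `X` does not vanish
by straightening the field (`exists_fderiv_apply_eq`).

*The Weyl structure.* It remains to find a Weyl structure whose induced connection on `ℒ^λ` is the
one for which this scale is parallel.  A Weyl structure over a neighbourhood is the same as a local
section `s` of `𝒢 → M` over `e₀`, extended equivariantly, and the condition reads
`B(E_λ, s^*ω) = -dh` (`killingForm_formAt_extension`; it uses that `G₀` fixes `E_λ`).  For an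
arbitrary section `s` there is a unique function `Z` with values in `𝔤^1 = 𝔭^⊥` such that
`B(E_λ + Z, s^*ω) = -dh`, because `s^*ω` identifies `TM` with `𝔤/𝔭`
(`Geometry.IsLiftOn.exists_potential`).  Replacing `s` by `s · p`, with `p` a function into `P₊`,
replaces `Z` by `Ad(p)⁻¹(E_λ + Z) - E_λ`: the logarithmic derivative of `p` has values in `𝔤^1`
(`ParabolicType.lieMap_mem_filt_one`), which is orthogonal to `𝔤^0`.  As `ad E_λ` is invertible on
each `𝔤_i` with `i > 0`, acting with the exponential of a suitable `𝔤_i`-valued function moves `Z`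
from `𝔤^i` to `𝔤^{i+1}` (`Geometry.IsLiftOn.exists_improvement`), and after `k` steps `Z = 0`
(`Geometry.IsLiftOn.exists_normalized`).

*Prerequisites.* The argument needs some Lie theory and analysis: smooth dependence of the flow of a
vector field on initial values (`exists_local_flow`, by applying the inverse function theorem to the
integral equation in a space of continuous curves), the smooth exponential map of a Lie group
(`exists_smooth_exp`), and the adjoint representation together with its derivative
(`Ad_lie`, `hasDerivAt_modelAd_of_eq_one`).  The orthogonality relations of the grading rest on the
nondegeneracy of the Killing form, which is Cartan's criterion.
-/

open scoped Manifold ContDiff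

namespace Parabolic

/-! ### Smooth dependence of solutions of ordinary differential equations -/

open Topology in
/-- The inverse function theorem for a map which is smooth near a point, with an inverse that is
smooth on its whole domain. -/
theorem exists_smooth_local_inverse {E F : Type*} [NormedAddCommGroup E] [NormedSpace ℝ E]
    [NormedAddCommGroup F] [NormedSpace ℝ F] [CompleteSpace E] {f : E → F} {U : Set E}
    (hU : IsOpen U) (hf : ContDiffOn ℝ ∞ f U) {a : E} (ha : a ∈ U) (f' : E ≃L[ℝ] F)
    (hf' : HasFDerivAt f (f' : E →L[ℝ] F) a) :
    ∃ e : OpenPartialHomeomorph E F, a ∈ e.source ∧ e.source ⊆ U ∧ (∀ y, e y = f y) ∧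
      ContDiffOn ℝ ∞ e.symm e.target := by
  have h0 : (∞ : WithTop ℕ∞) ≠ 0 := by simp
  have hfa : ContDiffAt ℝ ∞ f a := hf.contDiffAt (hU.mem_nhds ha)
  let e := hfa.toOpenPartialHomeomorph f hf' h0
  have hcont : ContinuousAt (fderiv ℝ f) a :=
    (hf.continuousOn_fderiv_of_isOpen hU (by simp)).continuousAt (hU.mem_nhds ha)
  have hev : ∀ᶠ y in 𝓝 a, fderiv ℝ f y ∈ Set.range ((↑) : (E ≃L[ℝ] F) → E →L[ℝ] F) := by
    apply hcont
    rw [hf'.fderiv]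
    exact ContinuousLinearEquiv.nhds f'
  obtain ⟨V, hV, hVo, haV⟩ := mem_nhds_iff.1 hev
  refine ⟨e.restrOpen (U ∩ V) (hU.inter hVo), ⟨?_, ha, haV⟩, fun y hy => hy.2.1, fun y => rfl, ?_⟩
  · exact ContDiffAt.mem_toOpenPartialHomeomorph_source hfa hf' h0
  · intro y hy
    have hmem := (e.restrOpen (U ∩ V) (hU.inter hVo)).map_target hy
    obtain ⟨g', hg'⟩ := hV hmem.2.2
    apply ContDiffAt.contDiffWithinAt
    apply (e.restrOpen (U ∩ V) (hU.inter hVo)).contDiffAt_symm hy (f₀' := g')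
    · rw [hg']
      exact ((hf.contDiffAt (hU.mem_nhds hmem.2.1)).differentiableAt h0).hasFDerivAt
    · exact hf.contDiffAt (hU.mem_nhds hmem.2.1)

section Nemytskii

variable {K : Type*} [TopologicalSpace K] [CompactSpace K]

/-- The pointwise application of a family of linear maps to a family of vectors, as a continuous
bilinear map. -/
noncomputable def pointwiseApply (K : Type*) [TopologicalSpace K] [CompactSpace K]
    (E F : Type*) [NormedAddCommGroup E] [NormedSpace ℝ E]
    [NormedAddCommGroup F] [NormedSpace ℝ F] : C(K, E →L[ℝ] F) →L[ℝ] C(K, E) →L[ℝ] C(K, F) :=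
  LinearMap.mkContinuous₂
    (LinearMap.mk₂ ℝ (fun (a : C(K, E →L[ℝ] F)) (η : C(K, E)) =>
      (⟨fun t => a t (η t), by fun_prop⟩ : C(K, F)))
      (fun _ _ _ => by ext; simp) (fun _ _ _ => by ext; simp)
      (fun _ _ _ => by ext; simp) (fun _ _ _ => by ext; simp)) 1
    (fun a η => by
      rw [one_mul, ContinuousMap.norm_le _ (by positivity)]
      exact fun t => ((a t).le_opNorm _).trans
        (mul_le_mul (a.norm_coe_le_norm t) (η.norm_coe_le_norm t) (norm_nonneg _) (norm_nonneg a)))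

theorem hasFDerivAt_postcomp {E F : Type*} [NormedAddCommGroup E] [NormedSpace ℝ E]
    [NormedAddCommGroup F] [NormedSpace ℝ F] (f : C(E, F)) (f' : C(E, E →L[ℝ] F))
    (hf : ∀ x, HasFDerivAt f (f' x) x) (γ : C(K, E)) :
    HasFDerivAt (fun γ : C(K, E) => f.comp γ) (pointwiseApply K E F (f'.comp γ)) γ := by
  rw [hasFDerivAt_iff_isLittleO_nhds_zero, Asymptotics.isLittleO_iff]
  intro ε hε
  have hK : IsCompact (Set.range γ) := isCompact_range γ.continuous
  have hu := hK.uniformContinuousAt_of_continuousAt f' (fun x _ => f'.continuous.continuousAt)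
    (Metric.dist_mem_uniformity hε)
  obtain ⟨δ, hδ, hδ'⟩ := Metric.mem_uniformity_dist.1 hu
  filter_upwards [Metric.ball_mem_nhds (0 : C(K, E)) hδ] with η hη
  rw [mem_ball_zero_iff] at hη
  rw [ContinuousMap.norm_le _ (by positivity)]
  intro t
  have hη' : ‖η t‖ ≤ ‖η‖ := η.norm_coe_le_norm t
  have key := (convex_ball (γ t) δ).norm_image_sub_le_of_norm_hasFDerivWithin_le' (f := f)
    (f' := fun x => f' x) (φ := f' (γ t)) (C := ε) (x := γ t) (y := γ t + η t)
    (fun x _ => (hf x).hasFDerivWithinAt)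
    (fun x hx => by
      have := hδ' (a := γ t) (b := x) (by rw [dist_comm]; exact hx) ⟨t, rfl⟩
      change dist (f' (γ t)) (f' x) < ε at this
      rw [dist_comm, dist_eq_norm] at this
      exact this.le)
    (Metric.mem_ball_self hδ)
    (by simpa using hη'.trans_lt hη)
  simp only [add_sub_cancel_left] at key
  exact key.trans (by gcongr)

universe u in
/-- Composition with a smooth map is a smooth operator on continuous functions over a compact
space. -/
theorem contDiff_postcomp {E : Type u} [NormedAddCommGroup E] [NormedSpace ℝ E] (n : ℕ) :
    ∀ {F : Type u} [NormedAddCommGroup F] [NormedSpace ℝ F] (f : C(E, F)), ContDiff ℝ n f →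
      ContDiff ℝ n (fun γ : C(K, E) => f.comp γ) := by
  induction n with
  | zero =>
    intro F _ _ f _
    exact contDiff_zero.2 (ContinuousMap.continuous_postcomp f)
  | succ n ih =>
    intro F _ _ f hf
    have hf' := hf
    rw [Nat.cast_add, Nat.cast_one, contDiff_succ_iff_fderiv] at hf
    let f' : C(E, E →L[ℝ] F) := ⟨fderiv ℝ f, hf.2.2.continuous⟩
    have hd := hasFDerivAt_postcomp (K := K) f f' (fun x => (hf.1 x).hasFDerivAt)
    rw [Nat.cast_add, Nat.cast_one, contDiff_succ_iff_fderiv]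
    refine ⟨fun γ => (hd γ).differentiableAt, by simp, ?_⟩
    rw [funext fun γ => (hd γ).fderiv]
    exact (pointwiseApply K E F).contDiff.comp (ih f' hf.2.2)

end Nemytskii

section Flow

variable {E : Type*} [NormedAddCommGroup E] [NormedSpace ℝ E] [CompleteSpace E]

open Set intervalIntegral

/-- The operator `γ ↦ (t ↦ ∫₀ᵗ γ)` on continuous curves over the unit interval. -/
noncomputable def primitiveOperator (E : Type*) [NormedAddCommGroup E] [NormedSpace ℝ E]
    [CompleteSpace E] : C(Icc (0 : ℝ) 1, E) →L[ℝ] C(Icc (0 : ℝ) 1, E) :=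
  LinearMap.mkContinuous
    { toFun := fun γ =>
        ⟨fun t => ∫ u in (0 : ℝ)..t, IccExtend zero_le_one γ u,
          (continuous_primitive (fun a b => (γ.continuous.Icc_extend').intervalIntegrable a b)
            0).comp continuous_subtype_val⟩
      map_add' := fun γ η => by
        ext t
        exact integral_add (γ.continuous.Icc_extend'.intervalIntegrable _ _)
          (η.continuous.Icc_extend'.intervalIntegrable _ _)
      map_smul' := fun c γ => by
        ext t
        exact integral_smul c _ } 1
    (fun γ => by
      rw [one_mul, ContinuousMap.norm_le _ (norm_nonneg γ)]
      intro t
      have h := norm_integral_le_of_norm_le_const (a := (0 : ℝ)) (b := t)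
        (f := IccExtend zero_le_one γ) (C := ‖γ‖) (fun u _ => γ.norm_coe_le_norm _)
      refine h.trans ?_
      have h1 : |(t : ℝ) - 0| ≤ 1 := by
        rw [sub_zero, abs_of_nonneg t.2.1]
        exact t.2.2
      exact mul_le_of_le_one_right (norm_nonneg γ) h1)

/-- The constant curves, as a continuous linear map. -/
noncomputable def constCurve (E : Type*) [NormedAddCommGroup E] [NormedSpace ℝ E] :
    E →L[ℝ] C(Icc (0 : ℝ) 1, E) :=
  LinearMap.mkContinuous
    { toFun := fun x => ContinuousMap.const _ x
      map_add' := fun _ _ => rfl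
      map_smul' := fun _ _ => rfl } 1
    (fun x => by
      rw [one_mul, ContinuousMap.norm_le _ (norm_nonneg x)]
      exact fun t => le_rfl)

/-- The integral equation `γ(t) = x + s ∫₀ᵗ F(γ)`, as the zero set of a map on triples
`((s, x), γ)`; the pair `(s, x)` is kept, so that the inverse function theorem applies. -/
noncomputable def flowEquation (F : C(E, E)) (z : (ℝ × E) × C(Icc (0 : ℝ) 1, E)) :
    (ℝ × E) × C(Icc (0 : ℝ) 1, E) :=
  (z.1, z.2 - constCurve E z.1.2 - z.1.1 • primitiveOperator E (F.comp z.2))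

theorem contDiff_flowEquation (F : C(E, E)) (hF : ContDiff ℝ ∞ F) :
    ContDiff ℝ ∞ (flowEquation F) := by
  have h1 : ContDiff ℝ ∞ (fun γ : C(Icc (0 : ℝ) 1, E) => F.comp γ) :=
    contDiff_infty.2 fun n => contDiff_postcomp n F (hF.of_le (by exact_mod_cast le_top))
  have h2 : ContDiff ℝ ∞ (fun z : (ℝ × E) × C(Icc (0 : ℝ) 1, E) =>
      primitiveOperator E (F.comp z.2)) :=
    (primitiveOperator E).contDiff.comp (h1.comp contDiff_snd)
  unfold flowEquation
  refine contDiff_fst.prodMk ((contDiff_snd.sub ((constCurve E).contDiff.comp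
    (contDiff_snd.comp contDiff_fst))).sub (ContDiff.smul (contDiff_fst.comp contDiff_fst) h2))

/-- At time zero the linearized flow equation is unipotent, hence invertible. -/
noncomputable def flowEquationDeriv (w : C(Icc (0 : ℝ) 1, E)) :
    ((ℝ × E) × C(Icc (0 : ℝ) 1, E)) ≃L[ℝ] (ℝ × E) × C(Icc (0 : ℝ) 1, E) :=
  ContinuousLinearEquiv.equivOfInverse
    ((ContinuousLinearMap.fst ℝ _ _).prod (ContinuousLinearMap.snd ℝ _ _ -
      (constCurve E ∘L ContinuousLinearMap.snd ℝ _ _ ∘L ContinuousLinearMap.fst ℝ _ _) -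
      (ContinuousLinearMap.fst ℝ ℝ E ∘L ContinuousLinearMap.fst ℝ _ _).smulRight w))
    ((ContinuousLinearMap.fst ℝ _ _).prod (ContinuousLinearMap.snd ℝ _ _ +
      (constCurve E ∘L ContinuousLinearMap.snd ℝ _ _ ∘L ContinuousLinearMap.fst ℝ _ _) +
      (ContinuousLinearMap.fst ℝ ℝ E ∘L ContinuousLinearMap.fst ℝ _ _).smulRight w))
    (fun z => by ext <;> simp; abel) (fun z => by ext <;> simp; abel)

theorem hasFDerivAt_flowEquation (F : C(E, E)) (hF : ContDiff ℝ ∞ F) (x₀ : E) :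
    HasFDerivAt (flowEquation F)
      (flowEquationDeriv (primitiveOperator E (F.comp (constCurve E x₀))) :
        ((ℝ × E) × C(Icc (0 : ℝ) 1, E)) →L[ℝ] (ℝ × E) × C(Icc (0 : ℝ) 1, E))
      ((0, x₀), constCurve E x₀) := by
  have h1 : DifferentiableAt ℝ (fun z : (ℝ × E) × C(Icc (0 : ℝ) 1, E) =>
      primitiveOperator E (F.comp z.2)) ((0, x₀), constCurve E x₀) := by
    have h0 : ContDiff ℝ 1 (fun γ : C(Icc (0 : ℝ) 1, E) => F.comp γ) := by
      exact_mod_cast contDiff_postcomp (K := Icc (0 : ℝ) 1) 1 F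
        (hF.of_le (by exact_mod_cast le_top))
    exact (((primitiveOperator E).contDiff.comp (h0.comp contDiff_snd)).differentiable
      (by simp)).differentiableAt
  have hfst : HasFDerivAt (fun z : (ℝ × E) × C(Icc (0 : ℝ) 1, E) => z.1)
    (ContinuousLinearMap.fst ℝ _ _) ((0, x₀), constCurve E x₀) := hasFDerivAt_fst
  have hsnd : HasFDerivAt (fun z : (ℝ × E) × C(Icc (0 : ℝ) 1, E) => z.2)
    (ContinuousLinearMap.snd ℝ _ _) ((0, x₀), constCurve E x₀) := hasFDerivAt_snd
  have h11 : HasFDerivAt (fun z : (ℝ × E) × C(Icc (0 : ℝ) 1, E) => z.1.1)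
    (ContinuousLinearMap.fst ℝ ℝ E ∘L ContinuousLinearMap.fst ℝ _ _)
    ((0, x₀), constCurve E x₀) := hasFDerivAt_fst.comp _ hfst
  have h12 : HasFDerivAt (fun z : (ℝ × E) × C(Icc (0 : ℝ) 1, E) => constCurve E z.1.2)
    (constCurve E ∘L ContinuousLinearMap.snd ℝ _ _ ∘L ContinuousLinearMap.fst ℝ _ _)
    ((0, x₀), constCurve E x₀) :=
      (constCurve E).hasFDerivAt.comp _ (hasFDerivAt_snd.comp _ hfst)
  have h := hfst.prodMk ((hsnd.sub h12).sub (h11.smul h1.hasFDerivAt))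
  refine h.congr_fderiv ?_
  ext z <;> simp [flowEquationDeriv]

open Metric in
/-- A smooth vector field has a smooth local flow.  The time-`s` map is the end point of the
solution of `γ' = s F(γ)` over the unit interval, which depends smoothly on `s` and on the initial value by
the inverse function theorem. -/
theorem exists_local_flow_of_contDiff (F : C(E, E)) (hF : ContDiff ℝ ∞ F) (x₀ : E) :
    ∃ (φ : ℝ → E → E) (r : ℝ), 0 < r ∧
      ContDiffOn ℝ ∞ (fun p : ℝ × E => φ p.1 p.2) (ball 0 r ×ˢ ball x₀ r) ∧
      (∀ x ∈ ball x₀ r, φ 0 x = x) ∧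
      ∀ t ∈ ball (0 : ℝ) r, ∀ x ∈ ball x₀ r, HasDerivAt (fun s => φ s x) (F (φ t x)) t := by
  obtain ⟨e, hae, -, hecoe, hesymm⟩ := exists_smooth_local_inverse isOpen_univ
    (contDiff_flowEquation F hF).contDiffOn (mem_univ _) _ (hasFDerivAt_flowEquation F hF x₀)
  have hbase : e ((0, x₀), constCurve E x₀) = ((0, x₀), 0) := by
    rw [hecoe]
    simp [flowEquation]
  obtain ⟨δ, hδ, hδe⟩ := Metric.isOpen_iff.1 e.open_source _ hae
  let ι : ℝ × E → (ℝ × E) × C(Icc (0 : ℝ) 1, E) := fun p => (p, 0)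
  have hι : Continuous ι := by fun_prop
  have ht0 : ι (0, x₀) ∈ e.target := by
    rw [← show e _ = ι (0, x₀) from hbase]
    exact e.map_source hae
  have hev : ∀ᶠ p in nhds ((0, x₀) : ℝ × E), ι p ∈ e.target ∧
      e.symm (ι p) ∈ ball ((0, x₀), constCurve E x₀) δ := by
    refine (hι.continuousAt.eventually (e.open_target.mem_nhds ht0)).and ?_
    refine ((e.continuousAt_symm ht0).comp (f := ι) (x := (0, x₀)) hι.continuousAt).eventually
      (isOpen_ball.mem_nhds (mem_ball.2 ?_))
    have : e.symm (ι (0, x₀)) = ((0, x₀), constCurve E x₀) := by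
      rw [← show e _ = ι (0, x₀) from hbase]
      exact e.left_inv hae
    rw [Function.comp_apply, this, dist_self]
    exact hδ
  obtain ⟨r', hr', hbox'⟩ := Metric.eventually_nhds_iff_ball.1 hev
  obtain ⟨r, hr, hrr', hrδ⟩ : ∃ r > 0, r ≤ r' ∧ r ≤ δ :=
    ⟨min r' δ, lt_min hr' hδ, min_le_left _ _, min_le_right _ _⟩
  have hbox : ∀ s ∈ ball (0 : ℝ) r, ∀ x ∈ ball x₀ r, ι (s, x) ∈ e.target ∧
      e.symm (ι (s, x)) ∈ ball ((0, x₀), constCurve E x₀) δ := fun s hs x hx =>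
    hbox' _ (by
      rw [← ball_prod_same]
      exact ⟨ball_subset_ball hrr' hs, ball_subset_ball hrr' hx⟩)
  let Γ : ℝ → E → C(Icc (0 : ℝ) 1, E) := fun s x => (e.symm (ι (s, x))).2
  have hfst : ∀ s ∈ ball (0 : ℝ) r, ∀ x ∈ ball x₀ r, e.symm (ι (s, x)) = ((s, x), Γ s x) := by
    intro s hs x hx
    have h := e.right_inv (hbox s hs x hx).1
    rw [hecoe] at h
    exact Prod.ext (show (e.symm (ι (s, x))).1 = (s, x) from congrArg Prod.fst h) rfl
  have hΓ : ∀ s ∈ ball (0 : ℝ) r, ∀ x ∈ ball x₀ r, ∀ t : Icc (0 : ℝ) 1,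
      Γ s x t = x + s • ∫ u in (0 : ℝ)..t, F (Γ s x (projIcc 0 1 zero_le_one u)) := by
    intro s hs x hx t
    have h := e.right_inv (hbox s hs x hx).1
    rw [hfst s hs x hx, hecoe] at h
    have h2 : (Γ s x - constCurve E x - s • primitiveOperator E (F.comp (Γ s x))) t = 0 := by
      rw [show Γ s x - constCurve E x - s • primitiveOperator E (F.comp (Γ s x)) = 0 from
        congrArg Prod.snd h]
      rfl
    have h3 : Γ s x t - x - s • (∫ u in (0 : ℝ)..t,
        F (Γ s x (projIcc 0 1 zero_le_one u))) = 0 := h2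
    rw [sub_sub, sub_eq_zero] at h3
    exact h3
  have hΓδ : ∀ s ∈ ball (0 : ℝ) r, ∀ x ∈ ball x₀ r, dist (Γ s x) (constCurve E x₀) < δ := by
    intro s hs x hx
    have h := (hbox s hs x hx).2
    rw [← ball_prod_same] at h
    exact h.2
  have huniq : ∀ s ∈ ball (0 : ℝ) r, ∀ x ∈ ball x₀ r, ∀ η : C(Icc (0 : ℝ) 1, E),
      dist η (constCurve E x₀) < δ →
      (∀ t : Icc (0 : ℝ) 1,
        η t = x + s • ∫ u in (0 : ℝ)..t, F (η (projIcc 0 1 zero_le_one u))) → η = Γ s x := by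
    intro s hs x hx η hη heq
    have hsrc : ((s, x), η) ∈ e.source := hδe (by
      rw [← ball_prod_same, ← ball_prod_same]
      exact ⟨⟨ball_subset_ball hrδ hs, ball_subset_ball hrδ hx⟩, hη⟩)
    have he : e ((s, x), η) = ι (s, x) := by
      rw [hecoe]
      refine Prod.ext rfl ?_
      ext t
      change η t - x - s • (∫ u in (0 : ℝ)..t, F (η (projIcc 0 1 zero_le_one u))) = 0
      rw [sub_sub, sub_eq_zero]
      exact heq t
    have h := e.left_inv hsrc
    rw [he] at h
    exact (congrArg Prod.snd h).symm
  have hscale : ∀ s ∈ ball (0 : ℝ) r, ∀ x ∈ ball x₀ r, ∀ t : Icc (0 : ℝ) 1,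
      Γ (s * t) x 1 = Γ s x t := by
    intro s hs x hx t
    have hst : s * t ∈ ball (0 : ℝ) r := by
      rw [mem_ball_zero_iff] at hs ⊢
      rw [norm_mul]
      refine lt_of_le_of_lt (mul_le_of_le_one_right (norm_nonneg s) ?_) hs
      rw [Real.norm_of_nonneg t.2.1]
      exact t.2.2
    let η : C(Icc (0 : ℝ) 1, E) := (Γ s x).comp ⟨fun τ => t * τ, by fun_prop⟩
    have hη : η = Γ (s * t) x := by
      refine huniq _ hst x hx η ?_ ?_
      · refine lt_of_le_of_lt ?_ (hΓδ s hs x hx)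
        rw [ContinuousMap.dist_le dist_nonneg]
        exact fun τ => ContinuousMap.dist_apply_le_dist (f := Γ s x) (g := constCurve E x₀) (t * τ)
      · intro τ
        change Γ s x (t * τ) = _
        rw [hΓ s hs x hx, mul_smul]
        congr 2
        have hsub := smul_integral_comp_mul_left (a := (0 : ℝ)) (b := (τ : ℝ))
          (fun u => F (Γ s x (projIcc 0 1 zero_le_one u))) (t : ℝ)
        rw [mul_zero] at hsub
        rw [Icc.coe_mul, ← hsub]
        congr 1
        apply integral_congr
        intro u hu
        rw [uIcc_of_le τ.2.1] at hu
        have hu1 : u ∈ Icc (0 : ℝ) 1 := ⟨hu.1, hu.2.trans τ.2.2⟩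
        change F (Γ s x (projIcc 0 1 zero_le_one (t * u))) =
          F (Γ s x (t * projIcc 0 1 zero_le_one u))
        congr 2
        ext
        rw [Icc.coe_mul, projIcc_of_mem zero_le_one hu1, projIcc_of_mem zero_le_one
          ⟨mul_nonneg t.2.1 hu1.1, mul_le_one₀ t.2.2 hu1.1 hu1.2⟩]
    rw [← hη]
    change Γ s x (t * 1) = _
    rw [mul_one]
  have hsmooth : ContDiffOn ℝ ∞ (fun p : ℝ × E => Γ p.1 p.2 1) (ball 0 r ×ˢ ball x₀ r) := by
    have h1 : ContDiffOn ℝ ∞ (fun p : ℝ × E => e.symm (ι p)) (ball 0 r ×ˢ ball x₀ r) :=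
      hesymm.comp (contDiff_id.prodMk contDiff_const).contDiffOn
        (fun p hp => (hbox p.1 hp.1 p.2 hp.2).1)
    exact ((ContinuousMap.evalCLM ℝ (1 : Icc (0 : ℝ) 1)).contDiff.comp
      contDiff_snd).comp_contDiffOn h1
  have hint : ∀ s ∈ ball (0 : ℝ) r, ∀ x ∈ ball x₀ r,
      Γ s x 1 = x + ∫ v in (0 : ℝ)..s, F (Γ v x 1) := by
    intro s hs x hx
    rw [hΓ s hs x hx]
    congr 1
    have hsub := smul_integral_comp_mul_left (a := (0 : ℝ)) (b := 1)
      (fun v => F (Γ v x 1)) s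
    rw [mul_zero, mul_one] at hsub
    rw [← hsub]
    congr 1
    apply integral_congr
    intro u hu
    rw [uIcc_of_le (by simp)] at hu
    have hu1 : u ∈ Icc (0 : ℝ) 1 := by simpa using hu
    change F (Γ s x (projIcc 0 1 zero_le_one u)) = F (Γ (s * u) x 1)
    rw [projIcc_of_mem zero_le_one hu1, ← hscale s hs x hx ⟨u, hu1⟩]
  refine ⟨fun s x => Γ s x 1, r, hr, hsmooth, fun x hx => ?_, fun t ht x hx => ?_⟩
  · change Γ 0 x 1 = x
    rw [hΓ 0 (mem_ball_self hr) x hx, zero_smul, add_zero]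
  · have hc : ContinuousOn (fun v => F (Γ v x 1)) (ball 0 r) :=
      F.continuous.comp_continuousOn
        (hsmooth.continuousOn.comp (f := fun v => (v, x)) (by fun_prop) (fun v hv => ⟨hv, hx⟩))
    have hsub : uIcc 0 t ⊆ ball (0 : ℝ) r := by
      rw [← segment_eq_uIcc]
      exact (convex_ball 0 r).segment_subset (mem_ball_self hr) ht
    have hd := (integral_hasDerivAt_right (hc.mono hsub).intervalIntegrable
      (hc.stronglyMeasurableAtFilter isOpen_ball t ht)
      (hc.continuousAt (isOpen_ball.mem_nhds ht))).const_add x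
    refine hd.congr_of_eventuallyEq ?_
    filter_upwards [isOpen_ball.mem_nhds ht] with s hs
    exact hint s hs x hx

open Metric in
/-- The smooth local flow near `x₀` of a vector field which is smooth near `x₀`. -/
theorem exists_local_flow [FiniteDimensional ℝ E] {F : E → E} {U : Set E} (hU : IsOpen U)
    (hF : ContDiffOn ℝ ∞ F U) {x₀ : E} (hx₀ : x₀ ∈ U) :
    ∃ (φ : ℝ → E → E) (r : ℝ), 0 < r ∧
      ContDiffOn ℝ ∞ (fun p : ℝ × E => φ p.1 p.2) (ball 0 r ×ˢ ball x₀ r) ∧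
      (∀ x ∈ ball x₀ r, φ 0 x = x) ∧
      (∀ t ∈ ball (0 : ℝ) r, ∀ x ∈ ball x₀ r, φ t x ∈ U) ∧
      ∀ t ∈ ball (0 : ℝ) r, ∀ x ∈ ball x₀ r, HasDerivAt (fun s => φ s x) (F (φ t x)) t := by
  obtain ⟨ε, hε, hεU⟩ := Metric.isOpen_iff.1 hU x₀ hx₀
  let χ : ContDiffBump x₀ := ⟨ε / 4, ε / 2, by positivity, by linarith⟩
  have hsm : ContDiff ℝ ∞ (fun x => χ x • F x) := by
    rw [contDiff_iff_contDiffAt]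
    intro x
    by_cases hx : x ∈ ball x₀ ε
    · exact χ.contDiffAt.smul (hF.contDiffAt (hU.mem_nhds (hεU hx)))
    · have hx' : x ∈ (closedBall x₀ (ε / 2))ᶜ := by
        rw [mem_ball, not_lt] at hx
        rw [mem_compl_iff, mem_closedBall, not_le]
        linarith
      refine (contDiffAt_const (c := (0 : E))).congr_of_eventuallyEq ?_
      filter_upwards [isClosed_closedBall.isOpen_compl.mem_nhds hx'] with y hy
      rw [mem_compl_iff, mem_closedBall, not_le] at hy
      rw [χ.zero_of_le_dist hy.le, zero_smul]
  obtain ⟨φ, r, hr, hφ, hφ0, hφd⟩ := exists_local_flow_of_contDiff ⟨_, hsm.continuous⟩ hsm x₀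
  have hc : ContinuousAt (fun p : ℝ × E => φ p.1 p.2) (0, x₀) :=
    hφ.continuousOn.continuousAt ((isOpen_ball.prod isOpen_ball).mem_nhds
      ⟨mem_ball_self hr, mem_ball_self hr⟩)
  have hev : ∀ᶠ p in nhds ((0, x₀) : ℝ × E), φ p.1 p.2 ∈ ball x₀ (ε / 4) := by
    refine hc.eventually (isOpen_ball.mem_nhds ?_)
    change φ 0 x₀ ∈ _
    rw [hφ0 x₀ (mem_ball_self hr)]
    exact mem_ball_self (by positivity)
  obtain ⟨r', hr', hbox⟩ := Metric.eventually_nhds_iff_ball.1 hev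
  have h1 : ball (0 : ℝ) (min r r') ⊆ ball 0 r := ball_subset_ball (min_le_left _ _)
  have h2 : ball x₀ (min r r') ⊆ ball x₀ r := ball_subset_ball (min_le_left _ _)
  have hbox' : ∀ t ∈ ball (0 : ℝ) (min r r'), ∀ x ∈ ball x₀ (min r r'),
      φ t x ∈ ball x₀ (ε / 4) := fun t ht x hx => hbox (t, x) (by
    rw [← ball_prod_same]
    exact ⟨ball_subset_ball (min_le_right _ _) ht, ball_subset_ball (min_le_right _ _) hx⟩)
  refine ⟨φ, min r r', lt_min hr hr', hφ.mono (prod_mono h1 h2), fun x hx => hφ0 x (h2 hx),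
    fun t ht x hx => hεU (ball_subset_ball (by linarith) (hbox' t ht x hx)),
    fun t ht x hx => ?_⟩
  have hd := hφd t (h1 ht) x (h2 hx)
  have : χ (φ t x) = 1 := χ.one_of_mem_closedBall (ball_subset_closedBall (hbox' t ht x hx))
  change HasDerivAt _ (χ (φ t x) • F (φ t x)) t at hd
  rwa [this, one_smul] at hd

open Metric in
/-- The equation `dh(F) = c` is smoothly solvable near every point where the vector field `F` does
not vanish.  The flow of `(F, c)` on `E × ℝ` issuing from a hyperplane transverse to `F` straightens
`F` in its first component, and its second component integrates `c` along the flow lines. -/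
theorem exists_fderiv_apply_eq [FiniteDimensional ℝ E] {F : E → E} {c : E → ℝ} {U : Set E}
    (hU : IsOpen U) (hF : ContDiffOn ℝ ∞ F U) (hc : ContDiffOn ℝ ∞ c U) {x₀ : E} (hx₀ : x₀ ∈ U)
    (hne : F x₀ ≠ 0) :
    ∃ (h : E → ℝ) (V : Set E), IsOpen V ∧ x₀ ∈ V ∧ V ⊆ U ∧ ContDiffOn ℝ ∞ h V ∧
      ∀ x ∈ V, fderiv ℝ h x (F x) = c x := by
  obtain ⟨φ, r, hr, hφ, hφ0, hφU, hφd⟩ := exists_local_flow (E := E × ℝ)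
    (F := fun p => (F p.1, c p.1)) (U := U ×ˢ univ) (x₀ := (x₀, 0)) (hU.prod isOpen_univ)
    ((hF.comp contDiff_fst.contDiffOn fun p hp => hp.1).prodMk
      (hc.comp contDiff_fst.contDiffOn fun p hp => hp.1)) ⟨hx₀, mem_univ _⟩
  obtain ⟨w, hw⟩ : ∃ w, F x₀ = w := ⟨_, rfl⟩
  obtain ⟨l, hl⟩ : ∃ l : E →L[ℝ] ℝ, l w = 1 := by
    obtain ⟨l, hl⟩ := SeparatingDual.exists_eq_one (R := ℝ) hne
    exact ⟨l, by rw [← hw]; exact hl⟩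
  -- A point is written as its `w`-coordinate together with its projection to the hyperplane.
  let a : E → ℝ × (E × ℝ) := fun y => (l (y - x₀), (y - l (y - x₀) • w, 0))
  have ha : ContDiff ℝ ∞ a := by
    have h1 : ContDiff ℝ ∞ (fun y => l (y - x₀)) := l.contDiff.comp (contDiff_id.sub contDiff_const)
    exact h1.prodMk ((contDiff_id.sub (h1.smul contDiff_const)).prodMk contDiff_const)
  have ha0 : a x₀ = (0, (x₀, 0)) := by simp [a]
  let W : Set E := a ⁻¹' (ball 0 r ×ˢ ball (x₀, 0) r)
  have hW : IsOpen W := (isOpen_ball.prod isOpen_ball).preimage ha.continuous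
  have hx₀W : x₀ ∈ W := by
    change a x₀ ∈ ball (0 : ℝ) r ×ˢ ball (x₀, (0 : ℝ)) r
    rw [ha0]
    exact ⟨mem_ball_self hr, mem_ball_self hr⟩
  let Φ : E → E × ℝ := fun y => φ (a y).1 (a y).2
  have hΦ : ContDiffOn ℝ ∞ Φ W := hφ.comp ha.contDiffOn fun y hy => hy
  have hΦd : ∀ y ∈ W, DifferentiableAt ℝ Φ y := fun y hy =>
    (hΦ.contDiffAt (hW.mem_nhds hy)).differentiableAt (by simp)
  have haw : ∀ y (s : ℝ), a (y + s • w) = ((a y).1 + s, (a y).2) := by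
    intro y s
    have h1 : l (y + s • w - x₀) = l (y - x₀) + s := by
      rw [add_sub_right_comm, map_add, map_smul, hl, smul_eq_mul, mul_one]
    simp only [a, h1, add_smul]
    refine Prod.ext rfl (Prod.ext ?_ rfl)
    change y + s • w - (l (y - x₀) • w + s • w) = y - l (y - x₀) • w
    abel
  have hΦw : ∀ y ∈ W, fderiv ℝ Φ y w = (F (Φ y).1, c (Φ y).1) := by
    intro y hy
    have h1 : HasDerivAt (fun s : ℝ => Φ (y + s • w)) (fderiv ℝ Φ y w) 0 := by
      have h0 : HasDerivAt (fun s : ℝ => y + s • w) w 0 := by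
        simpa using ((hasDerivAt_id (0 : ℝ)).smul_const w).const_add y
      have h1 : HasFDerivAt Φ (fderiv ℝ Φ y) (y + (0 : ℝ) • w) := by
        simpa using (hΦd y hy).hasFDerivAt
      exact h1.comp_hasDerivAt (0 : ℝ) h0
    have h2 : HasDerivAt (fun s : ℝ => φ ((a y).1 + s) (a y).2) (F (Φ y).1, c (Φ y).1) 0 := by
      have h0 := hφd (a y).1 hy.1 (a y).2 hy.2
      rw [← add_zero (a y).1] at h0
      simpa using h0.comp_const_add (a y).1 (0 : ℝ)
    refine h1.unique (h2.congr_of_eventuallyEq (Filter.Eventually.of_forall fun s => ?_))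
    simp only [Φ, haw]
  let Ψ : E → E := fun y => (Φ y).1
  have hΨ : ContDiffOn ℝ ∞ Ψ W := contDiff_fst.comp_contDiffOn hΦ
  have hΦx₀ : Φ x₀ = (x₀, 0) := by
    simp only [Φ, ha0]
    exact hφ0 _ (mem_ball_self hr)
  have hΨd : HasFDerivAt Ψ ((ContinuousLinearEquiv.refl ℝ E : E ≃L[ℝ] E) : E →L[ℝ] E) x₀ := by
    have h0 : HasFDerivAt Ψ ((ContinuousLinearMap.fst ℝ E ℝ) ∘L fderiv ℝ Φ x₀) x₀ :=
      hasFDerivAt_fst.comp x₀ (hΦd x₀ hx₀W).hasFDerivAt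
    refine h0.congr_fderiv ?_
    ext v
    -- On the hyperplane `Φ` is the identity, and `w` is mapped to `F x₀ = w`.
    have h1 : fderiv ℝ Φ x₀ (v - l v • w) = (v - l v • w, 0) := by
      obtain ⟨z, hz⟩ : ∃ z, v - l v • w = z := ⟨_, rfl⟩
      have hlz : l z = 0 := by rw [← hz, map_sub, map_smul, hl, smul_eq_mul, mul_one, sub_self]
      rw [hz]
      have hc0 : HasDerivAt (fun s : ℝ => x₀ + s • z) z 0 := by
        simpa using ((hasDerivAt_id (0 : ℝ)).smul_const z).const_add x₀
      have h1 : HasDerivAt (fun s : ℝ => Φ (x₀ + s • z)) (fderiv ℝ Φ x₀ z) 0 := by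
        have h1 : HasFDerivAt Φ (fderiv ℝ Φ x₀) (x₀ + (0 : ℝ) • z) := by
          simpa using (hΦd x₀ hx₀W).hasFDerivAt
        exact h1.comp_hasDerivAt (0 : ℝ) hc0
      refine h1.unique ((hc0.prodMk (hasDerivAt_const (0 : ℝ) (0 : ℝ))).congr_of_eventuallyEq ?_)
      have hev : ∀ᶠ s : ℝ in nhds 0, x₀ + s • z ∈ W := by
        refine hc0.continuousAt.eventually (hW.mem_nhds ?_)
        simpa using hx₀W
      filter_upwards [hev] with s hs
      have has : a (x₀ + s • z) = (0, (x₀ + s • z, 0)) := by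
        simp [a, hlz]
      have hs' : a (x₀ + s • z) ∈ ball (0 : ℝ) r ×ˢ ball (x₀, (0 : ℝ)) r := hs
      rw [has] at hs'
      simp only [Φ, has]
      exact hφ0 _ hs'.2
    have h2 : fderiv ℝ Φ x₀ v = fderiv ℝ Φ x₀ (v - l v • w) + l v • fderiv ℝ Φ x₀ w := by
      rw [← map_smul, ← map_add, sub_add_cancel]
    change (fderiv ℝ Φ x₀ v).1 = v
    rw [h2, h1, hΦw x₀ hx₀W, hΦx₀, hw]
    simp
  obtain ⟨e, hxe, heW, hecoe, hesymm⟩ := exists_smooth_local_inverse hW hΨ hx₀W _ hΨd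
  have hex₀ : e x₀ = x₀ := by
    rw [hecoe]
    simp only [Ψ, hΦx₀]
  refine ⟨fun x => (Φ (e.symm x)).2, e.target, e.open_target, ?_, ?_, ?_, ?_⟩
  · rw [← hex₀]
    exact e.map_source hxe
  · intro x hx
    rw [← e.right_inv hx, hecoe]
    have hy := heW (e.map_target hx)
    exact (hφU _ hy.1 _ hy.2).1
  · exact (contDiff_snd.comp_contDiffOn hΦ).comp hesymm fun x hx => heW (e.map_target hx)
  · intro x hx
    have hyW : e.symm x ∈ W := heW (e.map_target hx)
    have hxy : Ψ (e.symm x) = x := by rw [← hecoe, e.right_inv hx]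
    have hds : HasFDerivAt e.symm (fderiv ℝ e.symm x) x :=
      ((hesymm.contDiffAt (e.open_target.mem_nhds hx)).differentiableAt (by simp)).hasFDerivAt
    have hΨy : HasFDerivAt Ψ ((ContinuousLinearMap.fst ℝ E ℝ) ∘L fderiv ℝ Φ (e.symm x))
        (e.symm x) := hasFDerivAt_fst.comp _ (hΦd _ hyW).hasFDerivAt
    have hΨw : ((ContinuousLinearMap.fst ℝ E ℝ) ∘L fderiv ℝ Φ (e.symm x)) w = F x := by
      change (fderiv ℝ Φ (e.symm x) w).1 = F x
      rw [hΦw _ hyW]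
      exact congrArg F hxy
    have hleft : fderiv ℝ e.symm x (F x) = w := by
      have h1 : HasFDerivAt (fun y => e.symm (Ψ y)) (fderiv ℝ e.symm x ∘L
          ((ContinuousLinearMap.fst ℝ E ℝ) ∘L fderiv ℝ Φ (e.symm x))) (e.symm x) := by
        refine HasFDerivAt.comp (e.symm x) ?_ hΨy
        rwa [hxy]
      have h2 : HasFDerivAt (fun y => e.symm (Ψ y)) (ContinuousLinearMap.id ℝ E) (e.symm x) := by
        refine (hasFDerivAt_id _).congr_of_eventuallyEq ?_
        filter_upwards [e.open_source.mem_nhds (e.map_target hx)] with y hy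
        rw [← hecoe, e.left_inv hy, id]
      have h3 := congrArg (fun L : E →L[ℝ] E => L w) (h1.unique h2)
      change fderiv ℝ e.symm x (((ContinuousLinearMap.fst ℝ E ℝ) ∘L
        fderiv ℝ Φ (e.symm x)) w) = w at h3
      rwa [hΨw] at h3
    have hh : HasFDerivAt (fun x => (Φ (e.symm x)).2)
        (((ContinuousLinearMap.snd ℝ E ℝ) ∘L fderiv ℝ Φ (e.symm x)) ∘L fderiv ℝ e.symm x) x :=
      (hasFDerivAt_snd.comp _ (hΦd _ hyW).hasFDerivAt).comp x hds
    rw [hh.fderiv]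
    change (fderiv ℝ Φ (e.symm x) (fderiv ℝ e.symm x (F x))).2 = c x
    rw [hleft, hΦw _ hyW]
    exact congrArg c hxy

end Flow

/-! ### Derivatives as maps between model spaces -/

section Composition

variable {E₁ H₁ M₁ E₂ H₂ M₂ E₃ H₃ M₃ : Type*}
  [NormedAddCommGroup E₁] [NormedSpace ℝ E₁] [TopologicalSpace H₁] {I₁ : ModelWithCorners ℝ E₁ H₁}
  [TopologicalSpace M₁] [ChartedSpace H₁ M₁]
  [NormedAddCommGroup E₂] [NormedSpace ℝ E₂] [TopologicalSpace H₂] {I₂ : ModelWithCorners ℝ E₂ H₂}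
  [TopologicalSpace M₂] [ChartedSpace H₂ M₂]
  [NormedAddCommGroup E₃] [NormedSpace ℝ E₃] [TopologicalSpace H₃] {I₃ : ModelWithCorners ℝ E₃ H₃}
  [TopologicalSpace M₃] [ChartedSpace H₃ M₃]

/-- `f' : E₁ → E₂` is the derivative of `f` at `x`.  This is `HasMFDerivAt`, with the derivative
regarded as a map between the model spaces, which are definitionally the tangent spaces; base points
then need to agree only propositionally. -/
def HasModelDerivAt (I₁ : ModelWithCorners ℝ E₁ H₁) (I₂ : ModelWithCorners ℝ E₂ H₂)
    (f : M₁ → M₂) (x : M₁) (f' : E₁ →L[ℝ] E₂) : Prop :=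
  HasMFDerivAt I₁ I₂ f x f'

theorem HasModelDerivAt.comp_of_eq {g : M₂ → M₃} {f : M₁ → M₂} {x : M₁} {y : M₂} {g' : E₂ →L[ℝ] E₃}
    {f' : E₁ →L[ℝ] E₂} (hg : HasModelDerivAt I₂ I₃ g y g') (hf : HasModelDerivAt I₁ I₂ f x f')
    (h : f x = y) : HasModelDerivAt I₁ I₃ (fun z => g (f z)) x (g' ∘L f') := by
  subst h
  exact HasMFDerivAt.comp x hg hf

theorem HasModelDerivAt.congr_of_eventuallyEq {f g : M₁ → M₂} {x : M₁} {f' : E₁ →L[ℝ] E₂}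
    (hf : HasModelDerivAt I₁ I₂ f x f') (h : g =ᶠ[nhds x] f) : HasModelDerivAt I₁ I₂ g x f' :=
  HasMFDerivAt.congr_of_eventuallyEq hf h

theorem HasModelDerivAt.unique {f g : M₁ → M₂} {x : M₁} {f' g' : E₁ →L[ℝ] E₂}
    (hf : HasModelDerivAt I₁ I₂ f x f') (hg : HasModelDerivAt I₁ I₂ g x g')
    (h : f =ᶠ[nhds x] g) : f' = g' :=
  hasMFDerivAt_unique hf (HasMFDerivAt.congr_of_eventuallyEq hg h)

/-- The derivative of a map between manifolds, as a map between the model spaces. -/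
noncomputable def modelDeriv (I₁ : ModelWithCorners ℝ E₁ H₁) (I₂ : ModelWithCorners ℝ E₂ H₂)
    (f : M₁ → M₂) (x : M₁) : E₁ →L[ℝ] E₂ :=
  mfderiv I₁ I₂ f x

theorem hasModelDerivAt_modelDeriv {f : M₁ → M₂} {x : M₁} (h : MDifferentiableAt I₁ I₂ f x) :
    HasModelDerivAt I₁ I₂ f x (modelDeriv I₁ I₂ f x) :=
  MDifferentiableAt.hasMFDerivAt h

theorem HasModelDerivAt.modelDeriv_eq {f : M₁ → M₂} {x : M₁} {f' : E₁ →L[ℝ] E₂}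
    (h : HasModelDerivAt I₁ I₂ f x f') : modelDeriv I₁ I₂ f x = f' :=
  HasMFDerivAt.mfderiv h

theorem hasModelDerivAt_id (x : M₁) :
    HasModelDerivAt I₁ I₁ (fun z => z) x (ContinuousLinearMap.id ℝ E₁) :=
  hasMFDerivAt_id x

theorem hasModelDerivAt_const (y : M₂) (x : M₁) : HasModelDerivAt I₁ I₂ (fun _ => y) x 0 :=
  hasMFDerivAt_const y x

theorem hasModelDerivAt_iff_hasFDerivAt {f : E₁ → E₂} {x : E₁} {f' : E₁ →L[ℝ] E₂} :
    HasModelDerivAt 𝓘(ℝ, E₁) 𝓘(ℝ, E₂) f x f' ↔ HasFDerivAt f f' x :=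
  hasMFDerivAt_iff_hasFDerivAt

end Composition

/-! ### Left-invariant vector fields in a chart at the identity -/

section LieGroups

set_option linter.unusedSectionVars false

variable {n : ℕ} {G : Type*} [TopologicalSpace G] [ChartedSpace (EuclideanSpace ℝ (Fin n)) G]
  [Group G] [LieGroup (𝓡 n) ∞ G]

theorem mdifferentiable_mul_left (g : G) : MDifferentiable (𝓡 n) (𝓡 n) (fun h : G => g * h) :=
  (contMDiff_mul_left (I := 𝓡 n) (n := ∞)).mdifferentiable (by simp)

theorem isManifold_one_of_lieGroup (n : ℕ) (G : Type*) [TopologicalSpace G]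
    [ChartedSpace (EuclideanSpace ℝ (Fin n)) G] [Group G] [LieGroup (𝓡 n) ∞ G] :
    IsManifold (𝓡 n) 1 G :=
  IsManifold.of_le (n := ∞) (by simp)

theorem t2Space_of_lieGroup (n : ℕ) (G : Type*) [TopologicalSpace G]
    [ChartedSpace (EuclideanSpace ℝ (Fin n)) G] [Group G] [LieGroup (𝓡 n) ∞ G] : T2Space G := by
  have : IsTopologicalGroup G := topologicalGroup_of_lieGroup (𝓡 n) ∞
  have : T1Space G := ChartedSpace.t1Space (EuclideanSpace ℝ (Fin n)) G
  infer_instance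

theorem mulInvariantVectorField_one (v : GroupLieAlgebra (𝓡 n) G) :
    (mulInvariantVectorField v (1 : G) : EuclideanSpace ℝ (Fin n)) = v := by
  have h := (hasModelDerivAt_id (I₁ := 𝓡 n) (1 : G)).congr_of_eventuallyEq
    (Filter.Eventually.of_forall fun h => one_mul h)
  exact congrArg (fun L : EuclideanSpace ℝ (Fin n) →L[ℝ] EuclideanSpace ℝ (Fin n) => L v)
    h.modelDeriv_eq

theorem mfderiv_mul_left_mulInvariantVectorField (g h : G) (v : GroupLieAlgebra (𝓡 n) G) :
    (mfderiv (𝓡 n) (𝓡 n) (fun a : G => g * a) h (mulInvariantVectorField v h) :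
      EuclideanSpace ℝ (Fin n)) = mulInvariantVectorField v (g * h) := by
  have h1 := (hasModelDerivAt_modelDeriv (mdifferentiable_mul_left (n := n) g h)).comp_of_eq
    (hasModelDerivAt_modelDeriv (mdifferentiable_mul_left (n := n) h 1)) (mul_one h)
  have h2 := hasModelDerivAt_modelDeriv (mdifferentiable_mul_left (n := n) (g * h) 1)
  have h3 := h1.unique h2
    (Filter.Eventually.of_forall fun a => (mul_assoc g h a).symm)
  exact congrArg (fun L : EuclideanSpace ℝ (Fin n) →L[ℝ] EuclideanSpace ℝ (Fin n) => L v) h3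

/-- The multiplication of a Lie group in the chart centred at the identity. -/
noncomputable def chartMul (n : ℕ) (G : Type*) [TopologicalSpace G]
    [ChartedSpace (EuclideanSpace ℝ (Fin n)) G] [Group G]
    (p : EuclideanSpace ℝ (Fin n) × EuclideanSpace ℝ (Fin n)) : EuclideanSpace ℝ (Fin n) :=
  extChartAt (𝓡 n) (1 : G)
    ((extChartAt (𝓡 n) (1 : G)).symm p.1 * (extChartAt (𝓡 n) (1 : G)).symm p.2)

/-- The set where `chartMul` represents the multiplication. -/
def chartMulDomain (n : ℕ) (G : Type*) [TopologicalSpace G]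
    [ChartedSpace (EuclideanSpace ℝ (Fin n)) G] [Group G] :
    Set (EuclideanSpace ℝ (Fin n) × EuclideanSpace ℝ (Fin n)) :=
  ((extChartAt (𝓡 n) (1 : G)).target ×ˢ (extChartAt (𝓡 n) (1 : G)).target) ∩
    (fun p => (extChartAt (𝓡 n) (1 : G)).symm p.1 * (extChartAt (𝓡 n) (1 : G)).symm p.2) ⁻¹'
      (extChartAt (𝓡 n) (1 : G)).source

variable (n G) in
theorem contMDiffOn_chart_mul :
    ContMDiffOn 𝓘(ℝ, EuclideanSpace ℝ (Fin n) × EuclideanSpace ℝ (Fin n)) (𝓡 n) ∞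
      (fun p : EuclideanSpace ℝ (Fin n) × EuclideanSpace ℝ (Fin n) =>
        (extChartAt (𝓡 n) (1 : G)).symm p.1 * (extChartAt (𝓡 n) (1 : G)).symm p.2)
      ((extChartAt (𝓡 n) (1 : G)).target ×ˢ (extChartAt (𝓡 n) (1 : G)).target) := by
  have h := contMDiffOn_extChartAt_symm (I := 𝓡 n) (n := ∞) (1 : G)
  have h1 : ContMDiffOn 𝓘(ℝ, EuclideanSpace ℝ (Fin n) × EuclideanSpace ℝ (Fin n)) (𝓡 n) ∞
      (fun p : EuclideanSpace ℝ (Fin n) × EuclideanSpace ℝ (Fin n) =>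
        (extChartAt (𝓡 n) (1 : G)).symm p.1)
      ((extChartAt (𝓡 n) (1 : G)).target ×ˢ (extChartAt (𝓡 n) (1 : G)).target) :=
    h.comp contDiff_fst.contMDiff.contMDiffOn fun p hp => hp.1
  have h2 : ContMDiffOn 𝓘(ℝ, EuclideanSpace ℝ (Fin n) × EuclideanSpace ℝ (Fin n)) (𝓡 n) ∞
      (fun p : EuclideanSpace ℝ (Fin n) × EuclideanSpace ℝ (Fin n) =>
        (extChartAt (𝓡 n) (1 : G)).symm p.2)
      ((extChartAt (𝓡 n) (1 : G)).target ×ˢ (extChartAt (𝓡 n) (1 : G)).target) :=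
    h.comp contDiff_snd.contMDiff.contMDiffOn fun p hp => hp.2
  exact h1.mul h2

variable (n G) in
theorem isOpen_chartMulDomain : IsOpen (chartMulDomain n G) :=
  (contMDiffOn_chart_mul n G).continuousOn.isOpen_inter_preimage
    ((isOpen_extChartAt_target 1).prod (isOpen_extChartAt_target 1))
    (isOpen_extChartAt_source 1)

variable (n G) in
theorem contDiffOn_chartMul : ContDiffOn ℝ ∞ (chartMul n G) (chartMulDomain n G) := by
  rw [← contMDiffOn_iff_contDiffOn]
  refine (contMDiffOn_extChartAt (I := 𝓡 n) (n := ∞) (x := (1 : G))).comp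
    ((contMDiffOn_chart_mul n G).mono Set.inter_subset_left) fun p hp => ?_
  have := hp.2
  rwa [Set.mem_preimage, extChartAt_source] at this

theorem chart_left_mem_chartMulDomain {x : EuclideanSpace ℝ (Fin n)}
    (hx : x ∈ (extChartAt (𝓡 n) (1 : G)).target) :
    (x, extChartAt (𝓡 n) (1 : G) 1) ∈ chartMulDomain n G := by
  refine ⟨⟨hx, mem_extChartAt_target 1⟩, ?_⟩
  simp only [Set.mem_preimage, extChartAt_to_inv, mul_one]
  exact (extChartAt (𝓡 n) (1 : G)).map_target hx

theorem chart_right_mem_chartMulDomain {x : EuclideanSpace ℝ (Fin n)}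
    (hx : x ∈ (extChartAt (𝓡 n) (1 : G)).target) :
    (extChartAt (𝓡 n) (1 : G) 1, x) ∈ chartMulDomain n G := by
  refine ⟨⟨mem_extChartAt_target 1, hx⟩, ?_⟩
  simp only [Set.mem_preimage, extChartAt_to_inv, one_mul]
  exact (extChartAt (𝓡 n) (1 : G)).map_target hx

theorem chartMul_left {x : EuclideanSpace ℝ (Fin n)}
    (hx : x ∈ (extChartAt (𝓡 n) (1 : G)).target) :
    chartMul n G (x, extChartAt (𝓡 n) (1 : G) 1) = x := by
  simp only [chartMul, extChartAt_to_inv, mul_one]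
  exact (extChartAt (𝓡 n) (1 : G)).right_inv hx

theorem chartMul_right {x : EuclideanSpace ℝ (Fin n)}
    (hx : x ∈ (extChartAt (𝓡 n) (1 : G)).target) :
    chartMul n G (extChartAt (𝓡 n) (1 : G) 1, x) = x := by
  simp only [chartMul, extChartAt_to_inv, one_mul]
  exact (extChartAt (𝓡 n) (1 : G)).right_inv hx

theorem chart_symm_chartMul {p : EuclideanSpace ℝ (Fin n) × EuclideanSpace ℝ (Fin n)}
    (hp : p ∈ chartMulDomain n G) :
    (extChartAt (𝓡 n) (1 : G)).symm (chartMul n G p) =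
      (extChartAt (𝓡 n) (1 : G)).symm p.1 * (extChartAt (𝓡 n) (1 : G)).symm p.2 :=
  (extChartAt (𝓡 n) (1 : G)).left_inv hp.2

theorem mdifferentiableAt_chart_symm {x : EuclideanSpace ℝ (Fin n)}
    (hx : x ∈ (extChartAt (𝓡 n) (1 : G)).target) :
    MDifferentiableAt (𝓡 n) (𝓡 n) (extChartAt (𝓡 n) (1 : G)).symm x :=
  ((contMDiffOn_extChartAt_symm (I := 𝓡 n) (n := ∞) (1 : G)).contMDiffAt
    ((isOpen_extChartAt_target 1).mem_nhds hx)).mdifferentiableAt (by simp)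

variable (n G) in
theorem hasModelDerivAt_chart_symm_one :
    HasModelDerivAt (𝓡 n) (𝓡 n) (extChartAt (𝓡 n) (1 : G)).symm (extChartAt (𝓡 n) (1 : G) 1)
      (ContinuousLinearMap.id ℝ (EuclideanSpace ℝ (Fin n))) := by
  have := isManifold_one_of_lieGroup n G
  have h := hasModelDerivAt_modelDeriv (mdifferentiableAt_chart_symm (n := n) (G := G)
    (mem_extChartAt_target 1))
  have h2 : modelDeriv (𝓡 n) (𝓡 n) (extChartAt (𝓡 n) (1 : G)).symm
      (extChartAt (𝓡 n) (1 : G) 1) = ContinuousLinearMap.id ℝ (EuclideanSpace ℝ (Fin n)) := by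
    have h3 := mfderivWithin_range_extChartAt_symm (I := 𝓡 n) (x := (1 : G))
    rw [ModelWithCorners.range_eq_univ, mfderivWithin_univ] at h3
    exact h3
  rwa [h2] at h

/-- The left-invariant vector field generated by `v`, in the chart centred at the identity. -/
noncomputable def chartInvariantField (n : ℕ) (G : Type*) [TopologicalSpace G]
    [ChartedSpace (EuclideanSpace ℝ (Fin n)) G] [Group G]
    (x v : EuclideanSpace ℝ (Fin n)) : EuclideanSpace ℝ (Fin n) :=
  fderiv ℝ (chartMul n G) (x, extChartAt (𝓡 n) (1 : G) 1) (0, v)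

variable (n G) in
theorem contDiffOn_chartInvariantField :
    ContDiffOn ℝ ∞ (fun p : EuclideanSpace ℝ (Fin n) × EuclideanSpace ℝ (Fin n) =>
      chartInvariantField n G p.1 p.2) ((extChartAt (𝓡 n) (1 : G)).target ×ˢ Set.univ) := by
  have h1 : ContDiffOn ℝ ∞ (fderiv ℝ (chartMul n G)) (chartMulDomain n G) :=
    (contDiffOn_chartMul n G).fderiv_of_isOpen (isOpen_chartMulDomain n G) (by simp)
  refine ContDiffOn.clm_apply (h1.comp (f := fun p : EuclideanSpace ℝ (Fin n) ×
    EuclideanSpace ℝ (Fin n) => (p.1, extChartAt (𝓡 n) (1 : G) 1))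
    (contDiff_fst.prodMk contDiff_const).contDiffOn fun p hp =>
      chart_left_mem_chartMulDomain hp.1) (contDiff_const.prodMk contDiff_snd).contDiffOn

theorem modelDeriv_chart_symm_chartInvariantField {x : EuclideanSpace ℝ (Fin n)}
    (hx : x ∈ (extChartAt (𝓡 n) (1 : G)).target) (v : GroupLieAlgebra (𝓡 n) G) :
    modelDeriv (𝓡 n) (𝓡 n) (extChartAt (𝓡 n) (1 : G)).symm x
      (chartInvariantField n G x (toModel v)) =
      mulInvariantVectorField v ((extChartAt (𝓡 n) (1 : G)).symm x) := by
  have hdom := chart_left_mem_chartMulDomain hx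
  have h1 : HasFDerivAt (fun y => chartMul n G (x, y))
      (fderiv ℝ (chartMul n G) (x, extChartAt (𝓡 n) (1 : G) 1) ∘L
        ContinuousLinearMap.inr ℝ _ _) (extChartAt (𝓡 n) (1 : G) 1) := by
    have h0 := (((contDiffOn_chartMul n G).contDiffAt
      ((isOpen_chartMulDomain n G).mem_nhds hdom)).differentiableAt (by simp)).hasFDerivAt
    exact h0.comp (extChartAt (𝓡 n) (1 : G) 1) (hasFDerivAt_prodMk_right x _)
  have h2 := (hasModelDerivAt_modelDeriv (mdifferentiableAt_chart_symm hx)).comp_of_eq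
    (hasModelDerivAt_iff_hasFDerivAt.2 h1) (chartMul_left hx)
  have h3 := (hasModelDerivAt_modelDeriv
    (mdifferentiable_mul_left (n := n) ((extChartAt (𝓡 n) (1 : G)).symm x) 1)).comp_of_eq
    (hasModelDerivAt_chart_symm_one n G) (extChartAt_to_inv 1)
  have h4 := h2.unique h3 (by
    have hc : ContinuousAt (fun y : EuclideanSpace ℝ (Fin n) => (x, y))
      (extChartAt (𝓡 n) (1 : G) 1) := by fun_prop
    filter_upwards [hc.preimage_mem_nhds ((isOpen_chartMulDomain n G).mem_nhds hdom)] with y hy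
    exact chart_symm_chartMul hy)
  exact congrArg (fun L : EuclideanSpace ℝ (Fin n) →L[ℝ] EuclideanSpace ℝ (Fin n) =>
    L (toModel v)) h4

end LieGroups

/-! ### The exponential map of a Lie group -/

section Exponential

set_option linter.unusedSectionVars false

open Set Metric

variable {n : ℕ} {G : Type*} [TopologicalSpace G] [ChartedSpace (EuclideanSpace ℝ (Fin n)) G]
  [Group G] [LieGroup (𝓡 n) ∞ G]

theorem contMDiff_one_mulInvariantVectorField (v : GroupLieAlgebra (𝓡 n) G) :
    ContMDiff (𝓡 n) (𝓡 n).tangent 1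
      (fun g : G => (⟨g, mulInvariantVectorField v g⟩ : TangentBundle (𝓡 n) G)) :=
  (contMDiff_mulInvariantVectorField v).of_le (by
    rw [minSmoothness_of_isRCLikeNormedField]
    norm_num)

/-- The map `t ↦ t • w`. -/
noncomputable def lineMap {E : Type*} [NormedAddCommGroup E] [NormedSpace ℝ E] (w : E) :
    ℝ →L[ℝ] E :=
  (1 : ℝ →L[ℝ] ℝ).smulRight w

/-- The value at `g` of the left-invariant vector field generated by `v`, as a vector of the model
space. -/
noncomputable def leftField (v : GroupLieAlgebra (𝓡 n) G) (g : G) : EuclideanSpace ℝ (Fin n) :=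
  mulInvariantVectorField v g

theorem isMIntegralCurveOn_mulInvariantVectorField {v : GroupLieAlgebra (𝓡 n) G} {γ : ℝ → G}
    {s : Set ℝ}
    (h : ∀ t ∈ s, HasModelDerivAt 𝓘(ℝ, ℝ) (𝓡 n) γ t
      (lineMap (leftField v (γ t)))) :
    IsMIntegralCurveOn γ (mulInvariantVectorField v) s := fun t ht =>
  HasMFDerivAt.hasMFDerivWithinAt (h t ht)

theorem isMIntegralCurveOn_mul_left {v : GroupLieAlgebra (𝓡 n) G} {γ : ℝ → G} {s : Set ℝ}
    (hs : IsOpen s) (h : IsMIntegralCurveOn γ (mulInvariantVectorField v) s) (g : G) :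
    IsMIntegralCurveOn (fun t => g * γ t) (mulInvariantVectorField v) s := by
  refine isMIntegralCurveOn_mulInvariantVectorField fun t ht => ?_
  have h1 : HasModelDerivAt 𝓘(ℝ, ℝ) (𝓡 n) γ t
      (lineMap (leftField v (γ t))) :=
    HasMFDerivWithinAt.hasMFDerivAt (h t ht) (hs.mem_nhds ht)
  have h2 := (hasModelDerivAt_modelDeriv (mdifferentiable_mul_left (n := n) g (γ t))).comp_of_eq
    h1 rfl
  have h3 : modelDeriv (𝓡 n) (𝓡 n) (fun a => g * a) (γ t) ∘L
      lineMap (leftField v (γ t)) =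
      lineMap (leftField v (g * γ t)) := by
    ext1
    change modelDeriv (𝓡 n) (𝓡 n) (fun a => g * a) (γ t) ((1 : ℝ) •
      (leftField v (γ t))) =
      (1 : ℝ) • (leftField v (g * γ t))
    rw [one_smul, one_smul]
    exact mfderiv_mul_left_mulInvariantVectorField g (γ t) v
  rwa [h3] at h2

variable (n G) in
/-- Near time zero, the integral curves through the identity of the left-invariant vector fields
depend smoothly on the field. -/
theorem exists_local_integralCurve :
    ∃ (α : ℝ → EuclideanSpace ℝ (Fin n) → G) (r : ℝ), 0 < r ∧
      (∀ v ∈ ball (0 : EuclideanSpace ℝ (Fin n)) r, α 0 v = 1) ∧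
      (∀ t ∈ ball (0 : ℝ) r, ContMDiffOn (𝓡 n) (𝓡 n) ∞ (α t) (ball 0 r)) ∧
      ∀ v : GroupLieAlgebra (𝓡 n) G, toModel v ∈ ball (0 : EuclideanSpace ℝ (Fin n)) r →
        IsMIntegralCurveOn (fun t => α t (toModel v)) (mulInvariantVectorField v) (Ioo (-r) r) := by
  obtain ⟨e, he⟩ : ∃ e, e = extChartAt (𝓡 n) (1 : G) 1 := ⟨_, rfl⟩
  have het : e ∈ (extChartAt (𝓡 n) (1 : G)).target := he ▸ mem_extChartAt_target 1
  obtain ⟨φ, r, hr, hφ, hφ0, hφU, hφd⟩ := exists_local_flow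
    (E := EuclideanSpace ℝ (Fin n) × EuclideanSpace ℝ (Fin n))
    (F := fun p => (chartInvariantField n G p.1 p.2, 0)) (x₀ := (e, 0))
    ((isOpen_extChartAt_target (1 : G)).prod isOpen_univ)
    ((contDiffOn_chartInvariantField n G).prodMk contDiffOn_const) ⟨het, mem_univ _⟩
  have hmem : ∀ v ∈ ball (0 : EuclideanSpace ℝ (Fin n)) r,
      (e, v) ∈ ball (e, (0 : EuclideanSpace ℝ (Fin n))) r := fun v hv => by
    rw [← ball_prod_same]
    exact ⟨mem_ball_self hr, hv⟩
  -- the parameter is constant along the flow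
  have hsnd : ∀ v ∈ ball (0 : EuclideanSpace ℝ (Fin n)) r, ∀ t ∈ ball (0 : ℝ) r,
      (φ t (e, v)).2 = v := by
    intro v hv t ht
    have hd : ∀ s ∈ ball (0 : ℝ) r, HasDerivAt (fun s => (φ s (e, v)).2) 0 s := fun s hs =>
      (hφd s hs (e, v) (hmem v hv)).snd
    have h1 := (convex_ball (0 : ℝ) r).is_const_of_fderivWithin_eq_zero (𝕜 := ℝ)
      (fun s hs => (hd s hs).differentiableAt.differentiableWithinAt)
      (fun s hs => by
        have h2 := (hd s hs).hasFDerivAt.hasFDerivWithinAt.fderivWithin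
          (isOpen_ball.uniqueDiffWithinAt hs)
        rw [h2]
        ext
        simp) ht (mem_ball_self hr)
    rw [h1, hφ0 _ (hmem v hv)]
  refine ⟨fun t v => (extChartAt (𝓡 n) (1 : G)).symm (φ t (e, v)).1, r, hr, ?_, ?_, ?_⟩
  · intro v hv
    simp only [hφ0 _ (hmem v hv)]
    rw [he, extChartAt_to_inv]
  · intro t ht
    have h1 : ContDiffOn ℝ ∞ (fun v => (φ t (e, v)).1) (ball 0 r) := by
      refine contDiff_fst.comp_contDiffOn (hφ.comp (f := fun v => (t, (e, v)))
        (contDiff_const.prodMk (contDiff_const.prodMk contDiff_id)).contDiffOn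
        fun v hv => ⟨ht, hmem v hv⟩)
    exact (contMDiffOn_extChartAt_symm (I := 𝓡 n) (n := ∞) (1 : G)).comp h1.contMDiffOn
      fun v hv => (hφU t ht _ (hmem v hv)).1
  · intro v hv
    refine isMIntegralCurveOn_mulInvariantVectorField fun t ht => ?_
    have ht' : t ∈ ball (0 : ℝ) r := by
      rwa [Real.ball_eq_Ioo, zero_sub, zero_add]
    have hx := (hφU t ht' _ (hmem _ hv)).1
    have h1 : HasDerivAt (fun s => (φ s (e, toModel v)).1)
        (chartInvariantField n G (φ t (e, toModel v)).1 (toModel v)) t := by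
      have := (hφd t ht' _ (hmem _ hv)).fst
      simp only [hsnd _ hv t ht'] at this
      exact this
    have h2 := (hasModelDerivAt_modelDeriv (mdifferentiableAt_chart_symm hx)).comp_of_eq
      (hasModelDerivAt_iff_hasFDerivAt.2 h1.hasFDerivAt) rfl
    have h3 : modelDeriv (𝓡 n) (𝓡 n) (extChartAt (𝓡 n) (1 : G)).symm (φ t (e, toModel v)).1 ∘L
        ContinuousLinearMap.toSpanSingleton ℝ
          (chartInvariantField n G (φ t (e, toModel v)).1 (toModel v)) =
        lineMap (leftField v ((extChartAt (𝓡 n) (1 : G)).symm (φ t (e, toModel v)).1)) := by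
      ext1
      change modelDeriv (𝓡 n) (𝓡 n) (extChartAt (𝓡 n) (1 : G)).symm (φ t (e, toModel v)).1
        ((1 : ℝ) • chartInvariantField n G (φ t (e, toModel v)).1 (toModel v)) =
        (1 : ℝ) • (leftField v ((extChartAt (𝓡 n) (1 : G)).symm (φ t (e, toModel v)).1))
      rw [one_smul, one_smul]
      exact modelDeriv_chart_symm_chartInvariantField hx v
    rw [h3] at h2
    exact h2

theorem mulInvariantVectorField_smul_apply (c : ℝ) (v : GroupLieAlgebra (𝓡 n) G) :
    (mulInvariantVectorField (c • v) : (g : G) → TangentSpace (𝓡 n) g) =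
      c • mulInvariantVectorField v :=
  mulInvariantVectorField_smul c v

/-- A left-invariant vector field is complete. -/
theorem exists_isMIntegralCurve_mulInvariantVectorField (v : GroupLieAlgebra (𝓡 n) G) :
    ∃ γ : ℝ → G, γ 0 = 1 ∧ IsMIntegralCurve γ (mulInvariantVectorField v) := by
  have := t2Space_of_lieGroup n G
  have := isManifold_one_of_lieGroup n G
  obtain ⟨α, r, hr, h0, -, hα⟩ := exists_local_integralCurve n G
  -- Local integral curves exist for a uniform time once `v` is scaled into a small ball; left
  -- translation extends them to all times, and rescaling time undoes the factor `c`.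
  obtain ⟨c, hc, hcv⟩ : ∃ c : ℝ, 0 < c ∧
      c • toModel v ∈ ball (0 : EuclideanSpace ℝ (Fin n)) r := by
    refine ⟨r / (2 * (‖toModel v‖ + 1)), by positivity, ?_⟩
    rw [mem_ball_zero_iff, norm_smul, Real.norm_of_nonneg (by positivity), div_mul_eq_mul_div,
      div_lt_iff₀ (by positivity)]
    nlinarith [norm_nonneg (toModel v)]
  obtain ⟨γ, hγ0, hγ⟩ := exists_isMIntegralCurve_of_isMIntegralCurveOn
    (contMDiff_one_mulInvariantVectorField (c • v)) hr
    (fun g => ⟨fun t => g * α t (c • toModel v), by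
      change g * α 0 (c • toModel v) = g
      rw [h0 _ hcv, mul_one],
      isMIntegralCurveOn_mul_left isOpen_Ioo (hα (c • v) hcv) g⟩) (1 : G)
  refine ⟨γ ∘ (· * c⁻¹), by simp [hγ0], ?_⟩
  have h1 := hγ.comp_mul c⁻¹
  rwa [mulInvariantVectorField_smul_apply, smul_smul, inv_mul_cancel₀ hc.ne', one_smul] at h1

/-- The exponential map of a Lie group is smooth. -/
theorem exists_smooth_exp (n : ℕ) (G : Type*) [TopologicalSpace G]
    [ChartedSpace (EuclideanSpace ℝ (Fin n)) G] [Group G] [LieGroup (𝓡 n) ∞ G] :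
    ∃ Exp : EuclideanSpace ℝ (Fin n) → G, ContMDiff (𝓡 n) (𝓡 n) ∞ Exp ∧
      ∀ v : GroupLieAlgebra (𝓡 n) G,
        IsOneParameterSubgroup v (fun t : ℝ => Exp (t • toModel v)) := by
  have := t2Space_of_lieGroup n G
  have := isManifold_one_of_lieGroup n G
  choose γ hγ0 hγ using exists_isMIntegralCurve_mulInvariantVectorField (n := n) (G := G)
  have hscale : ∀ (c : ℝ) (v : GroupLieAlgebra (𝓡 n) G) (t : ℝ), γ (c • v) t = γ v (t * c) := by
    intro c v t
    have h1 := (hγ v).comp_mul c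
    rw [← mulInvariantVectorField_smul_apply] at h1
    refine congrFun (isMIntegralCurve_Ioo_eq_of_contMDiff_boundaryless (t₀ := 0)
      (contMDiff_one_mulInvariantVectorField (c • v)) (hγ (c • v)) h1 ?_) t
    simp [hγ0]
  have hadd : ∀ (v : GroupLieAlgebra (𝓡 n) G) (s t : ℝ), γ v (s + t) = γ v s * γ v t := by
    intro v s t
    have h1 := (hγ v).comp_add s
    have h2 : IsMIntegralCurve (fun t => γ v s * γ v t) (mulInvariantVectorField v) :=
      isMIntegralCurve_iff_isMIntegralCurveOn.2
        (isMIntegralCurveOn_mul_left isOpen_univ ((hγ v).isMIntegralCurveOn univ) (γ v s))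
    have h3 := congrFun (isMIntegralCurve_Ioo_eq_of_contMDiff_boundaryless (t₀ := 0)
      (contMDiff_one_mulInvariantVectorField v) h1 h2 (by simp [hγ0])) t
    rw [← h3, Function.comp_apply, add_comm]
  have hpow : ∀ (v : GroupLieAlgebra (𝓡 n) G) (N : ℕ) (t : ℝ), γ v (N * t) = γ v t ^ N := by
    intro v N t
    induction N with
    | zero => simp [hγ0]
    | succ N ih => rw [Nat.cast_succ, add_mul, one_mul, hadd, ih, pow_succ]
  -- The local flow of the field depending on the parameter `v` gives smoothness near zero, and
  -- `Exp w = Exp (w / N) ^ N` carries it to arbitrary bounded sets.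
  let Exp : EuclideanSpace ℝ (Fin n) → G := fun v => γ v 1
  have hExp : ∀ (v : GroupLieAlgebra (𝓡 n) G) (t : ℝ), Exp (t • toModel v) = γ v t := by
    intro v t
    have h1 := hscale t v 1
    rw [one_mul] at h1
    exact h1
  obtain ⟨α, r, hr, h0, hsm, hα⟩ := exists_local_integralCurve n G
  have hlocal : ContMDiffOn (𝓡 n) (𝓡 n) ∞ Exp (ball 0 (r / 2 * r)) := by
    have h1 : ContMDiffOn (𝓡 n) (𝓡 n) ∞ (fun v => α (r / 2) ((r / 2)⁻¹ • v))
        (ball 0 (r / 2 * r)) := by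
      refine (hsm (r / 2) ?_).comp (contDiff_const_smul (r / 2)⁻¹).contMDiff.contMDiffOn ?_
      · rw [mem_ball_zero_iff, Real.norm_of_nonneg (by positivity)]
        linarith
      · intro v hv
        rw [mem_ball_zero_iff] at hv
        rw [mem_preimage, mem_ball_zero_iff, norm_smul, Real.norm_of_nonneg (by positivity),
          inv_mul_lt_iff₀ (by positivity)]
        exact hv
    refine h1.congr fun v hv => ?_
    obtain ⟨w, hw⟩ : ∃ w : GroupLieAlgebra (𝓡 n) G, toModel w = (r / 2)⁻¹ • v :=
      ⟨(r / 2)⁻¹ • v, rfl⟩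
    have hwr : toModel w ∈ ball (0 : EuclideanSpace ℝ (Fin n)) r := by
      rw [mem_ball_zero_iff] at hv
      rw [hw, mem_ball_zero_iff, norm_smul, Real.norm_of_nonneg (by positivity),
          inv_mul_lt_iff₀ (by positivity)]
      exact hv
    have hv' : v = (r / 2) • toModel w := by
      rw [hw, smul_smul, mul_inv_cancel₀ (by positivity), one_smul]
    rw [← hw]
    conv_lhs => rw [hv', hExp]
    exact isMIntegralCurveOn_Ioo_eqOn_of_contMDiff_boundaryless (t₀ := 0)
      (by simpa using hr) (contMDiff_one_mulInvariantVectorField w)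
      ((hγ w).isMIntegralCurveOn _) (hα w hwr) (by rw [hγ0, h0 _ hwr])
      ⟨by linarith, by linarith⟩
  have hsmooth : ContMDiff (𝓡 n) (𝓡 n) ∞ Exp := by
    intro v
    obtain ⟨N, hN⟩ := exists_nat_gt (‖v‖ / (r / 2 * r))
    have hN0 : (0 : ℝ) < N := lt_of_le_of_lt (by positivity) hN
    have h1 : ContMDiffAt (𝓡 n) (𝓡 n) ∞ (fun w => Exp ((N : ℝ)⁻¹ • w)) v := by
      refine ContMDiffAt.comp v (hlocal.contMDiffAt (isOpen_ball.mem_nhds ?_))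
        (contDiff_const_smul (N : ℝ)⁻¹).contMDiff.contMDiffAt
      rw [mem_ball_zero_iff, norm_smul, Real.norm_of_nonneg (by positivity),
          inv_mul_lt_iff₀ hN0]
      rwa [div_lt_iff₀ (by positivity)] at hN
    have h2 : Exp = fun w => Exp ((N : ℝ)⁻¹ • w) ^ N := by
      funext w
      have h3 := hpow w N (N : ℝ)⁻¹
      rw [mul_inv_cancel₀ hN0.ne'] at h3
      have h4 := hExp w (N : ℝ)⁻¹
      rw [← h4] at h3
      exact h3
    rw [h2]
    exact (contMDiff_pow N).contMDiffAt.comp v h1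
  refine ⟨Exp, hsmooth, fun v => ⟨?_, ?_, ?_⟩⟩
  · exact hsmooth.comp (contDiff_id.smul contDiff_const).contMDiff
  · intro s t
    simp only [hExp, hadd]
  · have h1 : HasModelDerivAt 𝓘(ℝ, ℝ) (𝓡 n) (γ v) 0
        (lineMap (leftField v (γ v 0))) := hγ v 0
    rw [show (fun t : ℝ => Exp (t • toModel v)) = γ v from funext (hExp v)]
    have h2 : modelDeriv 𝓘(ℝ, ℝ) (𝓡 n) (γ v) 0 1 = toModel v := by
      rw [h1.modelDeriv_eq, hγ0]
      change (1 : ℝ) • (mulInvariantVectorField v (1 : G) : EuclideanSpace ℝ (Fin n)) = v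
      rw [one_smul]
      exact mulInvariantVectorField_one v
    exact h2

end Exponential

/-! ### The adjoint representation -/

section Adjoint

set_option linter.unusedSectionVars false

variable {n : ℕ} {G : Type*} [TopologicalSpace G] [ChartedSpace (EuclideanSpace ℝ (Fin n)) G]
  [Group G] [LieGroup (𝓡 n) ∞ G]

theorem mdifferentiable_mul_right (g : G) : MDifferentiable (𝓡 n) (𝓡 n) (fun h : G => h * g) :=
  (contMDiff_mul_right (I := 𝓡 n) (n := ∞)).mdifferentiable (by simp)

theorem contMDiff_conj (g : G) : ContMDiff (𝓡 n) (𝓡 n) ∞ (fun h : G => g * h * g⁻¹) :=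
  (contMDiff_mul_right (I := 𝓡 n) (n := ∞) (a := g⁻¹)).comp
    (contMDiff_mul_left (I := 𝓡 n) (n := ∞) (a := g))

theorem mdifferentiable_conj (g : G) : MDifferentiable (𝓡 n) (𝓡 n) (fun h : G => g * h * g⁻¹) :=
  (contMDiff_conj g).mdifferentiable (by simp)

/-- The adjoint representation, on the model space. -/
noncomputable def modelAd (n : ℕ) {G : Type*} [TopologicalSpace G]
    [ChartedSpace (EuclideanSpace ℝ (Fin n)) G] [Group G] (g : G) :
    EuclideanSpace ℝ (Fin n) →L[ℝ] EuclideanSpace ℝ (Fin n) :=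
  modelDeriv (𝓡 n) (𝓡 n) (fun h : G => g * h * g⁻¹) 1

theorem toModel_Ad (g : G) (A : GroupLieAlgebra (𝓡 n) G) :
    toModel (Ad g A) = modelAd n g (toModel A) := rfl

theorem hasModelDerivAt_conj (g : G) :
    HasModelDerivAt (𝓡 n) (𝓡 n) (fun h : G => g * h * g⁻¹) 1 (modelAd n g) :=
  hasModelDerivAt_modelDeriv (mdifferentiable_conj g 1)

theorem modelAd_mul (g h : G) : modelAd n (g * h) = modelAd n g ∘L modelAd n h := by
  have h1 := (hasModelDerivAt_conj (n := n) g).comp_of_eq (hasModelDerivAt_conj h) (by simp)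
  exact (hasModelDerivAt_conj (n := n) (g * h)).unique h1
    (Filter.Eventually.of_forall fun a => by simp [mul_assoc])

theorem modelAd_one : modelAd n (1 : G) = ContinuousLinearMap.id ℝ _ :=
  (hasModelDerivAt_conj (n := n) (1 : G)).unique (hasModelDerivAt_id 1)
    (Filter.Eventually.of_forall fun a => by simp)

theorem Ad_mul (g h : G) (A : GroupLieAlgebra (𝓡 n) G) : Ad (g * h) A = Ad g (Ad h A) :=
  congrArg (fun L : EuclideanSpace ℝ (Fin n) →L[ℝ] EuclideanSpace ℝ (Fin n) => L (toModel A))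
    (modelAd_mul g h)

theorem Ad_one (A : GroupLieAlgebra (𝓡 n) G) : Ad (1 : G) A = A :=
  congrArg (fun L : EuclideanSpace ℝ (Fin n) →L[ℝ] EuclideanSpace ℝ (Fin n) => L (toModel A))
    modelAd_one

theorem Ad_inv_Ad (g : G) (A : GroupLieAlgebra (𝓡 n) G) : Ad g⁻¹ (Ad g A) = A := by
  rw [← Ad_mul, inv_mul_cancel, Ad_one]

theorem Ad_Ad_inv (g : G) (A : GroupLieAlgebra (𝓡 n) G) : Ad g (Ad g⁻¹ A) = A := by
  rw [← Ad_mul, mul_inv_cancel, Ad_one]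

theorem modelDeriv_conj_leftField (g h : G) (A : GroupLieAlgebra (𝓡 n) G) :
    modelDeriv (𝓡 n) (𝓡 n) (fun a : G => g * a * g⁻¹) h (leftField A h) =
      leftField (Ad g A) (g * h * g⁻¹) := by
  have h1 := (hasModelDerivAt_modelDeriv (mdifferentiable_conj (n := n) g h)).comp_of_eq
    (hasModelDerivAt_modelDeriv (mdifferentiable_mul_left (n := n) h 1)) (mul_one h)
  have h2 := (hasModelDerivAt_modelDeriv (mdifferentiable_mul_left (n := n)
    (g * h * g⁻¹) 1)).comp_of_eq (hasModelDerivAt_conj (n := n) g) (by simp)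
  have h3 := h1.unique h2 (Filter.Eventually.of_forall fun a => by simp [mul_assoc])
  exact congrArg (fun L : EuclideanSpace ℝ (Fin n) →L[ℝ] EuclideanSpace ℝ (Fin n) =>
    L (toModel A)) h3

theorem modelDeriv_conj_comp (g h : G) :
    modelDeriv (𝓡 n) (𝓡 n) (fun a : G => g⁻¹ * a * g⁻¹⁻¹) (g * h * g⁻¹) ∘L
      modelDeriv (𝓡 n) (𝓡 n) (fun a : G => g * a * g⁻¹) h = ContinuousLinearMap.id ℝ _ := by
  have h1 := (hasModelDerivAt_modelDeriv (mdifferentiable_conj (n := n) g⁻¹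
    (g * h * g⁻¹))).comp_of_eq (hasModelDerivAt_modelDeriv (mdifferentiable_conj (n := n) g h)) rfl
  exact h1.unique (hasModelDerivAt_id h)
    (Filter.Eventually.of_forall fun a => by simp [mul_assoc])

/-- Conjugation by `g` carries left-invariant fields to left-invariant fields, acting by `Ad g` on
generators; with naturality of the bracket of vector fields this gives `Ad_lie`. -/
theorem mpullback_conj_mulInvariantVectorField (g : G) (A : GroupLieAlgebra (𝓡 n) G) :
    VectorField.mpullback (𝓡 n) (𝓡 n) (fun h : G => g * h * g⁻¹)
      (mulInvariantVectorField (Ad g A)) = mulInvariantVectorField A := by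
  funext h
  have hinv : (modelDeriv (𝓡 n) (𝓡 n) (fun a : G => g * a * g⁻¹) h).inverse
      (leftField (Ad g A) (g * h * g⁻¹)) = leftField A h := by
    have h1 := modelDeriv_conj_comp (n := n) g h
    have h2 : modelDeriv (𝓡 n) (𝓡 n) (fun a : G => g * a * g⁻¹) h ∘L
        modelDeriv (𝓡 n) (𝓡 n) (fun a : G => g⁻¹ * a * g⁻¹⁻¹) (g * h * g⁻¹) =
        ContinuousLinearMap.id ℝ _ := by
      have h3 := modelDeriv_conj_comp (n := n) g⁻¹ (g * h * g⁻¹)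
      have h4 : g⁻¹ * (g * h * g⁻¹) * g⁻¹⁻¹ = h := by group
      simp only [inv_inv] at h3 h4 ⊢
      rwa [h4] at h3
    rw [ContinuousLinearMap.inverse_eq h2 h1, ← modelDeriv_conj_leftField]
    exact congrArg (fun L : EuclideanSpace ℝ (Fin n) →L[ℝ] EuclideanSpace ℝ (Fin n) =>
      L (leftField A h)) h1
  exact hinv

/-- The adjoint representation acts by automorphisms of the Lie algebra. -/
theorem Ad_lie (g : G) (A A' : GroupLieAlgebra (𝓡 n) G) : Ad g ⁅A, A'⁆ = ⁅Ad g A, Ad g A'⁆ := by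
  have := isManifold_one_of_lieGroup n G
  have hM : IsManifold (𝓡 n) (minSmoothness ℝ 2) G := IsManifold.of_le (n := ∞) (by
    rw [minSmoothness_of_isRCLikeNormedField]
    exact ENat.LEInfty.out)
  have h1 := VectorField.mpullback_mlieBracket (I := 𝓡 n) (I' := 𝓡 n) (n := ∞) (x₀ := (1 : G))
    (f := fun h : G => g * h * g⁻¹)
    (mdifferentiableAt_mulInvariantVectorField (Ad g A))
    (mdifferentiableAt_mulInvariantVectorField (Ad g A')) (contMDiff_conj g).contMDiffAt
    (by
      rw [minSmoothness_of_isRCLikeNormedField]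
      exact ENat.LEInfty.out)
  rw [mpullback_conj_mulInvariantVectorField, mpullback_conj_mulInvariantVectorField,
    ← mulInvariantVector_mlieBracket] at h1
  have h2 := mpullback_conj_mulInvariantVectorField g (Ad g⁻¹ ⁅Ad g A, Ad g A'⁆)
  rw [Ad_Ad_inv] at h2
  have h3 : mulInvariantVectorField (Ad g⁻¹ ⁅Ad g A, Ad g A'⁆) (1 : G) = ⁅A, A'⁆ :=
    (congrFun h2 1).symm.trans h1
  have h4 : Ad g⁻¹ ⁅Ad g A, Ad g A'⁆ = ⁅A, A'⁆ :=
    (mulInvariantVectorField_one (Ad g⁻¹ ⁅Ad g A, Ad g A'⁆)).symm.trans h3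
  rw [← h4, Ad_Ad_inv]

/-- The adjoint action of `g` as an automorphism of the Lie algebra. -/
noncomputable def AdEquiv (g : G) :
    GroupLieAlgebra (𝓡 n) G ≃ₗ⁅ℝ⁆ GroupLieAlgebra (𝓡 n) G where
  toFun := Ad g
  invFun := Ad g⁻¹
  map_add' := (Ad g).map_add
  map_smul' := (Ad g).map_smul
  map_lie' := Ad_lie g _ _
  left_inv := Ad_inv_Ad g
  right_inv := Ad_Ad_inv g

theorem modelDeriv_mul_right_modelAd (g : G) (v : GroupLieAlgebra (𝓡 n) G) :
    modelDeriv (𝓡 n) (𝓡 n) (fun h : G => h * g) 1 (modelAd n g (toModel v)) = leftField v g := by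
  have h1 := (hasModelDerivAt_modelDeriv (mdifferentiable_mul_right (n := n) g 1)).comp_of_eq
    (hasModelDerivAt_conj (n := n) g) (by simp)
  have h2 := hasModelDerivAt_modelDeriv (mdifferentiable_mul_left (n := n) g 1)
  exact congrArg (fun L : EuclideanSpace ℝ (Fin n) →L[ℝ] EuclideanSpace ℝ (Fin n) =>
    L (toModel v)) (h1.unique h2 (Filter.Eventually.of_forall fun a => by simp))

theorem hasFDerivAt_chartMul {p : EuclideanSpace ℝ (Fin n) × EuclideanSpace ℝ (Fin n)}
    (hp : p ∈ chartMulDomain n G) :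
    HasFDerivAt (chartMul n G) (fderiv ℝ (chartMul n G) p) p :=
  (((contDiffOn_chartMul n G).contDiffAt
    ((isOpen_chartMulDomain n G).mem_nhds hp)).differentiableAt (by simp)).hasFDerivAt

/-- The derivative of right translation, in the chart centred at the identity. -/
noncomputable def chartRightTranslation (n : ℕ) (G : Type*) [TopologicalSpace G]
    [ChartedSpace (EuclideanSpace ℝ (Fin n)) G] [Group G] (x : EuclideanSpace ℝ (Fin n)) :
    EuclideanSpace ℝ (Fin n) →L[ℝ] EuclideanSpace ℝ (Fin n) :=
  fderiv ℝ (chartMul n G) (extChartAt (𝓡 n) (1 : G) 1, x) ∘L ContinuousLinearMap.inl ℝ _ _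

theorem modelDeriv_chart_symm_comp_chartRightTranslation {x : EuclideanSpace ℝ (Fin n)}
    (hx : x ∈ (extChartAt (𝓡 n) (1 : G)).target) :
    modelDeriv (𝓡 n) (𝓡 n) (extChartAt (𝓡 n) (1 : G)).symm x ∘L chartRightTranslation n G x =
      modelDeriv (𝓡 n) (𝓡 n) (fun h : G => h * (extChartAt (𝓡 n) (1 : G)).symm x) 1 := by
  have hdom := chart_right_mem_chartMulDomain (G := G) hx
  have h1 : HasFDerivAt (fun y => chartMul n G (y, x)) (chartRightTranslation n G x)
      (extChartAt (𝓡 n) (1 : G) 1) :=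
    HasFDerivAt.comp (f := fun y => (y, x)) (g := chartMul n G) (extChartAt (𝓡 n) (1 : G) 1)
      (hasFDerivAt_chartMul hdom) (hasFDerivAt_prodMk_left _ x)
  have h2 := (hasModelDerivAt_modelDeriv (mdifferentiableAt_chart_symm hx)).comp_of_eq
    (hasModelDerivAt_iff_hasFDerivAt.2 h1) (chartMul_right hx)
  have h3 := (hasModelDerivAt_modelDeriv
    (mdifferentiable_mul_right (n := n) ((extChartAt (𝓡 n) (1 : G)).symm x) 1)).comp_of_eq
    (hasModelDerivAt_chart_symm_one n G) (extChartAt_to_inv 1)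
  refine h2.unique h3 ?_
  have hc : ContinuousAt (fun y : EuclideanSpace ℝ (Fin n) => (y, x))
    (extChartAt (𝓡 n) (1 : G) 1) := by fun_prop
  filter_upwards [hc.preimage_mem_nhds ((isOpen_chartMulDomain n G).mem_nhds hdom)] with y hy
  exact chart_symm_chartMul hy

theorem isInvertible_modelDeriv_chart_symm {x : EuclideanSpace ℝ (Fin n)}
    (hx : x ∈ (extChartAt (𝓡 n) (1 : G)).target) :
    (modelDeriv (𝓡 n) (𝓡 n) (extChartAt (𝓡 n) (1 : G)).symm x).IsInvertible := by
  have := isManifold_one_of_lieGroup n G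
  have h1 := isInvertible_mfderivWithin_extChartAt_symm (I := 𝓡 n) hx
  rw [ModelWithCorners.range_eq_univ, mfderivWithin_univ] at h1
  exact h1

/-- `dR_g (Ad g v) = dL_g v`, in the chart centred at the identity. -/
theorem chartRightTranslation_modelAd {x : EuclideanSpace ℝ (Fin n)}
    (hx : x ∈ (extChartAt (𝓡 n) (1 : G)).target) (v : EuclideanSpace ℝ (Fin n)) :
    chartRightTranslation n G x (modelAd n ((extChartAt (𝓡 n) (1 : G)).symm x) v) =
      chartInvariantField n G x v := by
  have h1 := modelDeriv_chart_symm_comp_chartRightTranslation hx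
  have h2 := modelDeriv_chart_symm_chartInvariantField hx v
  have h3 := modelDeriv_mul_right_modelAd ((extChartAt (𝓡 n) (1 : G)).symm x) v
  apply (isInvertible_modelDeriv_chart_symm hx).injective
  refine Eq.trans ?_ h2.symm
  refine Eq.trans ?_ h3
  exact congrArg (fun L : EuclideanSpace ℝ (Fin n) →L[ℝ] EuclideanSpace ℝ (Fin n) =>
    L (modelAd n ((extChartAt (𝓡 n) (1 : G)).symm x) v)) h1

variable (n G) in
/-- The second derivative of the multiplication at the identity. -/
noncomputable def chartMulHessian : EuclideanSpace ℝ (Fin n) × EuclideanSpace ℝ (Fin n) →L[ℝ]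
    EuclideanSpace ℝ (Fin n) × EuclideanSpace ℝ (Fin n) →L[ℝ] EuclideanSpace ℝ (Fin n) :=
  fderiv ℝ (fderiv ℝ (chartMul n G)) (extChartAt (𝓡 n) (1 : G) 1, extChartAt (𝓡 n) (1 : G) 1)

variable (n G) in
theorem hasFDerivAt_fderiv_chartMul :
    HasFDerivAt (fderiv ℝ (chartMul n G)) (chartMulHessian n G)
      (extChartAt (𝓡 n) (1 : G) 1, extChartAt (𝓡 n) (1 : G) 1) := by
  have h1 : ContDiffOn ℝ ∞ (fderiv ℝ (chartMul n G)) (chartMulDomain n G) :=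
    (contDiffOn_chartMul n G).fderiv_of_isOpen (isOpen_chartMulDomain n G) (by simp)
  exact ((h1.contDiffAt ((isOpen_chartMulDomain n G).mem_nhds (chart_left_mem_chartMulDomain
    (mem_extChartAt_target 1)))).differentiableAt (by simp)).hasFDerivAt

variable (n G) in
theorem chartMulHessian_symm (v w : EuclideanSpace ℝ (Fin n) × EuclideanSpace ℝ (Fin n)) :
    chartMulHessian n G v w = chartMulHessian n G w v := by
  have h := ((contDiffOn_chartMul n G).contDiffAt ((isOpen_chartMulDomain n G).mem_nhds
    (chart_left_mem_chartMulDomain (mem_extChartAt_target 1)))).isSymmSndFDerivAt (by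
      rw [minSmoothness_of_isRCLikeNormedField]
      exact ENat.LEInfty.out)
  exact h v w

theorem hasFDerivAt_chartInvariantField (v : EuclideanSpace ℝ (Fin n)) :
    HasFDerivAt (fun x => chartInvariantField n G x v)
      ((chartMulHessian n G).flip (0, v) ∘L ContinuousLinearMap.inl ℝ _ _)
      (extChartAt (𝓡 n) (1 : G) 1) := by
  have h1 := HasFDerivAt.comp (f := fun y => (y, extChartAt (𝓡 n) (1 : G) 1))
    (extChartAt (𝓡 n) (1 : G) 1) (hasFDerivAt_fderiv_chartMul n G)
    (hasFDerivAt_prodMk_left (𝕜 := ℝ) (extChartAt (𝓡 n) (1 : G) 1) (extChartAt (𝓡 n) (1 : G) 1))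
  have h2 := h1.clm_apply (hasFDerivAt_const ((0 : EuclideanSpace ℝ (Fin n)), v) _)
  refine h2.congr_fderiv ?_
  ext w
  simp

theorem hasFDerivAt_chartRightTranslation :
    HasFDerivAt (chartRightTranslation n G)
      ((ContinuousLinearMap.compL ℝ _ _ _).flip (ContinuousLinearMap.inl ℝ _ _) ∘L
        chartMulHessian n G ∘L ContinuousLinearMap.inr ℝ _ _)
      (extChartAt (𝓡 n) (1 : G) 1) := by
  have h1 := (hasFDerivAt_fderiv_chartMul n G).comp (extChartAt (𝓡 n) (1 : G) 1)
    (hasFDerivAt_prodMk_right (𝕜 := ℝ) (extChartAt (𝓡 n) (1 : G) 1) (extChartAt (𝓡 n) (1 : G) 1))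
  exact (((ContinuousLinearMap.compL ℝ _ _ _).flip
    (ContinuousLinearMap.inl ℝ _ _)).hasFDerivAt).comp (extChartAt (𝓡 n) (1 : G) 1) h1

variable (n G) in
theorem chartRightTranslation_one :
    chartRightTranslation n G (extChartAt (𝓡 n) (1 : G) 1) = ContinuousLinearMap.id ℝ _ := by
  have h1 := modelDeriv_chart_symm_comp_chartRightTranslation (n := n) (G := G)
    (mem_extChartAt_target 1)
  rw [(hasModelDerivAt_chart_symm_one n G).modelDeriv_eq, extChartAt_to_inv] at h1
  have h2 := (hasModelDerivAt_id (I₁ := 𝓡 n) (1 : G)).congr_of_eventuallyEq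
    (Filter.Eventually.of_forall fun h => mul_one h)
  rw [h2.modelDeriv_eq] at h1
  exact h1

/-- The Lie bracket of a Lie group is the antisymmetrization of the second derivative of the
multiplication. -/
theorem toModel_lie (A A' : GroupLieAlgebra (𝓡 n) G) :
    toModel ⁅A, A'⁆ = chartMulHessian n G (toModel A, 0) (0, toModel A') -
      chartMulHessian n G (toModel A', 0) (0, toModel A) := by
  have := isManifold_one_of_lieGroup n G
  have hfield : ∀ B : GroupLieAlgebra (𝓡 n) G,
      (VectorField.mpullbackWithin 𝓘(ℝ, EuclideanSpace ℝ (Fin n)) (𝓡 n)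
        (extChartAt (𝓡 n) (1 : G)).symm (mulInvariantVectorField B) (Set.range (𝓡 n)) :
        EuclideanSpace ℝ (Fin n) → EuclideanSpace ℝ (Fin n)) =ᶠ[nhds (extChartAt (𝓡 n) (1 : G) 1)]
      fun x => chartInvariantField n G x (toModel B) := by
    intro B
    filter_upwards [(isOpen_extChartAt_target (1 : G)).mem_nhds (mem_extChartAt_target 1)]
      with x hx
    have h1 : (modelDeriv (𝓡 n) (𝓡 n) (extChartAt (𝓡 n) (1 : G)).symm x).inverse
        (leftField B ((extChartAt (𝓡 n) (1 : G)).symm x)) =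
        chartInvariantField n G x (toModel B) := by
      rw [(isInvertible_modelDeriv_chart_symm hx).inverse_apply_eq]
      exact (modelDeriv_chart_symm_chartInvariantField hx B).symm
    rw [VectorField.mpullbackWithin_apply, ModelWithCorners.range_eq_univ, mfderivWithin_univ]
    exact h1
  have h1 := Filter.EventuallyEq.lieBracket_vectorField_eq (𝕜 := ℝ) (hfield A) (hfield A')
  have h2 : toModel ⁅A, A'⁆ = VectorField.lieBracket ℝ
      (VectorField.mpullbackWithin 𝓘(ℝ, EuclideanSpace ℝ (Fin n)) (𝓡 n)
        (extChartAt (𝓡 n) (1 : G)).symm (mulInvariantVectorField A) (Set.range (𝓡 n)) :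
        EuclideanSpace ℝ (Fin n) → EuclideanSpace ℝ (Fin n))
      (VectorField.mpullbackWithin 𝓘(ℝ, EuclideanSpace ℝ (Fin n)) (𝓡 n)
        (extChartAt (𝓡 n) (1 : G)).symm (mulInvariantVectorField A') (Set.range (𝓡 n)) :
        EuclideanSpace ℝ (Fin n) → EuclideanSpace ℝ (Fin n)) (extChartAt (𝓡 n) (1 : G) 1) := by
    have hid : ∀ (L : EuclideanSpace ℝ (Fin n) →L[ℝ] EuclideanSpace ℝ (Fin n)),
        L = ContinuousLinearMap.id ℝ _ → ∀ w, L.inverse w = w := by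
      rintro L rfl w
      rw [ContinuousLinearMap.inverse_id]
      rfl
    rw [GroupLieAlgebra.bracket_def, ← VectorField.mlieBracketWithin_univ,
      VectorField.mlieBracketWithin_apply, Set.preimage_univ, Set.univ_inter,
      ModelWithCorners.range_eq_univ]
    refine (hid _ mfderiv_extChartAt_self _).trans ?_
    exact congrFun (VectorField.lieBracketWithin_univ (𝕜 := ℝ)) _
  refine h2.trans (h1.trans ?_)
  rw [VectorField.lieBracket]
  simp only [(hasFDerivAt_chartInvariantField (G := G) (toModel A)).fderiv,
    (hasFDerivAt_chartInvariantField (G := G) (toModel A')).fderiv]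
  have h3 : ∀ v, chartInvariantField n G (extChartAt (𝓡 n) (1 : G) 1) v = v := fun v => by
    have h4 := modelDeriv_chart_symm_chartInvariantField (n := n) (G := G)
      (mem_extChartAt_target 1) v
    rw [(hasModelDerivAt_chart_symm_one n G).modelDeriv_eq, extChartAt_to_inv] at h4
    exact h4.trans (mulInvariantVectorField_one v)
  rw [h3, h3]
  simp

/-- The derivative of the adjoint representation is the Lie bracket. -/
theorem hasFDerivAt_modelAd_chart_symm (A A' : GroupLieAlgebra (𝓡 n) G) :
    ∃ L : EuclideanSpace ℝ (Fin n) →L[ℝ] EuclideanSpace ℝ (Fin n),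
      HasFDerivAt (fun x => modelAd n ((extChartAt (𝓡 n) (1 : G)).symm x) (toModel A')) L
        (extChartAt (𝓡 n) (1 : G) 1) ∧ L (toModel A) = toModel ⁅A, A'⁆ := by
  obtain ⟨e, he⟩ : ∃ e, extChartAt (𝓡 n) (1 : G) 1 = e := ⟨_, rfl⟩
  have hR := hasFDerivAt_chartRightTranslation (n := n) (G := G)
  have hl := hasFDerivAt_chartInvariantField (G := G) (toModel A')
  have hR1 := chartRightTranslation_one n G
  have hinv : ∀ᶠ x in nhds (extChartAt (𝓡 n) (1 : G) 1),
      (chartRightTranslation n G x).IsInvertible := by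
    have h1 := hR.continuousAt
    have h2 := ContinuousLinearEquiv.nhds
      (ContinuousLinearEquiv.refl ℝ (EuclideanSpace ℝ (Fin n)))
    rw [ContinuousAt, hR1] at h1
    exact h1.eventually h2
  have hI : DifferentiableAt ℝ (fun x => (chartRightTranslation n G x).inverse)
      (extChartAt (𝓡 n) (1 : G) 1) := by
    have h1 : DifferentiableAt ℝ ContinuousLinearMap.inverse
        (chartRightTranslation n G (extChartAt (𝓡 n) (1 : G) 1)) := by
      rw [hR1]
      exact (contDiffAt_map_inverse (n := 1) (ContinuousLinearEquiv.refl ℝ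
        (EuclideanSpace ℝ (Fin n)))).differentiableAt (by simp)
    exact h1.comp _ hR.differentiableAt
  have heq : (fun x => modelAd n ((extChartAt (𝓡 n) (1 : G)).symm x) (toModel A'))
      =ᶠ[nhds (extChartAt (𝓡 n) (1 : G) 1)]
      fun x => (chartRightTranslation n G x).inverse (chartInvariantField n G x (toModel A')) := by
    filter_upwards [hinv, (isOpen_extChartAt_target (1 : G)).mem_nhds (mem_extChartAt_target 1)]
      with x hx hxt
    symm
    rw [hx.inverse_apply_eq]
    exact (chartRightTranslation_modelAd hxt _).symm
  have hd : DifferentiableAt ℝ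
      (fun x => modelAd n ((extChartAt (𝓡 n) (1 : G)).symm x) (toModel A'))
      (extChartAt (𝓡 n) (1 : G) 1) :=
    (hI.clm_apply hl.differentiableAt).congr_of_eventuallyEq heq
  refine ⟨_, hd.hasFDerivAt, ?_⟩
  -- differentiate `dR_g (Ad g A') = dL_g A'`
  have h1 := hR.clm_apply hd.hasFDerivAt
  have h2 := h1.unique (hl.congr_of_eventuallyEq (by
    filter_upwards [(isOpen_extChartAt_target (1 : G)).mem_nhds (mem_extChartAt_target 1)]
      with x hx
    exact chartRightTranslation_modelAd hx _))
  have h3 := congrArg (fun L : EuclideanSpace ℝ (Fin n) →L[ℝ] EuclideanSpace ℝ (Fin n) =>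
    L (toModel A)) h2
  simp only [hR1, extChartAt_to_inv, modelAd_one] at h3
  simp only [add_apply, ContinuousLinearMap.comp_apply,
    ContinuousLinearMap.id_apply, ContinuousLinearMap.flip_apply, ContinuousLinearMap.compL_apply,
    ContinuousLinearMap.inl_apply, ContinuousLinearMap.inr_apply] at h3
  rw [toModel_lie, ← h3, chartMulHessian_symm n G (toModel A', 0), add_sub_cancel_right]

/-- The derivative of `Ad` along a curve through the identity with velocity `A` is `ad A`. -/
theorem hasDerivAt_modelAd_of_eq_one {c : ℝ → G} {A : GroupLieAlgebra (𝓡 n) G} {t : ℝ}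
    (hc : HasModelDerivAt 𝓘(ℝ, ℝ) (𝓡 n) c t (lineMap (toModel A))) (hc0 : c t = 1)
    (A' : GroupLieAlgebra (𝓡 n) G) :
    HasDerivAt (fun s => toModel (Ad (c s) A')) (toModel ⁅A, A'⁆) t := by
  have := isManifold_one_of_lieGroup n G
  obtain ⟨L, hL, hLA⟩ := hasFDerivAt_modelAd_chart_symm A A'
  have h1 : HasModelDerivAt (𝓡 n) (𝓡 n) (extChartAt (𝓡 n) (1 : G)) 1
      (ContinuousLinearMap.id ℝ _) := by
    have h2 := hasModelDerivAt_modelDeriv (I₁ := 𝓡 n)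
      (mdifferentiableAt_extChartAt (I := 𝓡 n) (mem_chart_source _ (1 : G)))
    have h3 : modelDeriv (𝓡 n) (𝓡 n) (extChartAt (𝓡 n) (1 : G)) 1 = ContinuousLinearMap.id ℝ _ :=
      mfderiv_extChartAt_self
    rwa [h3] at h2
  have h2 := (hasModelDerivAt_iff_hasFDerivAt.2 hL).comp_of_eq (h1.comp_of_eq hc hc0)
    (by rw [hc0])
  have h3 := (hasModelDerivAt_iff_hasFDerivAt.1 h2).hasDerivAt
  have h4 : (L ∘L ContinuousLinearMap.id ℝ _ ∘L lineMap (toModel A)) 1 = toModel ⁅A, A'⁆ := by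
    rw [← hLA]
    change L ((1 : ℝ) • toModel A) = _
    rw [one_smul]
  rw [h4] at h3
  refine h3.congr_of_eventuallyEq ?_
  have hcont : ContinuousAt c t := HasMFDerivAt.continuousAt hc
  filter_upwards [hcont.preimage_mem_nhds (by
    rw [hc0]
    exact extChartAt_source_mem_nhds (I := 𝓡 n) (1 : G))] with s hs
  rw [toModel_Ad, (extChartAt (𝓡 n) (1 : G)).left_inv hs]

end Adjoint

/-! ### Graded semisimple Lie algebras -/

section Graded

set_option linter.unusedSectionVars false

instance instFiniteGroupLieAlgebra {n : ℕ} {G : Type*} [TopologicalSpace G]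
    [ChartedSpace (EuclideanSpace ℝ (Fin n)) G] [Group G] [LieGroup (𝓡 n) ∞ G] :
    Module.Finite ℝ (GroupLieAlgebra (𝓡 n) G) :=
  inferInstanceAs (Module.Finite ℝ (EuclideanSpace ℝ (Fin n)))

variable {nG nP n0 : ℕ} {G P G₀ : Type*}
  [TopologicalSpace G] [ChartedSpace (EuclideanSpace ℝ (Fin nG)) G] [Group G]
  [LieGroup (𝓡 nG) ∞ G]
  [TopologicalSpace P] [ChartedSpace (EuclideanSpace ℝ (Fin nP)) P] [Group P]
  [LieGroup (𝓡 nP) ∞ P]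
  [TopologicalSpace G₀] [ChartedSpace (EuclideanSpace ℝ (Fin n0)) G₀] [Group G₀]
  [LieGroup (𝓡 n0) ∞ G₀]

namespace ParabolicType

variable (T : ParabolicType nG nP n0 G P G₀)

theorem comp_mem (i : ℤ) (A : GroupLieAlgebra (𝓡 nG) G) : T.comp i A ∈ T.gr i :=
  Subtype.property _

theorem comp_of_mem {i : ℤ} {A : GroupLieAlgebra (𝓡 nG) G} (hA : A ∈ T.gr i) : T.comp i A = A := by
  rw [comp, T.isInternal.ofBijective_coeLinearMap_of_mem hA]

theorem comp_of_mem_ne {i j : ℤ} (hij : i ≠ j) {A : GroupLieAlgebra (𝓡 nG) G} (hA : A ∈ T.gr i) :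
    T.comp j A = 0 := by
  rw [comp, T.isInternal.ofBijective_coeLinearMap_of_mem_ne hij hA]
  rfl

/-- The projection onto the grading component of degree `i`. -/
noncomputable def compLinear (i : ℤ) :
    GroupLieAlgebra (𝓡 nG) G →ₗ[ℝ] GroupLieAlgebra (𝓡 nG) G where
  toFun := T.comp i
  map_add' A A' := by simp [comp]
  map_smul' c A := by
    simp only [comp, map_smul]
    rfl

theorem comp_add (i : ℤ) (A A' : GroupLieAlgebra (𝓡 nG) G) :
    T.comp i (A + A') = T.comp i A + T.comp i A' :=
  (T.compLinear i).map_add A A'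

theorem comp_sub (i : ℤ) (A A' : GroupLieAlgebra (𝓡 nG) G) :
    T.comp i (A - A') = T.comp i A - T.comp i A' :=
  (T.compLinear i).map_sub A A'

theorem comp_smul (i : ℤ) (c : ℝ) (A : GroupLieAlgebra (𝓡 nG) G) :
    T.comp i (c • A) = c • T.comp i A :=
  (T.compLinear i).map_smul c A

theorem comp_eq_zero_of_lt {i : ℤ} (hi : (T.k : ℤ) < |i|) (A : GroupLieAlgebra (𝓡 nG) G) :
    T.comp i A = 0 := by
  have h := T.comp_mem i A
  rwa [T.gr_eq_bot i hi, Submodule.mem_bot] at h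

theorem linearMap_ext {W : Type*} [AddCommGroup W] [Module ℝ W]
    {f g : GroupLieAlgebra (𝓡 nG) G →ₗ[ℝ] W} (h : ∀ i, ∀ A ∈ T.gr i, f A = g A)
    (A : GroupLieAlgebra (𝓡 nG) G) : f A = g A := by
  have htop : A ∈ ⨆ i, T.gr i := by
    rw [T.isInternal.submodule_iSup_eq_top]
    trivial
  induction htop using Submodule.iSup_induction' with
  | mem i x hx => exact h i x hx
  | zero => simp
  | add x y _ _ hx hy => rw [map_add, map_add, hx, hy]

theorem sum_comp (A : GroupLieAlgebra (𝓡 nG) G) :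
    ∑ i ∈ Finset.Icc (-(T.k : ℤ)) T.k, T.comp i A = A := by
  have h : ∀ i, ∀ A ∈ T.gr i,
      (∑ l ∈ Finset.Icc (-(T.k : ℤ)) T.k, T.compLinear l) A = LinearMap.id (R := ℝ) A := by
    intro i A hA
    rw [LinearMap.sum_apply, LinearMap.id_apply]
    by_cases hi : i ∈ Finset.Icc (-(T.k : ℤ)) T.k
    · exact (Finset.sum_eq_single_of_mem i hi fun l _ hl => T.comp_of_mem_ne hl.symm hA).trans
        (T.comp_of_mem hA)
    · have hi' : (T.k : ℤ) < |i| := by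
        rw [Finset.mem_Icc, ← abs_le] at hi
        exact not_le.1 hi
      rw [T.gr_eq_bot i hi', Submodule.mem_bot] at hA
      simp [hA]
  have h1 := T.linearMap_ext h A
  rwa [LinearMap.sum_apply] at h1

theorem mem_filt_of_mem_gr {i j : ℤ} (hij : i ≤ j) {A : GroupLieAlgebra (𝓡 nG) G}
    (hA : A ∈ T.gr j) : A ∈ T.filt i :=
  Submodule.mem_iSup_of_mem j (Submodule.mem_iSup_of_mem hij hA)

theorem mem_filt_iff {i : ℤ} {A : GroupLieAlgebra (𝓡 nG) G} :
    A ∈ T.filt i ↔ ∀ l < i, T.comp l A = 0 := by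
  constructor
  · intro hA l hl
    have h : T.filt i ≤ LinearMap.ker (T.compLinear l) := by
      refine iSup_le fun j => iSup_le fun hj => fun x hx => ?_
      exact T.comp_of_mem_ne (by omega) hx
    exact h hA
  · intro h
    rw [← T.sum_comp A]
    refine Submodule.sum_mem _ fun l _ => ?_
    by_cases hl : l < i
    · rw [h l hl]
      exact Submodule.zero_mem _
    · exact T.mem_filt_of_mem_gr (not_lt.1 hl) (T.comp_mem l A)

theorem filt_anti {i j : ℤ} (hij : i ≤ j) : T.filt j ≤ T.filt i := fun A hA => by
  rw [mem_filt_iff] at hA ⊢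
  exact fun l hl => hA l (by omega)

theorem filt_eq_bot {i : ℤ} (hi : (T.k : ℤ) < i) : T.filt i = ⊥ := by
  refine (Submodule.eq_bot_iff _).2 fun A hA => ?_
  rw [mem_filt_iff] at hA
  rw [← T.sum_comp A]
  refine Finset.sum_eq_zero fun l hl => hA l ?_
  rw [Finset.mem_Icc] at hl
  omega

theorem filt_eq_top {i : ℤ} (hi : i ≤ -(T.k : ℤ)) : T.filt i = ⊤ := by
  refine eq_top_iff.2 fun A _ => T.mem_filt_iff.2 fun l hl => T.comp_eq_zero_of_lt ?_ A
  rw [lt_abs]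
  omega

theorem mem_filt_succ {i : ℤ} {A : GroupLieAlgebra (𝓡 nG) G} (hA : A ∈ T.filt i)
    (h : T.comp i A = 0) : A ∈ T.filt (i + 1) := by
  rw [mem_filt_iff] at hA ⊢
  intro l hl
  rcases (Int.lt_add_one_iff.1 hl).lt_or_eq with h1 | rfl
  · exact hA l h1
  · exact h

theorem mem_filt_one {A : GroupLieAlgebra (𝓡 nG) G} (hA : A ∈ T.filt 0) (h : T.comp 0 A = 0) :
    A ∈ T.filt 1 := by
  have h1 := T.mem_filt_succ hA h
  rwa [zero_add] at h1

theorem lie_mem_filt {i j : ℤ} {A A' : GroupLieAlgebra (𝓡 nG) G} (hA : A ∈ T.filt i)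
    (hA' : A' ∈ T.filt j) : ⁅A, A'⁆ ∈ T.filt (i + j) := by
  rw [mem_filt_iff] at hA hA'
  rw [← T.sum_comp A, ← T.sum_comp A', sum_lie]
  refine Submodule.sum_mem _ fun l _ => ?_
  rw [lie_sum]
  refine Submodule.sum_mem _ fun l' _ => ?_
  by_cases hl : l < i
  · rw [hA l hl, zero_lie]
    exact Submodule.zero_mem _
  by_cases hl' : l' < j
  · rw [hA' l' hl', lie_zero]
    exact Submodule.zero_mem _
  exact T.mem_filt_of_mem_gr (by omega)
    (T.lie_mem l l' _ (T.comp_mem l A) _ (T.comp_mem l' A'))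

theorem isKilling (T : ParabolicType nG nP n0 G P G₀) :
    LieAlgebra.IsKilling ℝ (GroupLieAlgebra (𝓡 nG) G) := by
  have := T.semisimple
  infer_instance

theorem killingForm_nondegenerate (T : ParabolicType nG nP n0 G P G₀) :
    (killingForm ℝ (GroupLieAlgebra (𝓡 nG) G)).Nondegenerate := by
  have := T.isKilling
  exact LieAlgebra.IsKilling.killingForm_nondegenerate ℝ _

theorem eq_of_killingForm_eq (T : ParabolicType nG nP n0 G P G₀)
    {Z Z' : GroupLieAlgebra (𝓡 nG) G}
    (h : ∀ A, killingForm ℝ (GroupLieAlgebra (𝓡 nG) G) Z A = killingForm ℝ _ Z' A) : Z = Z' := by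
  rw [← sub_eq_zero]
  refine T.killingForm_nondegenerate.1 _ fun A => ?_
  rw [map_sub, LinearMap.sub_apply, h, sub_self]

/-- Grading components are orthogonal for the Killing form unless their degrees add up to zero:
the composition of the adjoint actions shifts degrees. -/
theorem killingForm_eq_zero_of_mem_gr {i j : ℤ} (hij : i + j ≠ 0)
    {A A' : GroupLieAlgebra (𝓡 nG) G} (hA : A ∈ T.gr i) (hA' : A' ∈ T.gr j) :
    killingForm ℝ (GroupLieAlgebra (𝓡 nG) G) A A' = 0 := by
  rw [killingForm_apply_apply]
  refine LinearMap.trace_eq_zero_of_mapsTo_ne T.isInternal (fun l => i + (j + l))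
    (fun l => by omega) fun l Y hY => ?_
  exact T.lie_mem i (j + l) _ hA _ (T.lie_mem j l _ hA' _ hY)

theorem killingForm_comp (i : ℤ) {A : GroupLieAlgebra (𝓡 nG) G} (hA : A ∈ T.gr i)
    (Y : GroupLieAlgebra (𝓡 nG) G) :
    killingForm ℝ (GroupLieAlgebra (𝓡 nG) G) A (T.comp (-i) Y) = killingForm ℝ _ A Y := by
  refine T.linearMap_ext
    (f := killingForm ℝ (GroupLieAlgebra (𝓡 nG) G) A ∘ₗ T.compLinear (-i)) (fun l Y hY => ?_) Y
  change killingForm ℝ _ A (T.comp (-i) Y) = _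
  by_cases hl : l = -i
  · rw [T.comp_of_mem (hl ▸ hY)]
  · rw [T.comp_of_mem_ne hl hY, map_zero, T.killingForm_eq_zero_of_mem_gr (by omega) hA hY]

theorem killingForm_comm (A A' : GroupLieAlgebra (𝓡 nG) G) :
    killingForm ℝ (GroupLieAlgebra (𝓡 nG) G) A A' = killingForm ℝ _ A' A :=
  LieModule.traceForm_comm ℝ _ _ A A'

theorem killingForm_eq_zero_of_mem_filt {i j : ℤ} (hij : 0 < i + j)
    {A A' : GroupLieAlgebra (𝓡 nG) G} (hA : A ∈ T.filt i) (hA' : A' ∈ T.filt j) :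
    killingForm ℝ (GroupLieAlgebra (𝓡 nG) G) A A' = 0 := by
  rw [mem_filt_iff] at hA hA'
  rw [← T.sum_comp A, map_sum, LinearMap.sum_apply]
  refine Finset.sum_eq_zero fun l _ => ?_
  rw [← T.killingForm_comp l (T.comp_mem l A)]
  by_cases hl : l < i
  · rw [hA l hl, map_zero, LinearMap.zero_apply]
  · rw [hA' (-l) (by omega), map_zero]

theorem mem_filt_one_of_killingForm_eq_zero {Z : GroupLieAlgebra (𝓡 nG) G}
    (h : ∀ A ∈ T.filt 0, killingForm ℝ (GroupLieAlgebra (𝓡 nG) G) Z A = 0) : Z ∈ T.filt 1 := by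
  refine T.mem_filt_iff.2 fun l hl => T.eq_of_killingForm_eq fun A => ?_
  rw [map_zero, LinearMap.zero_apply, ← T.killingForm_comp l (T.comp_mem l Z), killingForm_comm]
  have h1 : killingForm ℝ _ (T.comp (-l) A) Z = 0 := by
    rw [killingForm_comm]
    exact h _ (T.mem_filt_of_mem_gr (by omega) (T.comp_mem _ A))
  rw [← h1, ← T.killingForm_comp (-l) (T.comp_mem _ A) Z, neg_neg]

theorem eq_zero_of_lie_eq_zero {Z : GroupLieAlgebra (𝓡 nG) G}
    (h : ∀ i, ∀ A ∈ T.gr i, ⁅Z, A⁆ = 0) : Z = 0 := by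
  refine T.eq_of_killingForm_eq fun A => ?_
  have h1 : LieAlgebra.ad ℝ (GroupLieAlgebra (𝓡 nG) G) Z = 0 := by
    ext A
    exact T.linearMap_ext (f := (LieAlgebra.ad ℝ (GroupLieAlgebra (𝓡 nG) G) Z :
      GroupLieAlgebra (𝓡 nG) G →ₗ[ℝ] GroupLieAlgebra (𝓡 nG) G)) (g := 0) h A
  rw [killingForm_apply_apply, h1]
  simp

/-- An element of `𝔤^0` which raises the filtration degree lies in `𝔤^1`: its component in `𝔤_0`
is central. -/
theorem mem_filt_one_of_lie_mem {D : GroupLieAlgebra (𝓡 nG) G} (hD : D ∈ T.filt 0)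
    (h : ∀ i, ∀ A ∈ T.gr i, ⁅D, A⁆ ∈ T.filt (i + 1)) : D ∈ T.filt 1 := by
  refine T.mem_filt_one hD (T.eq_zero_of_lie_eq_zero fun i A hA => ?_)
  have h1 : D - T.comp 0 D ∈ T.filt 1 := by
    refine T.mem_filt_one (Submodule.sub_mem _ hD
      (T.mem_filt_of_mem_gr le_rfl (T.comp_mem 0 D))) ?_
    rw [comp_sub, T.comp_of_mem (T.comp_mem 0 D), sub_self]
  have h2 : ⁅T.comp 0 D, A⁆ ∈ T.filt (i + 1) := by
    have h3 := T.lie_mem_filt h1 (T.mem_filt_of_mem_gr le_rfl hA)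
    have h4 := Submodule.sub_mem _ (h i A hA) (by rwa [add_comm 1 i] at h3)
    rwa [sub_lie, sub_sub_cancel] at h4
  have h5 := T.lie_mem 0 i _ (T.comp_mem 0 D) _ hA
  rw [zero_add] at h5
  rw [← T.comp_of_mem h5]
  exact T.mem_filt_iff.1 h2 i (by omega)

end ParabolicType

theorem killingForm_Ad (g : G) (A A' : GroupLieAlgebra (𝓡 nG) G) :
    killingForm ℝ (GroupLieAlgebra (𝓡 nG) G) (Ad g A) (Ad g A') = killingForm ℝ _ A A' :=
  LieAlgebra.killingForm_of_equiv_apply (AdEquiv g) A A'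

namespace ParabolicType

variable {T : ParabolicType nG nP n0 G P G₀}

theorem Ad_mem_gr (g : G₀) {i : ℤ} {A : GroupLieAlgebra (𝓡 nG) G} (hA : A ∈ T.gr i) :
    Ad (T.ι (T.j g)) A ∈ T.gr i := by
  have h : T.j g ∈ {p : P | ∀ i : ℤ, ∀ A ∈ T.gr i, Ad (T.ι p) A ∈ T.gr i} := by
    rw [← T.range_j]
    exact ⟨g, rfl⟩
  exact h i A hA

end ParabolicType

namespace ScaleRep

variable {T : ParabolicType nG nP n0 G P G₀} (R : ScaleRep T)

/-- The adjoint action of `G₀` fixes `E_λ`, which is determined by its eigenvalues on the grading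
components. -/
theorem Ad_E (g : G₀) : Ad (T.ι (T.j g)) R.E = R.E := by
  rw [← sub_eq_zero]
  refine T.eq_zero_of_lie_eq_zero fun i A hA => ?_
  obtain ⟨c, -, hc⟩ := R.E_scalar i
  have h1 : Ad (T.ι (T.j g⁻¹)) A ∈ T.gr i := ParabolicType.Ad_mem_gr _ hA
  have h2 : Ad (T.ι (T.j g)) (Ad (T.ι (T.j g⁻¹)) A) = A := by
    rw [map_inv, map_inv, Ad_Ad_inv]
  rw [sub_lie, hc A hA]
  nth_rw 1 [← h2]
  rw [← Ad_lie, hc _ h1, map_smul, h2, sub_self]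

theorem E_mem_filt : R.E ∈ T.filt 0 := T.mem_filt_of_mem_gr le_rfl R.E_mem

end ScaleRep

/-! ### The adjoint action of the unipotent radical -/

theorem sub_mem_of_hasDerivAt {F : Type*} [NormedAddCommGroup F] [NormedSpace ℝ F]
    [FiniteDimensional ℝ F] (W : Submodule ℝ F) {u u' : ℝ → F}
    (h : ∀ t, HasDerivAt u (u' t) t) (hW : ∀ t, u' t ∈ W) (t s : ℝ) : u t - u s ∈ W := by
  by_contra hn
  obtain ⟨f, hf, hfW⟩ := Submodule.exists_le_ker_of_notMem hn
  apply hf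
  have h1 : ∀ t, HasDerivAt (fun t => LinearMap.toContinuousLinearMap f (u t)) 0 t := fun t => by
    have h2 := (LinearMap.toContinuousLinearMap f).hasFDerivAt.comp_hasDerivAt t (h t)
    have h3 : LinearMap.toContinuousLinearMap f (u' t) = 0 := hfW (hW t)
    rwa [h3] at h2
  have h2 := is_const_of_deriv_eq_zero (fun t => (h1 t).differentiableAt)
    (fun t => (h1 t).deriv) t s
  rw [map_sub, sub_eq_zero]
  exact h2

theorem deriv_mem_of_sub_mem {F : Type*} [NormedAddCommGroup F] [NormedSpace ℝ F]
    [FiniteDimensional ℝ F] (W : Submodule ℝ F) {u : ℝ → F} {w u₀ : F} {t : ℝ}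
    (h : HasDerivAt u w t) (hW : ∀ s, u s - u₀ ∈ W) : w ∈ W := by
  by_contra hn
  obtain ⟨f, hf, hfW⟩ := Submodule.exists_le_ker_of_notMem hn
  apply hf
  have h2 := (LinearMap.toContinuousLinearMap f).hasFDerivAt.comp_hasDerivAt t (h.sub_const u₀)
  have h3 : (LinearMap.toContinuousLinearMap f ∘ fun s => u s - u₀) = fun _ => 0 := by
    funext s
    exact hfW (hW s)
  rw [h3] at h2
  exact h2.unique (hasDerivAt_const t _)

theorem IsOneParameterSubgroup.map_zero {Z : GroupLieAlgebra (𝓡 nG) G} {γ : ℝ → G}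
    (h : IsOneParameterSubgroup Z γ) : γ 0 = 1 := by
  have h1 := h.2.1 0 0
  rw [add_zero] at h1
  exact left_eq_mul.1 h1

theorem IsOneParameterSubgroup.map_neg {Z : GroupLieAlgebra (𝓡 nG) G} {γ : ℝ → G}
    (h : IsOneParameterSubgroup Z γ) (t : ℝ) : γ (-t) = (γ t)⁻¹ := by
  refine eq_inv_of_mul_eq_one_left ?_
  rw [← h.2.1, neg_add_cancel, h.map_zero]

theorem IsOneParameterSubgroup.hasDerivAt_Ad {Z : GroupLieAlgebra (𝓡 nG) G} {γ : ℝ → G}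
    (h : IsOneParameterSubgroup Z γ) (A : GroupLieAlgebra (𝓡 nG) G) (t : ℝ) :
    HasDerivAt (fun s => toModel (Ad (γ s) A)) (toModel (Ad (γ t) ⁅Z, A⁆)) t := by
  have h1 : HasModelDerivAt 𝓘(ℝ, ℝ) (𝓡 nG) γ 0 (lineMap (toModel Z)) := by
    have h2 := hasModelDerivAt_modelDeriv (I₁ := 𝓘(ℝ, ℝ)) (I₂ := 𝓡 nG)
      (h.1.mdifferentiable (by simp) 0)
    have h3 : modelDeriv 𝓘(ℝ, ℝ) (𝓡 nG) γ 0 = lineMap (toModel Z) := by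
      ext1
      exact h.2.2.trans (one_smul ℝ (toModel Z)).symm
    rwa [h3] at h2
  have h2 := hasDerivAt_modelAd_of_eq_one h1 h.map_zero A
  have h3 : HasDerivAt (fun s => toModel (Ad (γ (s - t)) A)) (toModel ⁅Z, A⁆) t := by
    have h4 : HasDerivAt (fun s => toModel (Ad (γ s) A)) (toModel ⁅Z, A⁆) (t - t) := by
      rwa [sub_self]
    exact h4.comp_sub_const t t
  have h5 := (modelAd nG (γ t)).hasFDerivAt.comp_hasDerivAt t h3
  refine h5.congr_of_eventuallyEq (Filter.Eventually.of_forall fun s => ?_)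
  change _ = toModel (Ad (γ t) (Ad (γ (s - t)) A))
  rw [← Ad_mul, ← h.2.1, add_sub_cancel]

variable (T : ParabolicType nG nP n0 G P G₀)

namespace ParabolicType

/-- Elements of `exp (𝔤^l)`, for `l > 0`, act unipotently with respect to the filtration. -/
theorem Ad_sub_mem_filt {l : ℤ} (hl : 0 < l) {Z : GroupLieAlgebra (𝓡 nG) G} (hZ : Z ∈ T.filt l)
    {γ : ℝ → G} (h : IsOneParameterSubgroup Z γ) {a : ℤ} {A : GroupLieAlgebra (𝓡 nG) G}
    (hA : A ∈ T.filt a) (t : ℝ) : Ad (γ t) A - A ∈ T.filt (a + l) := by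
  obtain ⟨r, hr⟩ : ∃ r : ℕ, (T.k : ℤ) < a + r := ⟨(T.k + 1 - a).toNat, by omega⟩
  induction r generalizing a A t with
  | zero =>
    rw [T.filt_eq_bot (by simpa using hr), Submodule.mem_bot] at hA
    rw [hA, _root_.map_zero, sub_zero]
    exact Submodule.zero_mem _
  | succ r ih =>
    have h1 : ∀ t, Ad (γ t) ⁅Z, A⁆ ∈ T.filt (a + l) := fun t => by
      have h2 : ⁅Z, A⁆ ∈ T.filt (a + l) := by
        rw [add_comm]
        exact T.lie_mem_filt hZ hA
      have h3 := ih h2 t (by push_cast at hr; omega)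
      have h4 := Submodule.add_mem _ (T.filt_anti (by omega : a + l ≤ a + l + l) h3) h2
      rwa [sub_add_cancel] at h4
    have h2 := sub_mem_of_hasDerivAt (F := EuclideanSpace ℝ (Fin nG)) (T.filt (a + l))
      (h.hasDerivAt_Ad A) h1 t 0
    have h3 : Ad (γ 0) A = A := by rw [h.map_zero, Ad_one]
    rwa [h3] at h2

/-- The expansion of `Ad (exp (t Z))` to second order, with the remainder of filtration degree
`2 l + a`. -/
theorem Ad_sub_sub_mem_filt {l : ℤ} (hl : 0 < l) {Z : GroupLieAlgebra (𝓡 nG) G}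
    (hZ : Z ∈ T.filt l) {γ : ℝ → G} (h : IsOneParameterSubgroup Z γ) {a : ℤ}
    {A : GroupLieAlgebra (𝓡 nG) G} (hA : A ∈ T.filt a) (t : ℝ) :
    Ad (γ t) A - A - t • ⁅Z, A⁆ ∈ T.filt (l + a + l) := by
  have h1 := sub_mem_of_hasDerivAt (F := EuclideanSpace ℝ (Fin nG)) (T.filt (l + a + l))
    (u := fun s => toModel (Ad (γ s) A) - s • toModel ⁅Z, A⁆)
    (u' := fun s => toModel (Ad (γ s) ⁅Z, A⁆) - toModel ⁅Z, A⁆)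
    (fun s => by
      have h2 := (h.hasDerivAt_Ad A s).sub ((hasDerivAt_id s).smul_const (toModel ⁅Z, A⁆))
      rwa [one_smul] at h2)
    (fun s => T.Ad_sub_mem_filt hl hZ h (T.lie_mem_filt hZ hA) s) t 0
  have h3 : Ad (γ 0) A = A := by rw [h.map_zero, Ad_one]
  have h4 : toModel (Ad (γ t) A) - t • toModel ⁅Z, A⁆ -
      (toModel (Ad (γ 0) A) - (0 : ℝ) • toModel ⁅Z, A⁆) =
      toModel (Ad (γ t) A - A - t • ⁅Z, A⁆) := by
    rw [h3, zero_smul, sub_zero, sub_right_comm]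
    rfl
  rw [h4] at h1
  exact h1

end ParabolicType

end Graded

/-! ### Calculus on principal bundles with a Cartan connection -/

section Calculus

set_option linter.unusedSectionVars false

theorem HasModelDerivAt.prodMk {E₁ E₂ E₃ H₁ H₂ H₃ M₁ M₂ M₃ : Type*}
    [NormedAddCommGroup E₁] [NormedSpace ℝ E₁] [TopologicalSpace H₁] [TopologicalSpace M₁]
    [ChartedSpace H₁ M₁] [NormedAddCommGroup E₂] [NormedSpace ℝ E₂] [TopologicalSpace H₂]
    [TopologicalSpace M₂] [ChartedSpace H₂ M₂] [NormedAddCommGroup E₃] [NormedSpace ℝ E₃]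
    [TopologicalSpace H₃] [TopologicalSpace M₃] [ChartedSpace H₃ M₃]
    {I₁ : ModelWithCorners ℝ E₁ H₁} {I₂ : ModelWithCorners ℝ E₂ H₂} {I₃ : ModelWithCorners ℝ E₃ H₃}
    {f : M₁ → M₂} {g : M₁ → M₃} {x : M₁} {f' : E₁ →L[ℝ] E₂} {g' : E₁ →L[ℝ] E₃}
    (hf : HasModelDerivAt I₁ I₂ f x f') (hg : HasModelDerivAt I₁ I₃ g x g') :
    HasModelDerivAt I₁ (I₂.prod I₃) (fun z => (f z, g z)) x (f'.prod g') :=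
  HasMFDerivAt.prodMk hf hg

namespace PrincipalBundle

variable {nH nE m r : ℕ} {H E M N : Type*}
  [TopologicalSpace H] [ChartedSpace (EuclideanSpace ℝ (Fin nH)) H] [Group H]
  [LieGroup (𝓡 nH) ∞ H]
  [TopologicalSpace E] [ChartedSpace (EuclideanSpace ℝ (Fin nE)) E] [IsManifold (𝓡 nE) ∞ E]
  [TopologicalSpace M] [ChartedSpace (EuclideanSpace ℝ (Fin m)) M] [IsManifold (𝓡 m) ∞ M]
  [TopologicalSpace N] [ChartedSpace (EuclideanSpace ℝ (Fin r)) N]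
  (π : PrincipalBundle nH nE m H E M)

theorem contMDiff_act_left (h : H) : ContMDiff (𝓡 nE) (𝓡 nE) ∞ (fun u => π.act u h) :=
  π.contMDiff_act.comp (contMDiff_id.prodMk contMDiff_const)

/-- The product rule for the right action, in terms of the left logarithmic derivative `δ` of the
`H`-valued map. -/
theorem hasModelDerivAt_act {s : N → E} {p : N → H} {y : N}
    {s' : EuclideanSpace ℝ (Fin r) →L[ℝ] EuclideanSpace ℝ (Fin nE)}
    {δ : EuclideanSpace ℝ (Fin r) →L[ℝ] EuclideanSpace ℝ (Fin nH)}
    (hs : HasModelDerivAt (𝓡 r) (𝓡 nE) s y s')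
    (hp : HasModelDerivAt (𝓡 r) (𝓡 nH) (fun z => (p y)⁻¹ * p z) y δ) :
    HasModelDerivAt (𝓡 r) (𝓡 nE) (fun z => π.act (s z) (p z)) y
      (modelDeriv (𝓡 nE) (𝓡 nE) (fun u => π.act u (p y)) (s y) ∘L s' +
        modelDeriv (𝓡 nH) (𝓡 nE) (fun h => π.act (π.act (s y) (p y)) h) 1 ∘L δ) := by
  have hF := hasModelDerivAt_modelDeriv (π.contMDiff_act.mdifferentiable (by simp)
    (π.act (s y) (p y), (1 : H)))
  have hA := (hasModelDerivAt_modelDeriv ((π.contMDiff_act_left (p y)).mdifferentiable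
    (by simp) (s y))).comp_of_eq hs rfl
  have h1 := hF.comp_of_eq (hA.prodMk hp) (by simp)
  have hl := hF.comp_of_eq ((hasModelDerivAt_id (I₁ := 𝓡 nE) (π.act (s y) (p y))).prodMk
    (hasModelDerivAt_const (I₂ := 𝓡 nH) (1 : H) _)) rfl
  have hr := hF.comp_of_eq ((hasModelDerivAt_const (I₁ := 𝓡 nH) (I₂ := 𝓡 nE)
    (π.act (s y) (p y)) (1 : H)).prodMk (hasModelDerivAt_id (1 : H))) rfl
  have hl' := hl.unique (hasModelDerivAt_id (I₁ := 𝓡 nE) (π.act (s y) (p y)))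
    (Filter.Eventually.of_forall fun u => π.act_one u)
  have hr' := hr.modelDeriv_eq
  have h2 : ∀ z, π.act (s z) (p z) = π.act (π.act (s z) (p y)) ((p y)⁻¹ * p z) := fun z => by
    rw [π.act_mul, mul_inv_cancel_left]
  have h3 := h1.congr_of_eventuallyEq (Filter.Eventually.of_forall h2)
  convert h3 using 1
  ext1 v
  have h4 := congrArg (fun L : EuclideanSpace ℝ (Fin nE) →L[ℝ] EuclideanSpace ℝ (Fin nE) =>
    L (modelDeriv (𝓡 nE) (𝓡 nE) (fun u => π.act u (p y)) (s y) (s' v))) hl'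
  have h5 := congrArg (fun L : EuclideanSpace ℝ (Fin nH) →L[ℝ] EuclideanSpace ℝ (Fin nE) =>
    L (δ v)) hr'
  refine (congrArg₂ (· + ·) h4.symm h5).trans ?_
  have h6 : ∀ (L : EuclideanSpace ℝ (Fin nE) × EuclideanSpace ℝ (Fin nH) →L[ℝ]
      EuclideanSpace ℝ (Fin nE)) a c, L (a, 0) + L (0, c) = L (a, c) := fun L a c => by
    rw [← map_add, Prod.mk_add_mk, add_zero, zero_add]
  exact h6 _ _ _

end PrincipalBundle

section CartanConnection

variable {nG nP n0 m b r : ℕ} {G P G₀ M B N : Type*}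
  [TopologicalSpace G] [ChartedSpace (EuclideanSpace ℝ (Fin nG)) G] [Group G]
  [LieGroup (𝓡 nG) ∞ G]
  [TopologicalSpace P] [ChartedSpace (EuclideanSpace ℝ (Fin nP)) P] [Group P]
  [LieGroup (𝓡 nP) ∞ P]
  [TopologicalSpace G₀] [ChartedSpace (EuclideanSpace ℝ (Fin n0)) G₀] [Group G₀]
  [LieGroup (𝓡 n0) ∞ G₀]
  [TopologicalSpace M] [ChartedSpace (EuclideanSpace ℝ (Fin m)) M] [IsManifold (𝓡 m) ∞ M]
  [TopologicalSpace B] [ChartedSpace (EuclideanSpace ℝ (Fin b)) B] [IsManifold (𝓡 b) ∞ B]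
  [TopologicalSpace N] [ChartedSpace (EuclideanSpace ℝ (Fin r)) N]
  {T : ParabolicType nG nP n0 G P G₀}

namespace Geometry

variable (C : Geometry T m b M B)

/-- The value of the Cartan connection at `u`, on the model space of the total space. -/
def formAt (u : B) : EuclideanSpace ℝ (Fin b) →ₗ[ℝ] GroupLieAlgebra (𝓡 nG) G :=
  C.form u

theorem formAt_act (u : B) (p : P) (ξ : EuclideanSpace ℝ (Fin b)) :
    C.formAt (C.π.act u p) (modelDeriv (𝓡 b) (𝓡 b) (fun v => C.π.act v p) u ξ) =
      Ad (T.ι p)⁻¹ (C.formAt u ξ) :=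
  C.form_equivariant u p ξ

theorem formAt_fundamental (u : B) (A : EuclideanSpace ℝ (Fin nP)) :
    C.formAt u (modelDeriv (𝓡 nP) (𝓡 b) (fun p : P => C.π.act u p) 1 A) =
      lieMap nG nP T.ι A := by
  have h : C.formAt (C.π.act u 1) (modelDeriv (𝓡 nP) (𝓡 b) (fun p : P => C.π.act u p) 1 A) =
      lieMap nG nP T.ι A := C.form_fundamental u A
  rwa [C.π.act_one] at h

theorem formAt_hasModelDerivAt_act {s : N → B} {p : N → P} {y : N}
    {s' : EuclideanSpace ℝ (Fin r) →L[ℝ] EuclideanSpace ℝ (Fin b)}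
    {δ : EuclideanSpace ℝ (Fin r) →L[ℝ] EuclideanSpace ℝ (Fin nP)}
    (hs : HasModelDerivAt (𝓡 r) (𝓡 b) s y s')
    (hp : HasModelDerivAt (𝓡 r) (𝓡 nP) (fun z => (p y)⁻¹ * p z) y δ)
    (v : EuclideanSpace ℝ (Fin r)) :
    C.formAt (C.π.act (s y) (p y))
        (modelDeriv (𝓡 r) (𝓡 b) (fun z => C.π.act (s z) (p z)) y v) =
      Ad (T.ι (p y))⁻¹ (C.formAt (s y) (s' v)) + lieMap nG nP T.ι (δ v) := by
  rw [(C.π.hasModelDerivAt_act hs hp).modelDeriv_eq]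
  refine (map_add (C.formAt (C.π.act (s y) (p y))) _ _).trans ?_
  exact congrArg₂ (· + ·) (C.formAt_act _ _ _) (C.formAt_fundamental _ _)

/-- The Cartan connection, evaluated on the coordinate fields of a local parametrization `s` of a
section, is smooth. -/
theorem contDiffOn_formAt {s : EuclideanSpace ℝ (Fin m) → B} {Ω : Set (EuclideanSpace ℝ (Fin m))}
    (hΩ : IsOpen Ω) (hs : ContMDiffOn (𝓡 m) (𝓡 b) ∞ s Ω) (v : EuclideanSpace ℝ (Fin m)) :
    ContDiffOn ℝ ∞ (fun y => toModel (C.formAt (s y) (modelDeriv (𝓡 m) (𝓡 b) s y v))) Ω := by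
  have hB : IsManifold (𝓡 b) 1 B := IsManifold.of_le (n := ∞) ENat.LEInfty.out
  have h1 := hs.contMDiffOn_tangentMapWithin (m := ∞) (by simp) hΩ.uniqueMDiffOn
  have h2 : ContMDiffOn (𝓡 m) (𝓡 m).tangent ∞
      (fun y => (⟨y, v⟩ : TangentBundle (𝓡 m) (EuclideanSpace ℝ (Fin m)))) Ω :=
    contMDiffOn_vectorSpace_iff_contDiffOn.2 contDiffOn_const
  have h3 := C.form_smooth.comp_contMDiffOn (h1.comp h2 fun y hy => hy)
  refine contMDiffOn_iff_contDiffOn.1 (h3.congr fun y hy => ?_)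
  have h4 : mfderivWithin (𝓡 m) (𝓡 b) s Ω y = mfderiv (𝓡 m) (𝓡 b) s y :=
    mfderivWithin_of_isOpen hΩ hy
  exact congrArg (fun L : EuclideanSpace ℝ (Fin m) →L[ℝ] EuclideanSpace ℝ (Fin b) =>
    toModel (C.formAt (s y) (L v))) h4.symm

end Geometry

/-! ### Logarithmic derivatives of maps into the unipotent radical -/

namespace ParabolicType

theorem Ad_sub_mem_of_mem_Pplus {p : P} (hp : p ∈ T.Pplus) {a : ℤ}
    {A : GroupLieAlgebra (𝓡 nG) G} (hA : A ∈ T.filt a) : Ad (T.ι p) A - A ∈ T.filt (a + 1) := by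
  obtain ⟨Z, hZ, γ, hγ, hγ1⟩ := hp
  rw [← hγ1]
  exact T.Ad_sub_mem_filt one_pos hZ hγ hA 1

theorem Ad_inv_sub_mem_of_mem_Pplus {p : P} (hp : p ∈ T.Pplus) {a : ℤ}
    {A : GroupLieAlgebra (𝓡 nG) G} (hA : A ∈ T.filt a) : Ad (T.ι p)⁻¹ A - A ∈ T.filt (a + 1) := by
  obtain ⟨Z, hZ, γ, hγ, hγ1⟩ := hp
  rw [← hγ1, ← hγ.map_neg]
  exact T.Ad_sub_mem_filt one_pos hZ hγ hA (-1)

theorem Ad_inv_mem_of_mem_Pplus {p : P} (hp : p ∈ T.Pplus) {a : ℤ}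
    {A : GroupLieAlgebra (𝓡 nG) G} (hA : A ∈ T.filt a) : Ad (T.ι p)⁻¹ A ∈ T.filt a := by
  have h := Submodule.add_mem _
    (T.filt_anti (by omega : a ≤ a + 1) (T.Ad_inv_sub_mem_of_mem_Pplus hp hA)) hA
  rwa [sub_add_cancel] at h

theorem lieMap_ι_mem (A : GroupLieAlgebra (𝓡 nP) P) : lieMap nG nP T.ι A ∈ T.filt 0 := by
  have h : lieMap nG nP T.ι A ∈ LinearMap.range (lieMap nG nP T.ι).toLinearMap := ⟨A, rfl⟩
  rwa [T.lie_P] at h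

theorem exists_lieMap_ι_eq {Z : GroupLieAlgebra (𝓡 nG) G} (hZ : Z ∈ T.filt 0) :
    ∃ A, lieMap nG nP T.ι A = Z := by
  have h : Z ∈ LinearMap.range (lieMap nG nP T.ι).toLinearMap := by
    rwa [T.lie_P]
  exact h

theorem hasModelDerivAt_ι_one :
    HasModelDerivAt (𝓡 nP) (𝓡 nG) T.ι 1 (lieMap nG nP T.ι) :=
  hasModelDerivAt_modelDeriv (T.closed_P.contMDiff.mdifferentiable (by simp) 1)

/-- The left logarithmic derivative of a map into `P₊` has values in `𝔤^1`. -/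
theorem lieMap_mem_filt_one {p : EuclideanSpace ℝ (Fin m) → P} (hp : ∀ z, p z ∈ T.Pplus)
    {y : EuclideanSpace ℝ (Fin m)}
    {δ : EuclideanSpace ℝ (Fin m) →L[ℝ] EuclideanSpace ℝ (Fin nP)}
    (hδ : HasModelDerivAt (𝓡 m) (𝓡 nP) (fun z => (p y)⁻¹ * p z) y δ)
    (v : EuclideanSpace ℝ (Fin m)) : lieMap nG nP T.ι (δ v) ∈ T.filt 1 := by
  refine T.mem_filt_one_of_lie_mem (T.lieMap_ι_mem _) fun i A hA => ?_
  have hA := T.mem_filt_of_mem_gr le_rfl hA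
  have hline : HasModelDerivAt 𝓘(ℝ, ℝ) (𝓡 m) (fun t : ℝ => y + t • v) 0 (lineMap v) := by
    refine hasModelDerivAt_iff_hasFDerivAt.2 ?_
    exact ((hasFDerivAt_id (𝕜 := ℝ) (0 : ℝ)).smul_const v).const_add y
  have h1 := T.hasModelDerivAt_ι_one.comp_of_eq (hδ.comp_of_eq hline (by simp)) (by simp)
  have h2 : (lieMap nG nP T.ι) ∘L (δ ∘L lineMap v) =
      lineMap (toModel (lieMap nG nP T.ι (δ v))) := by
    ext1
    change toModel (lieMap nG nP T.ι (δ ((1 : ℝ) • v))) =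
      (1 : ℝ) • toModel (lieMap nG nP T.ι (δ v))
    rw [one_smul, one_smul]
  have h3 : HasModelDerivAt 𝓘(ℝ, ℝ) (𝓡 nG) (fun t : ℝ => T.ι ((p y)⁻¹ * p (y + t • v))) 0
      (lineMap (toModel (lieMap nG nP T.ι (δ v)))) := h2 ▸ h1
  have h4 := hasDerivAt_modelAd_of_eq_one h3 (by simp) A
  refine deriv_mem_of_sub_mem (F := EuclideanSpace ℝ (Fin nG)) (T.filt (i + 1))
    (u₀ := toModel A) h4 fun t => ?_
  have h5 := T.Ad_sub_mem_of_mem_Pplus (hp (y + t • v)) hA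
  have h6 : Ad (T.ι (p (y + t • v))) A ∈ T.filt i := by
    have h := Submodule.add_mem _ (T.filt_anti (by omega : i ≤ i + 1) h5) hA
    rwa [sub_add_cancel] at h
  have h7 := Submodule.add_mem _ (T.Ad_inv_sub_mem_of_mem_Pplus (hp y) h6) h5
  rw [sub_add_sub_cancel, ← Ad_mul, ← map_inv, ← map_mul] at h7
  exact h7

end ParabolicType

end CartanConnection

end Calculus

/-! ### Normalization of local sections of a parabolic geometry -/

section Normalization

set_option linter.unusedSectionVars false

/-- If `(v, a) ↦ α(y) v + L a` is an isomorphism for every `y`, the functional which is `β(y)` on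
`V` and zero on `A` is represented, via a nondegenerate bilinear form, by a unique vector, which
depends smoothly on `y`. -/
theorem exists_contDiffOn_represent {X V A F : Type*} [NormedAddCommGroup X] [NormedSpace ℝ X]
    [NormedAddCommGroup V] [NormedSpace ℝ V] [FiniteDimensional ℝ V]
    [NormedAddCommGroup A] [NormedSpace ℝ A] [FiniteDimensional ℝ A]
    [NormedAddCommGroup F] [NormedSpace ℝ F] [FiniteDimensional ℝ F]
    {Bf : LinearMap.BilinForm ℝ F} (hB : Bf.Nondegenerate) {Ω : Set X}
    {α : X → V →L[ℝ] F} (hα : ContDiffOn ℝ ∞ α Ω) (L : A →L[ℝ] F)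
    (hinj : ∀ y ∈ Ω, ∀ v a, α y v + L a = 0 → v = 0 ∧ a = 0)
    (hdim : Module.finrank ℝ V + Module.finrank ℝ A = Module.finrank ℝ F)
    {β : X → V →L[ℝ] ℝ} (hβ : ContDiffOn ℝ ∞ β Ω) :
    ∃ Z : X → F, ContDiffOn ℝ ∞ Z Ω ∧ (∀ y ∈ Ω, ∀ v a, Bf (Z y) (α y v + L a) = β y v) ∧
      ∀ y ∈ Ω, ∀ z, (∀ v a, Bf z (α y v + L a) = β y v) → z = Z y := by
  let K : X → V × A →L[ℝ] F := fun y =>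
    α y ∘L ContinuousLinearMap.fst ℝ V A + L ∘L ContinuousLinearMap.snd ℝ V A
  have hK : ContDiffOn ℝ ∞ K Ω :=
    (hα.clm_comp contDiffOn_const).add contDiffOn_const
  have hKinv : ∀ y ∈ Ω, (K y).IsInvertible := by
    intro y hy
    have h1 : Function.Injective (K y) := by
      rw [injective_iff_map_eq_zero]
      rintro ⟨v, a⟩ h
      obtain ⟨rfl, rfl⟩ := hinj y hy v a h
      rfl
    have h2 : Module.finrank ℝ (V × A) = Module.finrank ℝ F := by
      rw [Module.finrank_prod, hdim]
    refine ⟨(LinearEquiv.ofInjectiveOfFinrankEq (K y).toLinearMap h1 h2).toContinuousLinearEquiv,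
      ContinuousLinearMap.ext fun w => rfl⟩
  let D : (F →L[ℝ] ℝ) →L[ℝ] F := LinearMap.toContinuousLinearMap
    ((LinearMap.BilinForm.toDual Bf hB).symm.toLinearMap ∘ₗ ContinuousLinearMap.coeLM ℝ)
  have hD : ∀ ψ w, Bf (D ψ) w = ψ w := fun ψ w =>
    LinearMap.BilinForm.apply_toDual_symm_apply (hB := hB) _ w
  have hsol : ∀ y ∈ Ω, ∀ v a,
      Bf (D ((β y ∘L ContinuousLinearMap.fst ℝ V A) ∘L (K y).inverse)) (α y v + L a) = β y v := by
    intro y hy v a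
    rw [hD]
    change β y ((K y).inverse (K y (v, a))).1 = β y v
    have h1 : (K y).inverse (K y (v, a)) = (v, a) := by
      rw [(hKinv y hy).inverse_apply_eq]
    rw [h1]
  refine ⟨fun y => D ((β y ∘L ContinuousLinearMap.fst ℝ V A) ∘L (K y).inverse), ?_, hsol, ?_⟩
  · refine D.contDiff.comp_contDiffOn ((hβ.clm_comp contDiffOn_const).clm_comp fun y hy => ?_)
    exact (hKinv y hy).contDiffAt_map_inverse.comp_contDiffWithinAt y (hK y hy)
  · intro y hy z hz
    rw [← sub_eq_zero]
    refine hB.1 _ fun w => ?_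
    obtain ⟨e, he⟩ := hKinv y hy
    obtain ⟨⟨v, a⟩, rfl⟩ := e.surjective w
    have h1 : e (v, a) = α y v + L a := congrArg (fun T : V × A →L[ℝ] F => T (v, a)) he
    rw [map_sub, LinearMap.sub_apply, h1, hz, hsol y hy, sub_self]

variable {nG nP n0 m b b0 : ℕ} {G P G₀ M B B₀ : Type*}
  [TopologicalSpace G] [ChartedSpace (EuclideanSpace ℝ (Fin nG)) G] [Group G]
  [LieGroup (𝓡 nG) ∞ G]
  [TopologicalSpace P] [ChartedSpace (EuclideanSpace ℝ (Fin nP)) P] [Group P]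
  [LieGroup (𝓡 nP) ∞ P]
  [TopologicalSpace G₀] [ChartedSpace (EuclideanSpace ℝ (Fin n0)) G₀] [Group G₀]
  [LieGroup (𝓡 n0) ∞ G₀]
  [TopologicalSpace M] [ChartedSpace (EuclideanSpace ℝ (Fin m)) M] [IsManifold (𝓡 m) ∞ M]
  [TopologicalSpace B] [ChartedSpace (EuclideanSpace ℝ (Fin b)) B] [IsManifold (𝓡 b) ∞ B]
  [TopologicalSpace B₀] [ChartedSpace (EuclideanSpace ℝ (Fin b0)) B₀] [IsManifold (𝓡 b0) ∞ B₀]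
  {T : ParabolicType nG nP n0 G P G₀}

theorem IsOneParameterSubgroup.map_ι {A : GroupLieAlgebra (𝓡 nP) P} {γ : ℝ → P}
    (h : IsOneParameterSubgroup A γ) :
    IsOneParameterSubgroup (lieMap nG nP T.ι A) (fun t => T.ι (γ t)) := by
  refine ⟨T.closed_P.contMDiff.comp h.1, fun s t => by simp only [h.2.1, map_mul], ?_⟩
  have h1 := T.hasModelDerivAt_ι_one.comp_of_eq
    (hasModelDerivAt_modelDeriv (h.1.mdifferentiable (by simp) 0)) h.map_zero
  refine (congrArg (fun L : ℝ →L[ℝ] EuclideanSpace ℝ (Fin nG) => L 1) h1.modelDeriv_eq).trans ?_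
  exact congrArg (lieMap nG nP T.ι) h.2.2

variable (T) in
/-- The exponential map of `P`, as a smooth map on `𝔤`: it is precomposed with a linear retraction
onto `𝔭`, so that its values at elements outside `𝔭` are irrelevant. -/
theorem ParabolicType.exists_smooth_exp_parabolic :
    ∃ p : GroupLieAlgebra (𝓡 nG) G → P,
      ContMDiff (𝓡 nG) (𝓡 nP) ∞ (fun Z : EuclideanSpace ℝ (Fin nG) => p Z) ∧
      ∀ Z ∈ T.filt 0, ∃ γ : ℝ → G, IsOneParameterSubgroup Z γ ∧ γ 1 = T.ι (p Z) := by
  obtain ⟨Exp, hExp, hγ⟩ := exists_smooth_exp nP P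
  obtain ⟨r, hr⟩ := LinearMap.exists_leftInverse_of_injective (lieMap nG nP T.ι).toLinearMap
    (LinearMap.ker_eq_bot.2 T.closed_P.injective_lieMap)
  have hr' : ∀ A, r (lieMap nG nP T.ι A) = A := fun A => LinearMap.congr_fun hr A
  let r' : EuclideanSpace ℝ (Fin nG) →ₗ[ℝ] EuclideanSpace ℝ (Fin nP) := r
  refine ⟨fun Z => Exp (r' (toModel Z)), ?_, fun Z hZ => ?_⟩
  · exact hExp.comp (contMDiff_iff_contDiff.2
      (LinearMap.toContinuousLinearMap r').contDiff)
  · obtain ⟨A, rfl⟩ := T.exists_lieMap_ι_eq hZ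
    refine ⟨_, (hγ A).map_ι, ?_⟩
    change T.ι (Exp ((1 : ℝ) • toModel A)) = T.ι (Exp (r (lieMap nG nP T.ι A)))
    rw [one_smul, hr']
    rfl

namespace Geometry

variable (C : Geometry T m b M B) {S : FlagStructure T m b0 M B₀} {q : B → B₀}

/-- `s` is a smooth lift to the total space of the local parametrization `ψ` of the base. -/
structure IsLiftOn (ψ : EuclideanSpace ℝ (Fin m) → M) (Ω : Set (EuclideanSpace ℝ (Fin m)))
    (s : EuclideanSpace ℝ (Fin m) → B) : Prop where
  contMDiffOn : ContMDiffOn (𝓡 m) (𝓡 b) ∞ s Ω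
  proj_eq : ∀ y ∈ Ω, C.π.proj (s y) = ψ y

/-- The value of the Cartan connection on the derivative of `s` at `y` in the direction `v`. -/
noncomputable def pullAt (s : EuclideanSpace ℝ (Fin m) → B) (y v : EuclideanSpace ℝ (Fin m)) :
    GroupLieAlgebra (𝓡 nG) G :=
  C.formAt (s y) (modelDeriv (𝓡 m) (𝓡 b) s y v)

/-- The pull-back of the Cartan connection along `s`, on model spaces. -/
noncomputable def pullForm (s : EuclideanSpace ℝ (Fin m) → B) (y : EuclideanSpace ℝ (Fin m)) :
    EuclideanSpace ℝ (Fin m) →L[ℝ] EuclideanSpace ℝ (Fin nG) :=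
  LinearMap.toContinuousLinearMap
    (E := EuclideanSpace ℝ (Fin m)) (F' := EuclideanSpace ℝ (Fin nG))
    (C.formAt (s y) ∘ₗ (modelDeriv (𝓡 m) (𝓡 b) s y).toLinearMap)

theorem finrank_add_finrank (S : FlagStructure T m b0 M B₀) (x : M) : m + nP = nG := by
  have h1 := S.F_rank (-(T.k : ℤ)) x (by omega)
  have h2 : Module.finrank ℝ (T.filt 0) = nP := by
    have h3 := LinearMap.finrank_range_of_inj (f := (lieMap nG nP T.ι).toLinearMap)
      T.closed_P.injective_lieMap
    rw [T.lie_P] at h3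
    exact h3.trans (finrank_euclideanSpace_fin (𝕜 := ℝ))
  rw [S.F_neg_k, h2, T.filt_eq_top le_rfl, finrank_top, finrank_top] at h1
  have h4 : Module.finrank ℝ (TangentSpace (𝓡 m) x) = m := finrank_euclideanSpace_fin (𝕜 := ℝ)
  have h5 : Module.finrank ℝ (GroupLieAlgebra (𝓡 nG) G) = nG := finrank_euclideanSpace_fin (𝕜 := ℝ)
  rwa [h4, h5] at h1

variable {C} {ψ : EuclideanSpace ℝ (Fin m) → M} {Ω : Set (EuclideanSpace ℝ (Fin m))}
  {s : EuclideanSpace ℝ (Fin m) → B}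

theorem IsLiftOn.mdifferentiableAt (hs : C.IsLiftOn ψ Ω s) (hΩ : IsOpen Ω)
    {y : EuclideanSpace ℝ (Fin m)} (hy : y ∈ Ω) : MDifferentiableAt (𝓡 m) (𝓡 b) s y :=
  (hs.contMDiffOn.contMDiffAt (hΩ.mem_nhds hy)).mdifferentiableAt (by simp)

theorem IsLiftOn.pullForm_add_eq_zero (hC : C.Induces S q) (hs : C.IsLiftOn ψ Ω s) (hΩ : IsOpen Ω)
    (hψ : ∀ y ∈ Ω, ∀ v, modelDeriv (𝓡 m) (𝓡 m) ψ y v = 0 → v = 0)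
    {y : EuclideanSpace ℝ (Fin m)} (hy : y ∈ Ω) {v : EuclideanSpace ℝ (Fin m)}
    {a : GroupLieAlgebra (𝓡 nP) P}
    (h : C.pullForm s y v + toModel (lieMap nG nP T.ι a) = 0) : v = 0 ∧ a = 0 := by
  have h1 : C.formAt (s y) (modelDeriv (𝓡 m) (𝓡 b) s y v) = -lieMap nG nP T.ι a :=
    eq_neg_of_add_eq_zero_left h
  have h2 : C.formAt (s y) (modelDeriv (𝓡 m) (𝓡 b) s y v) ∈ T.filt 0 := by
    rw [h1]
    exact Submodule.neg_mem _ (T.lieMap_ι_mem a)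
  have h3 := (hC.filt_iff 0 le_rfl (s y) (modelDeriv (𝓡 m) (𝓡 b) s y v)).2 h2
  have h4 : modelDeriv (𝓡 b) (𝓡 m) C.π.proj (s y) (modelDeriv (𝓡 m) (𝓡 b) s y v) = 0 := by
    rw [liftFilt, S.F_zero] at h3
    exact h3
  have h5 := (hasModelDerivAt_modelDeriv (C.π.contMDiff_proj.mdifferentiable (by simp)
    (s y))).comp_of_eq (hasModelDerivAt_modelDeriv (hs.mdifferentiableAt hΩ hy)) rfl
  have h6 := h5.congr_of_eventuallyEq (g := ψ) (by
    filter_upwards [hΩ.mem_nhds hy] with z hz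
    exact (hs.proj_eq z hz).symm)
  have hv : v = 0 := by
    refine hψ y hy v ?_
    rw [h6.modelDeriv_eq]
    exact h4
  refine ⟨hv, T.closed_P.injective_lieMap ?_⟩
  rw [hv, map_zero, zero_add] at h
  exact h.trans (map_zero (lieMap nG nP T.ι)).symm

/-- The equation `B(E_λ + Z, s^*ω) = -dh` has a unique solution `Z` with values in `𝔤^1`, and the
solution is smooth. -/
theorem IsLiftOn.exists_potential (R : ScaleRep T) (hC : C.Induces S q) (hs : C.IsLiftOn ψ Ω s)
    (hΩ : IsOpen Ω) (hψ : ∀ y ∈ Ω, ∀ v, modelDeriv (𝓡 m) (𝓡 m) ψ y v = 0 → v = 0) (x : M)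
    {h : EuclideanSpace ℝ (Fin m) → ℝ} (hh : ContDiffOn ℝ ∞ h Ω) :
    ∃ Z : EuclideanSpace ℝ (Fin m) → GroupLieAlgebra (𝓡 nG) G,
      ContDiffOn ℝ ∞ (fun y => toModel (Z y)) Ω ∧
      (∀ y ∈ Ω, Z y ∈ T.filt 1) ∧
      (∀ y ∈ Ω, ∀ v, killingForm ℝ (GroupLieAlgebra (𝓡 nG) G) (R.E + Z y)
        (C.pullAt s y v) = -fderiv ℝ h y v) ∧
      ∀ y ∈ Ω, ∀ z ∈ T.filt 1, (∀ v, killingForm ℝ (GroupLieAlgebra (𝓡 nG) G) (R.E + z)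
        (C.pullAt s y v) = -fderiv ℝ h y v) → z = Z y := by
  have hα : ContDiffOn ℝ ∞ (C.pullForm s) Ω :=
    contDiffOn_clm_apply.2 fun v => C.contDiffOn_formAt hΩ hs.contMDiffOn v
  let κ : LinearMap.BilinForm ℝ (EuclideanSpace ℝ (Fin nG)) :=
    killingForm ℝ (GroupLieAlgebra (𝓡 nG) G)
  let κE : EuclideanSpace ℝ (Fin nG) →L[ℝ] ℝ := LinearMap.toContinuousLinearMap (κ R.E)
  have hβ : ContDiffOn ℝ ∞ (fun y => -fderiv ℝ h y - κE ∘L C.pullForm s y) Ω :=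
    (hh.fderiv_of_isOpen hΩ (by simp)).neg.sub (contDiffOn_const.clm_comp hα)
  let L : EuclideanSpace ℝ (Fin nP) →L[ℝ] EuclideanSpace ℝ (Fin nG) := lieMap nG nP T.ι
  obtain ⟨Z₀, hZ, hsol, huniq⟩ := exists_contDiffOn_represent (Bf := κ)
    T.killingForm_nondegenerate hα L
    (fun y hy v a h => hs.pullForm_add_eq_zero hC hΩ hψ hy h)
    (by simpa using finrank_add_finrank S x) hβ
  let Z : EuclideanSpace ℝ (Fin m) → GroupLieAlgebra (𝓡 nG) G := Z₀
  have hsol' : ∀ y ∈ Ω, ∀ v, killingForm ℝ (GroupLieAlgebra (𝓡 nG) G) (Z y) (C.pullAt s y v) =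
      -fderiv ℝ h y v - killingForm ℝ (GroupLieAlgebra (𝓡 nG) G) R.E (C.pullAt s y v) := by
    intro y hy v
    have h1 := hsol y hy v 0
    have h2 : C.pullForm s y v + L 0 = C.pullForm s y v := by rw [map_zero, add_zero]
    rw [h2] at h1
    exact h1
  refine ⟨Z, hZ, fun y hy => ?_, fun y hy v => ?_, fun y hy z hz hzv => ?_⟩
  · refine T.mem_filt_one_of_killingForm_eq_zero fun A hA => ?_
    obtain ⟨a, rfl⟩ := T.exists_lieMap_ι_eq hA
    have h1 := hsol y hy 0 a
    have h2 : C.pullForm s y 0 + L a = L a := by rw [map_zero, zero_add]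
    rw [h2, map_zero] at h1
    exact h1
  · rw [map_add, LinearMap.add_apply, hsol' y hy v]
    ring
  · refine huniq y hy z fun v a => ?_
    have h1 := hzv v
    rw [map_add, LinearMap.add_apply] at h1
    have h2 : killingForm ℝ (GroupLieAlgebra (𝓡 nG) G) z (lieMap nG nP T.ι a) = 0 :=
      T.killingForm_eq_zero_of_mem_filt (i := 1) (j := 0) one_pos hz (T.lieMap_ι_mem a)
    have h3 : killingForm ℝ (GroupLieAlgebra (𝓡 nG) G) z (C.pullAt s y v) =
      -fderiv ℝ h y v - killingForm ℝ (GroupLieAlgebra (𝓡 nG) G) R.E (C.pullAt s y v) := by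
      linarith
    refine (map_add (κ z) (C.pullForm s y v) (L a)).trans ?_
    refine (congrArg₂ (· + ·) h3 h2).trans ?_
    exact add_zero _

/-- One step of the normalization: the potential of a lift with values in `𝔤^i` is pushed into
`𝔤^{i+1}` by acting with the exponential of a section of `𝔤_i`. -/
theorem IsLiftOn.exists_improvement (R : ScaleRep T) (hC : C.Induces S q) (hs : C.IsLiftOn ψ Ω s)
    (hΩ : IsOpen Ω) (hψ : ∀ y ∈ Ω, ∀ v, modelDeriv (𝓡 m) (𝓡 m) ψ y v = 0 → v = 0) (x : M)
    {h : EuclideanSpace ℝ (Fin m) → ℝ} (hh : ContDiffOn ℝ ∞ h Ω) {i : ℤ} (hi : 0 < i)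
    (hZ : ∀ y ∈ Ω, ∃ Z ∈ T.filt i, ∀ v, killingForm ℝ (GroupLieAlgebra (𝓡 nG) G) (R.E + Z)
      (C.pullAt s y v) = -fderiv ℝ h y v) :
    ∃ s', C.IsLiftOn ψ Ω s' ∧ (∀ y ∈ Ω, q (s' y) = q (s y)) ∧
      ∀ y ∈ Ω, ∃ Z ∈ T.filt (i + 1), ∀ v, killingForm ℝ (GroupLieAlgebra (𝓡 nG) G) (R.E + Z)
        (C.pullAt s' y v) = -fderiv ℝ h y v := by
  obtain ⟨Z, hZs, -, hZeq, hZu⟩ := hs.exists_potential R hC hΩ hψ x hh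
  have hZi : ∀ y ∈ Ω, Z y ∈ T.filt i := fun y hy => by
    obtain ⟨z, hz, hzv⟩ := hZ y hy
    rwa [← hZu y hy z (T.filt_anti (by omega) hz) hzv]
  obtain ⟨c, hc0, hc⟩ := R.E_scalar i
  have hc0 := hc0 (by omega)
  obtain ⟨ex, hex, hγ⟩ := T.exists_smooth_exp_parabolic
  -- To first order `Ad (exp Υ)⁻¹ E_λ = E_λ + [E_λ, Υ] = E_λ + c Υ`, so this choice of `Υ` cancels
  -- the component of `Z` in degree `i`.
  let Υ : EuclideanSpace ℝ (Fin m) → GroupLieAlgebra (𝓡 nG) G := fun y => -c⁻¹ • T.comp i (Z y)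
  have hΥgr : ∀ y, Υ y ∈ T.gr i := fun y => Submodule.smul_mem _ _ (T.comp_mem i _)
  have hΥ : ∀ y, Υ y ∈ T.filt i := fun y => T.mem_filt_of_mem_gr le_rfl (hΥgr y)
  have hP : ∀ y, ex (Υ y) ∈ T.Pplus := fun y => by
    obtain ⟨γ, h1, h2⟩ := hγ (Υ y) (T.filt_anti (by omega) (hΥ y))
    exact ⟨Υ y, T.filt_anti (by omega) (hΥ y), γ, h1, h2⟩
  have hΥs : ContDiffOn ℝ ∞ (fun y => toModel (Υ y)) Ω := by
    let D : EuclideanSpace ℝ (Fin nG) →ₗ[ℝ] EuclideanSpace ℝ (Fin nG) := -c⁻¹ • T.compLinear i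
    exact (LinearMap.toContinuousLinearMap D).contDiff.comp_contDiffOn hZs
  have hps : ContMDiffOn (𝓡 m) (𝓡 nP) ∞ (fun y => ex (Υ y)) Ω :=
    hex.comp_contMDiffOn (contMDiffOn_iff_contDiffOn.2 hΥs)
  refine ⟨fun y => C.π.act (s y) (ex (Υ y)), ⟨?_, fun y hy => ?_⟩, fun y hy => ?_, fun y hy => ?_⟩
  · exact C.π.contMDiff_act.comp_contMDiffOn (hs.contMDiffOn.prodMk hps)
  · rw [C.π.proj_act, hs.proj_eq y hy]
  · exact ((hC.q_eq_iff _ _).2 ⟨_, hP y, rfl⟩).symm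
  have hδ : HasModelDerivAt (𝓡 m) (𝓡 nP) (fun z => (ex (Υ y))⁻¹ * ex (Υ z)) y _ :=
    hasModelDerivAt_modelDeriv (I₁ := 𝓡 m) (I₂ := 𝓡 nP)
    (f := fun z => (ex (Υ y))⁻¹ * ex (Υ z)) (x := y)
    (((contMDiff_mul_left (I := 𝓡 nP) (n := ∞) (a := (ex (Υ y))⁻¹)).comp_contMDiffOn hps
      |>.contMDiffAt (hΩ.mem_nhds hy)).mdifferentiableAt (by simp))
  have hE := R.E_mem_filt
  have hEZ : R.E + Z y ∈ T.filt 0 := Submodule.add_mem _ hE (T.filt_anti (by omega) (hZi y hy))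
  refine ⟨Ad (T.ι (ex (Υ y)))⁻¹ (R.E + Z y) - R.E, ?_, fun v => ?_⟩
  · obtain ⟨γ, h1, h2⟩ := hγ (Υ y) (T.filt_anti (by omega) (hΥ y))
    rw [← h2, ← h1.map_neg]
    have h3 := T.Ad_sub_sub_mem_filt hi (hΥ y) h1 hE (-1)
    have h4 := T.Ad_sub_mem_filt hi (hΥ y) h1 (hZi y hy) (-1)
    have h5 : T.comp i (Z y) = -c • Υ y := by
      simp only [Υ, smul_smul, neg_mul_neg, mul_inv_cancel₀ hc0, one_smul]
    have h6 : Z y + c • Υ y ∈ T.filt (i + 1) := by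
      refine T.mem_filt_succ (Submodule.add_mem _ (hZi y hy) (Submodule.smul_mem _ _ (hΥ y))) ?_
      rw [T.comp_add, T.comp_smul, T.comp_of_mem (hΥgr y), h5, neg_smul, neg_add_cancel]
    have h7 : ⁅Υ y, R.E⁆ = -(c • Υ y) := by
      rw [← lie_skew, hc _ (hΥgr y)]
    have h8 : Ad (γ (-1)) (R.E + Z y) - R.E =
        (Ad (γ (-1)) R.E - R.E - (-1 : ℝ) • ⁅Υ y, R.E⁆) + (Ad (γ (-1)) (Z y) - Z y) +
          (Z y + c • Υ y) := by
      rw [h7, map_add]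
      module
    rw [h8]
    exact Submodule.add_mem _ (Submodule.add_mem _ (T.filt_anti (by omega) h3)
      (T.filt_anti (by omega) h4)) h6
  · have h1 := C.formAt_hasModelDerivAt_act (p := fun z => ex (Υ z))
      (hasModelDerivAt_modelDeriv (hs.mdifferentiableAt hΩ hy)) hδ v
    have h2 := T.lieMap_mem_filt_one hP hδ v
    rw [add_sub_cancel]
    refine (congrArg (killingForm ℝ (GroupLieAlgebra (𝓡 nG) G) _) h1).trans ?_
    rw [map_add, killingForm_Ad, T.killingForm_eq_zero_of_mem_filt (i := 0) (j := 1) one_pos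
      (T.Ad_inv_mem_of_mem_Pplus (hP y) hEZ) h2, add_zero]
    exact hZeq y hy v

/-- A lift can be modified by a map into `P₊` such that `B(E_λ, s^*ω)` becomes any prescribed exact
one-form. -/
theorem IsLiftOn.exists_normalized (R : ScaleRep T) (hC : C.Induces S q) (hs : C.IsLiftOn ψ Ω s)
    (hΩ : IsOpen Ω) (hψ : ∀ y ∈ Ω, ∀ v, modelDeriv (𝓡 m) (𝓡 m) ψ y v = 0 → v = 0) (x : M)
    {h : EuclideanSpace ℝ (Fin m) → ℝ} (hh : ContDiffOn ℝ ∞ h Ω) :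
    ∃ s', C.IsLiftOn ψ Ω s' ∧ (∀ y ∈ Ω, q (s' y) = q (s y)) ∧
      ∀ y ∈ Ω, ∀ v, killingForm ℝ (GroupLieAlgebra (𝓡 nG) G) R.E (C.pullAt s' y v) =
        -fderiv ℝ h y v := by
  -- `𝔤^{r + 1}` vanishes for `r = k`
  have key : ∀ r : ℕ, ∃ s', C.IsLiftOn ψ Ω s' ∧ (∀ y ∈ Ω, q (s' y) = q (s y)) ∧
      ∀ y ∈ Ω, ∃ Z ∈ T.filt (r + 1), ∀ v, killingForm ℝ (GroupLieAlgebra (𝓡 nG) G) (R.E + Z)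
        (C.pullAt s' y v) = -fderiv ℝ h y v := by
    intro r
    induction r with
    | zero =>
      obtain ⟨Z, -, hZ1, hZ, -⟩ := hs.exists_potential R hC hΩ hψ x hh
      exact ⟨s, hs, fun _ _ => rfl, fun y hy => ⟨Z y, by simpa using hZ1 y hy, hZ y hy⟩⟩
    | succ r ih =>
      obtain ⟨s', hs', hq, hZ⟩ := ih
      obtain ⟨s'', hs'', hq', hZ'⟩ := hs'.exists_improvement R hC hΩ hψ x hh (by omega) hZ
      exact ⟨s'', hs'', fun y hy => (hq' y hy).trans (hq y hy), by exact_mod_cast hZ'⟩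
  obtain ⟨s', hs', hq, hZ⟩ := key T.k
  refine ⟨s', hs', hq, fun y hy v => ?_⟩
  obtain ⟨Z, hZ1, hZv⟩ := hZ y hy
  rw [T.filt_eq_bot (by omega), Submodule.mem_bot] at hZ1
  have h1 := hZv v
  rwa [hZ1, add_zero] at h1

end Geometry

end Normalization

/-! ### Scales and exact Weyl structures -/

section Scales

set_option linter.unusedSectionVars false

section RealValued

variable {E₁ H₁ M₁ : Type*} [NormedAddCommGroup E₁] [NormedSpace ℝ E₁] [TopologicalSpace H₁]
  [TopologicalSpace M₁] [ChartedSpace H₁ M₁] {I₁ : ModelWithCorners ℝ E₁ H₁}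
  {f g : M₁ → ℝ} {x : M₁} {f' g' : E₁ →L[ℝ] ℝ}

theorem HasModelDerivAt.add (hf : HasModelDerivAt I₁ 𝓘(ℝ, ℝ) f x f')
    (hg : HasModelDerivAt I₁ 𝓘(ℝ, ℝ) g x g') :
    HasModelDerivAt I₁ 𝓘(ℝ, ℝ) (fun z => f z + g z) x (f' + g') :=
  HasMFDerivAt.add hf hg

theorem HasModelDerivAt.sub (hf : HasModelDerivAt I₁ 𝓘(ℝ, ℝ) f x f')
    (hg : HasModelDerivAt I₁ 𝓘(ℝ, ℝ) g x g') :
    HasModelDerivAt I₁ 𝓘(ℝ, ℝ) (fun z => f z - g z) x (f' - g') :=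
  HasMFDerivAt.sub hf hg

end RealValued

theorem contMDiffOn_modelDeriv_apply {r : ℕ} {N F : Type*} [TopologicalSpace N]
    [ChartedSpace (EuclideanSpace ℝ (Fin r)) N] [IsManifold (𝓡 r) ∞ N]
    [NormedAddCommGroup F] [NormedSpace ℝ F] {g : N → F} {V : Set N} (hV : IsOpen V)
    (hg : ContMDiffOn (𝓡 r) 𝓘(ℝ, F) ∞ g V) {ξ : (y : N) → TangentSpace (𝓡 r) y}
    (hξ : SmoothFieldOn V ξ) :
    ContMDiffOn (𝓡 r) 𝓘(ℝ, F) ∞ (fun y => modelDeriv (𝓡 r) 𝓘(ℝ, F) g y (ξ y)) V := by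
  have hN : IsManifold (𝓡 r) 1 N := IsManifold.of_le (n := ∞) ENat.LEInfty.out
  have h1 := hg.contMDiffOn_tangentMapWithin (m := ∞) (by simp) hV.uniqueMDiffOn
  have h2 := (contMDiff_snd_tangentBundle_modelSpace F 𝓘(ℝ, F) (n := ∞)).comp_contMDiffOn
    (h1.comp hξ fun y hy => hy)
  refine h2.congr fun y hy => ?_
  have h4 : mfderivWithin (𝓡 r) 𝓘(ℝ, F) g V y = mfderiv (𝓡 r) 𝓘(ℝ, F) g y :=
    mfderivWithin_of_isOpen hV hy
  exact congrArg (fun L : EuclideanSpace ℝ (Fin r) →L[ℝ] F => L (ξ y)) h4.symm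

namespace PrincipalBundle

variable {nH nE m : ℕ} {H E M : Type*}
  [TopologicalSpace H] [ChartedSpace (EuclideanSpace ℝ (Fin nH)) H] [Group H]
  [LieGroup (𝓡 nH) ∞ H]
  [TopologicalSpace E] [ChartedSpace (EuclideanSpace ℝ (Fin nE)) E] [IsManifold (𝓡 nE) ∞ E]
  [TopologicalSpace M] [ChartedSpace (EuclideanSpace ℝ (Fin m)) M] [IsManifold (𝓡 m) ∞ M]
  (π : PrincipalBundle nH nE m H E M)

/-- A local section of a principal bundle determines a local trivialization. -/
theorem exists_trivialization {V' : Set M} (hV' : IsOpen V') {e : M → E}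
    (he : ContMDiffOn (𝓡 m) (𝓡 nE) ∞ e V') (hproj : ∀ y ∈ V', π.proj (e y) = y) {x : M}
    (hx : x ∈ V') :
    ∃ (V : Set M) (τ : E → H), IsOpen V ∧ x ∈ V ∧ V ⊆ V' ∧
      ContMDiffOn (𝓡 nE) (𝓡 nH) ∞ τ (π.proj ⁻¹' V) ∧
      (∀ u, π.proj u ∈ V → π.act (e (π.proj u)) (τ u) = u) ∧
      ∀ u, π.proj u ∈ V → ∀ h, τ (π.act u h) = τ u * h := by
  obtain ⟨W, e', τ', hW, hxW, -, hτ', -, hact, hτact⟩ := π.locallyTrivial x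
  have hmul : ∀ u, π.proj u ∈ W → ∀ h, τ' (π.act u h) = τ' u * h := fun u hu h => by
    have h1 := hτact (π.proj u) hu (τ' u * h)
    rwa [← π.act_mul, hact u hu] at h1
  refine ⟨V' ∩ W, fun u => (τ' (e (π.proj u)))⁻¹ * τ' u, hV'.inter hW, ⟨hx, hxW⟩,
    Set.inter_subset_left, ?_, fun u hu => ?_, fun u hu h => ?_⟩
  · have h1 : ContMDiffOn (𝓡 nE) (𝓡 nH) ∞ (fun u => τ' (e (π.proj u))) (π.proj ⁻¹' (V' ∩ W)) := by
      refine hτ'.comp (he.comp π.contMDiff_proj.contMDiffOn fun u hu => hu.1) fun u hu => ?_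
      change π.proj (e (π.proj u)) ∈ W
      rw [hproj _ hu.1]
      exact hu.2
    exact h1.inv.mul (hτ'.mono fun u hu => hu.2)
  · have h1 : π.act (e' (π.proj u)) (τ' (e (π.proj u))) = e (π.proj u) := by
      have h2 := hact (e (π.proj u)) (by rw [hproj _ hu.1]; exact hu.2)
      rwa [hproj _ hu.1] at h2
    change π.act (e (π.proj u)) ((τ' (e (π.proj u)))⁻¹ * τ' u) = u
    rw [← h1, π.act_mul, h1, mul_inv_cancel_left]
    exact hact u hu.2
  · change (τ' (e (π.proj (π.act u h))))⁻¹ * τ' (π.act u h) = _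
    rw [π.proj_act, hmul u hu.2, mul_assoc]

end PrincipalBundle

variable {nG nP n0 m b b0 : ℕ} {G P G₀ M B B₀ : Type*}
  [TopologicalSpace G] [ChartedSpace (EuclideanSpace ℝ (Fin nG)) G] [Group G]
  [LieGroup (𝓡 nG) ∞ G]
  [TopologicalSpace P] [ChartedSpace (EuclideanSpace ℝ (Fin nP)) P] [Group P]
  [LieGroup (𝓡 nP) ∞ P]
  [TopologicalSpace G₀] [ChartedSpace (EuclideanSpace ℝ (Fin n0)) G₀] [Group G₀]
  [LieGroup (𝓡 n0) ∞ G₀]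
  [TopologicalSpace M] [ChartedSpace (EuclideanSpace ℝ (Fin m)) M] [IsManifold (𝓡 m) ∞ M]
  [TopologicalSpace B] [ChartedSpace (EuclideanSpace ℝ (Fin b)) B] [IsManifold (𝓡 b) ∞ B]
  [TopologicalSpace B₀] [ChartedSpace (EuclideanSpace ℝ (Fin b0)) B₀] [IsManifold (𝓡 b0) ∞ B₀]
  {T : ParabolicType nG nP n0 G P G₀}

namespace ScaleRep

variable (R : ScaleRep T)

/-- The logarithm of the scale representation. -/
noncomputable def logLam (g : G₀) : ℝ := Real.log (R.lam g)

theorem logLam_mul (g h : G₀) : R.logLam (g * h) = R.logLam g + R.logLam h := by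
  rw [logLam, map_mul, Real.log_mul (R.lam_pos g).ne' (R.lam_pos h).ne']
  rfl

theorem contMDiff_logLam : ContMDiff (𝓡 n0) 𝓘(ℝ, ℝ) ∞ R.logLam := fun g =>
  (Real.contDiffAt_log.2 (R.lam_pos g).ne').contMDiffAt.comp g R.contMDiff_lam.contMDiffAt

theorem modelDeriv_logLam_one (A : GroupLieAlgebra (𝓡 n0) G₀) :
    modelDeriv (𝓡 n0) 𝓘(ℝ, ℝ) R.logLam 1 (toModel A) =
      killingForm ℝ (GroupLieAlgebra (𝓡 nG) G) R.E (lieMap nG nP T.ι (lieMap nP n0 T.j A)) := by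
  rw [← R.deriv_lam]
  have h1 := hasModelDerivAt_modelDeriv (R.contMDiff_lam.mdifferentiable (by simp) 1)
  have h2 := (hasModelDerivAt_iff_hasFDerivAt.2
    (Real.hasDerivAt_log one_ne_zero).hasFDerivAt).comp_of_eq h1 (map_one R.lam)
  refine (congrArg (fun L : EuclideanSpace ℝ (Fin n0) →L[ℝ] ℝ => L (toModel A))
    h2.modelDeriv_eq).trans ?_
  change modelDeriv (𝓡 n0) 𝓘(ℝ, ℝ) R.lam 1 (toModel A) * (1 : ℝ)⁻¹ = _
  rw [inv_one, mul_one]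
  rfl

end ScaleRep

variable {C : Geometry T m b M B} {S : FlagStructure T m b0 M B₀} {q : B → B₀}

/-- The chain rule for the representative `exp f` of a scale. -/
theorem differential_exp {f : B₀ → ℝ} {u : B₀} (hf : MDifferentiableAt (𝓡 b0) 𝓘(ℝ, ℝ) f u)
    (ξ : EuclideanSpace ℝ (Fin b0)) :
    differential (fun u => Real.exp (f u)) u ξ =
      Real.exp (f u) * modelDeriv (𝓡 b0) 𝓘(ℝ, ℝ) f u ξ := by
  have h1 := (hasModelDerivAt_iff_hasFDerivAt.2
    (Real.hasDerivAt_exp (f u)).hasFDerivAt).comp_of_eq (hasModelDerivAt_modelDeriv hf) rfl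
  refine (congrArg (fun L : EuclideanSpace ℝ (Fin b0) →L[ℝ] ℝ => L ξ) h1.modelDeriv_eq).trans ?_
  exact mul_comm _ _

/-- The Cartan connection along the equivariant extension `u ↦ s(y(u)) · τ(u)` of a lift `s` for
which `B(E_λ, s^*ω) = -dh`. -/
theorem killingForm_formAt_extension (R : ScaleRep T) {Ω : Set (EuclideanSpace ℝ (Fin m))}
    {ψ : EuclideanSpace ℝ (Fin m) → M} (hΩ : IsOpen Ω)
    {s : EuclideanSpace ℝ (Fin m) → B} (hs : C.IsLiftOn ψ Ω s) {h : EuclideanSpace ℝ (Fin m) → ℝ}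
    (hh : ContDiffOn ℝ ∞ h Ω)
    (hsh : ∀ y ∈ Ω, ∀ v, killingForm ℝ (GroupLieAlgebra (𝓡 nG) G) R.E (C.pullAt s y v) =
      -fderiv ℝ h y v) {χ : B₀ → EuclideanSpace ℝ (Fin m)} {τ : B₀ → G₀} {u : B₀}
    (hχ : MDifferentiableAt (𝓡 b0) (𝓡 m) χ u) (hτ : MDifferentiableAt (𝓡 b0) (𝓡 n0) τ u)
    (hu : χ u ∈ Ω) (ξ : EuclideanSpace ℝ (Fin b0)) :
    killingForm ℝ (GroupLieAlgebra (𝓡 nG) G) R.E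
        (C.formAt (C.π.act (s (χ u)) (T.j (τ u)))
          (modelDeriv (𝓡 b0) (𝓡 b) (fun v => C.π.act (s (χ v)) (T.j (τ v))) u ξ)) =
      -modelDeriv (𝓡 b0) 𝓘(ℝ, ℝ) (fun v => h (χ v) - R.logLam (τ v)) u ξ := by
  have hχ' := hasModelDerivAt_modelDeriv hχ
  have hs' := (hasModelDerivAt_modelDeriv (hs.mdifferentiableAt hΩ hu)).comp_of_eq hχ' rfl
  have hh' := (hasModelDerivAt_iff_hasFDerivAt.2 ((hh.contDiffAt (hΩ.mem_nhds hu)).differentiableAt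
    (by simp)).hasFDerivAt).comp_of_eq hχ' rfl
  have hδ : HasModelDerivAt (𝓡 b0) (𝓡 n0) (fun v => (τ u)⁻¹ * τ v) u _ :=
    (hasModelDerivAt_modelDeriv (mdifferentiable_mul_left (n := n0) (τ u)⁻¹ (τ u))).comp_of_eq
      (hasModelDerivAt_modelDeriv hτ) rfl
  generalize (modelDeriv (𝓡 n0) (𝓡 n0) (fun h => (τ u)⁻¹ * h) (τ u) ∘L
    modelDeriv (𝓡 b0) (𝓡 n0) τ u) = δ at hδ
  have hj : HasModelDerivAt (𝓡 n0) (𝓡 nP) T.j 1 (lieMap nP n0 T.j) :=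
    hasModelDerivAt_modelDeriv (T.closed_G₀.contMDiff.mdifferentiable (by simp) 1)
  have hjδ : HasModelDerivAt (𝓡 b0) (𝓡 nP) (fun v => (T.j (τ u))⁻¹ * T.j (τ v)) u _ :=
    (hj.comp_of_eq hδ (by simp)).congr_of_eventuallyEq
      (Filter.Eventually.of_forall fun v => by simp)
  have h1 := C.formAt_hasModelDerivAt_act (p := fun v => T.j (τ v)) hs' hjδ ξ
  have hlog := (hasModelDerivAt_modelDeriv (R.contMDiff_logLam.mdifferentiable (by simp)
    1)).comp_of_eq hδ (by simp)
  have hΛ : HasModelDerivAt (𝓡 b0) 𝓘(ℝ, ℝ) (fun v => h (χ v) - R.logLam (τ v)) u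
      (fderiv ℝ h (χ u) ∘L modelDeriv (𝓡 b0) (𝓡 m) χ u -
        (modelDeriv (𝓡 n0) 𝓘(ℝ, ℝ) R.logLam 1) ∘L δ) := by
    have h3 := (hh'.sub hlog).sub (hasModelDerivAt_const (I₁ := 𝓡 b0) (R.logLam (τ u)) u)
    rw [sub_zero] at h3
    exact h3.congr_of_eventuallyEq (g := fun v => h (χ v) - R.logLam (τ v))
      (Filter.Eventually.of_forall fun v => by
        have h5 := R.logLam_mul (τ u) ((τ u)⁻¹ * τ v)
        rw [mul_inv_cancel_left] at h5
        simp only [h5]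
        ring)
  refine (congrArg (killingForm ℝ (GroupLieAlgebra (𝓡 nG) G) R.E) h1).trans ?_
  have hE : Ad (T.ι (T.j (τ u)))⁻¹ R.E = R.E := by
    rw [← map_inv, ← map_inv, R.Ad_E]
  have h5 := R.modelDeriv_logLam_one (δ ξ)
  rw [map_add]
  nth_rw 1 [← hE]
  rw [killingForm_Ad]
  refine Eq.trans ?_ (congrArg (fun L : EuclideanSpace ℝ (Fin b0) →L[ℝ] ℝ => -L ξ)
    hΛ.modelDeriv_eq).symm
  refine (congrArg₂ (· + ·) (hsh _ hu (modelDeriv (𝓡 b0) (𝓡 m) χ u ξ)) h5.symm).trans ?_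
  change -fderiv ℝ h (χ u) (modelDeriv (𝓡 b0) (𝓡 m) χ u ξ) +
    modelDeriv (𝓡 n0) 𝓘(ℝ, ℝ) R.logLam 1 (δ ξ) =
    -(fderiv ℝ h (χ u) (modelDeriv (𝓡 b0) (𝓡 m) χ u ξ) -
      modelDeriv (𝓡 n0) 𝓘(ℝ, ℝ) R.logLam 1 (δ ξ))
  ring

end Scales

/-! ### Inessentiality away from the zeros -/

section Inessential

set_option linter.unusedSectionVars false

variable {nG nP n0 m b b0 : ℕ} {G P G₀ M B B₀ : Type*}
  [TopologicalSpace G] [ChartedSpace (EuclideanSpace ℝ (Fin nG)) G] [Group G]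
  [LieGroup (𝓡 nG) ∞ G]
  [TopologicalSpace P] [ChartedSpace (EuclideanSpace ℝ (Fin nP)) P] [Group P]
  [LieGroup (𝓡 nP) ∞ P]
  [TopologicalSpace G₀] [ChartedSpace (EuclideanSpace ℝ (Fin n0)) G₀] [Group G₀]
  [LieGroup (𝓡 n0) ∞ G₀]
  [TopologicalSpace M] [ChartedSpace (EuclideanSpace ℝ (Fin m)) M] [IsManifold (𝓡 m) ∞ M]
  [TopologicalSpace B] [ChartedSpace (EuclideanSpace ℝ (Fin b)) B] [IsManifold (𝓡 b) ∞ B]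
  [TopologicalSpace B₀] [ChartedSpace (EuclideanSpace ℝ (Fin b0)) B₀] [IsManifold (𝓡 b0) ∞ B₀]
  {T : ParabolicType nG nP n0 G P G₀} {S : FlagStructure T m b0 M B₀}

/-- The derivative of `log λ` of the fibre coordinate in the direction of an invariant field is
constant along the fibres. -/
theorem modelDeriv_logLam_act (R : ScaleRep T) (X : S.InfAut) {W : Set M} (hW : IsOpen W)
    {τ : B₀ → G₀} (hτ : ContMDiffOn (𝓡 b0) (𝓡 n0) ∞ τ (S.π₀.proj ⁻¹' W))
    (hact : ∀ u, S.π₀.proj u ∈ W → ∀ g, τ (S.π₀.act u g) = τ u * g) {u : B₀}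
    (hu : S.π₀.proj u ∈ W) (g : G₀) :
    modelDeriv (𝓡 b0) 𝓘(ℝ, ℝ) (fun v => R.logLam (τ v)) (S.π₀.act u g) (X.X₀ (S.π₀.act u g)) =
      modelDeriv (𝓡 b0) 𝓘(ℝ, ℝ) (fun v => R.logLam (τ v)) u (X.X₀ u) := by
  have hWo : IsOpen (S.π₀.proj ⁻¹' W) := hW.preimage S.π₀.contMDiff_proj.continuous
  have hℓ : ∀ u, S.π₀.proj u ∈ W →
      MDifferentiableAt (𝓡 b0) 𝓘(ℝ, ℝ) (fun v => R.logLam (τ v)) u := fun u hu =>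
    ((R.contMDiff_logLam.comp_contMDiffOn hτ).contMDiffAt
      (hWo.mem_nhds hu)).mdifferentiableAt (by simp)
  have h1 := (hasModelDerivAt_modelDeriv (hℓ (S.π₀.act u g) (by rwa [S.π₀.proj_act]))).comp_of_eq
    (hasModelDerivAt_modelDeriv ((S.π₀.contMDiff_act_left g).mdifferentiable (by simp) u)) rfl
  have h2 := (hasModelDerivAt_modelDeriv (hℓ u hu)).add
    (hasModelDerivAt_const (I₁ := 𝓡 b0) (R.logLam g) u)
  have h3 := h1.unique h2 (by
    filter_upwards [hWo.mem_nhds hu] with v hv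
    rw [hact v hv, R.logLam_mul])
  have h4 : modelDeriv (𝓡 b0) (𝓡 b0) (fun v => S.π₀.act v g) u (X.X₀ u) =
      X.X₀ (S.π₀.act u g) := X.invariant u g
  refine (congrArg (modelDeriv (𝓡 b0) 𝓘(ℝ, ℝ) (fun v => R.logLam (τ v)) (S.π₀.act u g))
    h4.symm).trans ?_
  refine (congrArg (fun L : EuclideanSpace ℝ (Fin b0) →L[ℝ] ℝ => L (X.X₀ u)) h3).trans ?_
  exact add_zero _

/-- An infinitesimal automorphism is inessential near every point at which it does not vanish. -/
theorem exists_isOpen_inessentialOn (R : ScaleRep T) {C : Geometry T m b M B} {q : B → B₀}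
    (hC : C.Induces S q) (X : S.InfAut) {x : M} (hx : X.X x ≠ 0) :
    ∃ U : Set M, IsOpen U ∧ x ∈ U ∧ InessentialOn C R q X U := by
  obtain ⟨V₁, e₁, -, hV₁, hxV₁, he₁, -, he₁p, -⟩ := C.π.locallyTrivial x
  have hM1 : IsManifold (𝓡 m) 1 M := IsManifold.of_le (n := ∞) ENat.LEInfty.out
  -- the induced local section of `𝒢₀` and the trivialization it determines
  have he₀ : ContMDiffOn (𝓡 m) (𝓡 b0) ∞ (fun y => q (e₁ y))
      (V₁ ∩ (extChartAt (𝓡 m) x).source) :=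
    (hC.contMDiff.comp_contMDiffOn he₁).mono Set.inter_subset_left
  have he₀p : ∀ y ∈ V₁ ∩ (extChartAt (𝓡 m) x).source, S.π₀.proj (q (e₁ y)) = y := fun y hy => by
    rw [hC.proj_q, he₁p y hy.1]
  obtain ⟨V, τ, hV, hxV, hVsub, hτ, hact, hτact⟩ := S.π₀.exists_trivialization
    (hV₁.inter (isOpen_extChartAt_source x)) he₀ he₀p ⟨hxV₁, mem_extChartAt_source x⟩
  have hVo : IsOpen (S.π₀.proj ⁻¹' V) := hV.preimage S.π₀.contMDiff_proj.continuous
  let φ := extChartAt (𝓡 m) x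
  have hψ : ContMDiffOn (𝓡 m) (𝓡 m) ∞ φ.symm φ.target := contMDiffOn_extChartAt_symm x
  have hφ : ContMDiffOn (𝓡 m) (𝓡 m) ∞ φ φ.source := by
    have h1 := contMDiffOn_extChartAt (I := 𝓡 m) (n := ∞) (x := x)
    rwa [← extChartAt_source (𝓡 m)] at h1
  have hΩ : IsOpen (φ.target ∩ φ.symm ⁻¹' V) :=
    (continuousOn_extChartAt_symm x).isOpen_inter_preimage (isOpen_extChartAt_target x) hV
  -- the vector field and the derivative of the fibre coordinate along it, in the chart
  let F : EuclideanSpace ℝ (Fin m) → EuclideanSpace ℝ (Fin m) := fun z =>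
    modelDeriv (𝓡 m) (𝓡 m) φ (φ.symm z) (X.X (φ.symm z))
  let c : EuclideanSpace ℝ (Fin m) → ℝ := fun z =>
    modelDeriv (𝓡 b0) 𝓘(ℝ, ℝ) (fun v => R.logLam (τ v)) (q (e₁ (φ.symm z)))
      (X.X₀ (q (e₁ (φ.symm z))))
  have hψΩ : ContMDiffOn (𝓡 m) (𝓡 m) ∞ φ.symm (φ.target ∩ φ.symm ⁻¹' V) :=
    hψ.mono Set.inter_subset_left
  have hF : ContDiffOn ℝ ∞ F (φ.target ∩ φ.symm ⁻¹' V) :=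
    contMDiffOn_iff_contDiffOn.1 ((contMDiffOn_modelDeriv_apply (isOpen_extChartAt_source x) hφ
      (X.smooth.mono (Set.subset_univ _))).comp hψΩ fun z hz => φ.map_target hz.1)
  have hc : ContDiffOn ℝ ∞ c (φ.target ∩ φ.symm ⁻¹' V) :=
    contMDiffOn_iff_contDiffOn.1 ((contMDiffOn_modelDeriv_apply hVo
      (R.contMDiff_logLam.comp_contMDiffOn hτ) (X.smooth₀.mono (Set.subset_univ _))).comp
        (he₀.comp hψΩ fun z hz => hVsub hz.2) fun z hz => by
          change S.π₀.proj (q (e₁ (φ.symm z))) ∈ V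
          rw [he₀p _ (hVsub hz.2)]
          exact hz.2)
  have hφx : φ.symm (φ x) = x := extChartAt_to_inv x
  have hFx : F (φ x) ≠ 0 := by
    have h1 : ∀ v, modelDeriv (𝓡 m) (𝓡 m) φ (φ.symm (φ x)) v = 0 → v = 0 := fun v hv => by
      rw [hφx] at hv
      exact (isInvertible_mfderiv_extChartAt (I := 𝓡 m) (mem_extChartAt_source x)).injective
        (hv.trans (map_zero (mfderiv (𝓡 m) (𝓡 m) φ x)).symm)
    intro h2
    refine hx ?_
    have h3 := h1 _ h2
    rwa [hφx] at h3
  obtain ⟨h, Ω, hΩo, hxΩ, hΩsub, hh, hhF⟩ := exists_fderiv_apply_eq hΩ hF hc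
    ⟨mem_extChartAt_target x, by change φ.symm (φ x) ∈ V; rwa [hφx]⟩ hFx
  have hψinj : ∀ z ∈ Ω, ∀ v, modelDeriv (𝓡 m) (𝓡 m) φ.symm z v = 0 → v = 0 := fun z hz v hv => by
    have h1 := isInvertible_mfderivWithin_extChartAt_symm (I := 𝓡 m) (hΩsub hz).1
    rw [ModelWithCorners.range_eq_univ, mfderivWithin_univ] at h1
    exact h1.injective (hv.trans (map_zero (mfderiv (𝓡 m) (𝓡 m) φ.symm z)).symm)
  have hlift : C.IsLiftOn φ.symm Ω (fun z => e₁ (φ.symm z)) :=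
    ⟨(he₁.comp hψΩ fun z hz => (hVsub hz.2).1).mono hΩsub,
      fun z hz => he₁p _ (hVsub (hΩsub hz).2).1⟩
  obtain ⟨s, hs, hsq, hsh⟩ := hlift.exists_normalized R hC hΩo hψinj x hh
  -- the Weyl structure `u ↦ s(χ u) · τ u` and the scale `exp (h(χ u) - log λ(τ u))`
  let χ : B₀ → EuclideanSpace ℝ (Fin m) := fun u => φ (S.π₀.proj u)
  have hU : IsOpen (φ.source ∩ φ ⁻¹' Ω) :=
    (continuousOn_extChartAt x).isOpen_inter_preimage (isOpen_extChartAt_source x) hΩo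
  have hUV : φ.source ∩ φ ⁻¹' Ω ⊆ V := fun y hy => by
    have h1 := (hΩsub hy.2).2
    change φ.symm (φ y) ∈ V at h1
    rwa [φ.left_inv hy.1] at h1
  have hUo : IsOpen (S.π₀.proj ⁻¹' (φ.source ∩ φ ⁻¹' Ω)) :=
    hU.preimage S.π₀.contMDiff_proj.continuous
  have hχ : ContMDiffOn (𝓡 b0) (𝓡 m) ∞ χ (S.π₀.proj ⁻¹' (φ.source ∩ φ ⁻¹' Ω)) :=
    hφ.comp S.π₀.contMDiff_proj.contMDiffOn fun u hu => hu.1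
  have hτU : ContMDiffOn (𝓡 b0) (𝓡 n0) ∞ τ (S.π₀.proj ⁻¹' (φ.source ∩ φ ⁻¹' Ω)) :=
    hτ.mono fun u hu => hUV hu
  have hχψ : ∀ u, S.π₀.proj u ∈ φ.source ∩ φ ⁻¹' Ω → φ.symm (χ u) = S.π₀.proj u :=
    fun u hu => φ.left_inv hu.1
  have hdχ : ∀ u, S.π₀.proj u ∈ φ.source ∩ φ ⁻¹' Ω → MDifferentiableAt (𝓡 b0) (𝓡 m) χ u :=
    fun u hu => (hχ.contMDiffAt (hUo.mem_nhds hu)).mdifferentiableAt (by simp)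
  have hdτ : ∀ u, S.π₀.proj u ∈ φ.source ∩ φ ⁻¹' Ω → MDifferentiableAt (𝓡 b0) (𝓡 n0) τ u :=
    fun u hu => (hτU.contMDiffAt (hUo.mem_nhds hu)).mdifferentiableAt (by simp)
  have hΛ : ContMDiffOn (𝓡 b0) 𝓘(ℝ, ℝ) ∞ (fun u => h (χ u) - R.logLam (τ u))
      (S.π₀.proj ⁻¹' (φ.source ∩ φ ⁻¹' Ω)) :=
    ((contMDiffOn_iff_contDiffOn.2 hh).comp hχ fun u hu => hu.2).sub
      (R.contMDiff_logLam.comp_contMDiffOn hτU)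
  have hdΛ : ∀ u, S.π₀.proj u ∈ φ.source ∩ φ ⁻¹' Ω →
      MDifferentiableAt (𝓡 b0) 𝓘(ℝ, ℝ) (fun u => h (χ u) - R.logLam (τ u)) u :=
    fun u hu => (hΛ.contMDiffAt (hUo.mem_nhds hu)).mdifferentiableAt (by simp)
  refine ⟨φ.source ∩ φ ⁻¹' Ω, hU, ⟨mem_extChartAt_source x, hxΩ⟩,
    fun u => C.π.act (s (χ u)) (T.j (τ u)), fun u => Real.exp (h (χ u) - R.logLam (τ u)),
    ⟨⟨?_, fun u hu => ?_, fun u g hu => ?_⟩, ⟨?_, fun u hu => Real.exp_pos _, fun u g hu => ?_⟩,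
      fun u hu ξ => ?_⟩, fun u hu => ?_⟩
  · exact C.π.contMDiff_act.comp_contMDiffOn ((hs.contMDiffOn.comp hχ fun u hu => hu.2).prodMk
      (T.closed_G₀.contMDiff.comp_contMDiffOn hτU))
  · rw [hC.q_act, hsq _ hu.2, hχψ u hu]
    exact hact u (hUV hu)
  · change C.π.act (s (φ (S.π₀.proj (S.π₀.act u g)))) (T.j (τ (S.π₀.act u g))) = _
    rw [S.π₀.proj_act, hτact u (hUV hu), map_mul, C.π.act_mul]
  · exact Real.contDiff_exp.contMDiff.comp_contMDiffOn hΛ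
  · change Real.exp (h (φ (S.π₀.proj (S.π₀.act u g))) - R.logLam (τ (S.π₀.act u g))) = _
    rw [S.π₀.proj_act, hτact u (hUV hu), R.logLam_mul, ← sub_sub, sub_eq_add_neg _ (R.logLam g),
      Real.exp_add, Real.exp_neg, ScaleRep.logLam, ScaleRep.logLam, Real.exp_log (R.lam_pos g),
      mul_comm]
  · have h1 := killingForm_formAt_extension R hΩo hs hh hsh (hdχ u hu) (hdτ u hu) hu.2 ξ
    have h2 := T.killingForm_comp 0 R.E_mem
    rw [neg_zero] at h2
    rw [h2]
    refine h1.trans ?_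
    have h3 : ∀ a d : ℝ, 0 < d → -a = -(d * a) / d := fun a d hd => by
      rw [← mul_neg, mul_div_cancel_left₀ _ hd.ne']
    refine (h3 _ _ (Real.exp_pos (h (χ u) - R.logLam (τ u)))).trans ?_
    exact congrArg (fun a => -a / Real.exp (h (χ u) - R.logLam (τ u)))
      (differential_exp (hdΛ u hu) ξ).symm
  · refine (differential_exp (hdΛ u hu) (X.X₀ u)).trans ?_
    have h1 := ((hasModelDerivAt_iff_hasFDerivAt.2
        ((hh.contDiffAt (hΩo.mem_nhds hu.2)).differentiableAt (by simp)).hasFDerivAt).comp_of_eq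
          (hasModelDerivAt_modelDeriv (hdχ u hu)) rfl).sub
        (hasModelDerivAt_modelDeriv
          ((R.contMDiff_logLam.mdifferentiable (by simp) (τ u)).comp u (hdτ u hu)))
    have h2 : modelDeriv (𝓡 b0) (𝓡 m) χ u (X.X₀ u) = F (χ u) := by
      have h3 := (hasModelDerivAt_modelDeriv ((hφ.contMDiffAt
        ((isOpen_extChartAt_source x).mem_nhds hu.1)).mdifferentiableAt (by simp))).comp_of_eq
        (hasModelDerivAt_modelDeriv (S.π₀.contMDiff_proj.mdifferentiable (by simp) u)) rfl
      refine (congrArg (fun L : EuclideanSpace ℝ (Fin b0) →L[ℝ] EuclideanSpace ℝ (Fin m) =>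
        L (X.X₀ u)) h3.modelDeriv_eq).trans ?_
      have h4 : F (χ u) = modelDeriv (𝓡 m) (𝓡 m) φ (S.π₀.proj u) (X.X (S.π₀.proj u)) := by
        change modelDeriv (𝓡 m) (𝓡 m) φ (φ.symm (χ u)) (X.X (φ.symm (χ u))) = _
        rw [hχψ u hu]
      rw [h4]
      exact congrArg (modelDeriv (𝓡 m) (𝓡 m) φ (S.π₀.proj u)) (X.lifts u)
    have h5 : modelDeriv (𝓡 b0) 𝓘(ℝ, ℝ) (fun v => R.logLam (τ v)) u (X.X₀ u) = c (χ u) := by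
      have h6 := modelDeriv_logLam_act R X hV hτ hτact (u := q (e₁ (S.π₀.proj u)))
        (by rw [he₀p _ (hVsub (hUV hu))]; exact hUV hu) (τ u)
      rw [hact u (hUV hu)] at h6
      refine h6.trans ?_
      change _ = modelDeriv (𝓡 b0) 𝓘(ℝ, ℝ) (fun v => R.logLam (τ v)) (q (e₁ (φ.symm (χ u))))
        (X.X₀ (q (e₁ (φ.symm (χ u)))))
      rw [hχψ u hu]
    have h7 : modelDeriv (𝓡 b0) 𝓘(ℝ, ℝ) (fun u => h (χ u) - R.logLam (τ u)) u (X.X₀ u) =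
        fderiv ℝ h (χ u) (modelDeriv (𝓡 b0) (𝓡 m) χ u (X.X₀ u)) -
          modelDeriv (𝓡 b0) 𝓘(ℝ, ℝ) (fun v => R.logLam (τ v)) u (X.X₀ u) :=
      congrArg (fun L : EuclideanSpace ℝ (Fin b0) →L[ℝ] ℝ => L (X.X₀ u)) h1.modelDeriv_eq
    rw [h7, h2, h5, hhF _ hu.2, sub_self, mul_zero]

end Inessential

end Parabolic

theorem proposition4p3 {nG nP n0 m b b0 : ℕ} {G P G₀ M B B₀ : Type*}
    [TopologicalSpace G] [ChartedSpace (EuclideanSpace ℝ (Fin nG)) G] [Group G]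
    [LieGroup (𝓡 nG) ∞ G]
    [TopologicalSpace P] [ChartedSpace (EuclideanSpace ℝ (Fin nP)) P] [Group P]
    [LieGroup (𝓡 nP) ∞ P]
    [TopologicalSpace G₀] [ChartedSpace (EuclideanSpace ℝ (Fin n0)) G₀] [Group G₀]
    [LieGroup (𝓡 n0) ∞ G₀]
    [TopologicalSpace M] [T2Space M] [ChartedSpace (EuclideanSpace ℝ (Fin m)) M]
    [IsManifold (𝓡 m) ∞ M]
    [TopologicalSpace B] [ChartedSpace (EuclideanSpace ℝ (Fin b)) B] [IsManifold (𝓡 b) ∞ B]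
    [TopologicalSpace B₀] [ChartedSpace (EuclideanSpace ℝ (Fin b0)) B₀]
    [IsManifold (𝓡 b0) ∞ B₀]
    (T : Parabolic.ParabolicType nG nP n0 G P G₀) (R : Parabolic.ScaleRep T)
    (S : Parabolic.FlagStructure T m b0 M B₀) (hS : S.IsRegular)
    (C : Parabolic.Geometry T m b M B) (q : B → B₀) (hC : C.Induces S q)
    (hreg : C.IsRegular) (hnorm : C.IsNormal)
    (X : S.InfAut) (x : M) (hx : X.X x ≠ 0) :
    ∃ U : Set M, IsOpen U ∧ x ∈ U ∧ Parabolic.InessentialOn C R q X U :=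
  Parabolic.exists_isOpen_inessentialOn R hC X hx
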